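/- **Languages.** Let $\mathcal L=\mathcal L_{\mathrm{DLE}}(\mathcal F,\mathcal G)$ be a language of distributive lattice expansions: terms are built from denumerably many proposition letters, $\bot,\top,\wedge,\vee$ and connectives $f\in\mathcal F$, $g\in\mathcal G$, each with a finite arity and an order-type $\varepsilon_f,\varepsilon_g$ with values in $\{1,\partial\}$. The language $\mathcal L^*$ adds: the right residuals $\to,\leftarrow$ of $\wedge$ (in $\mathcal G^*$); the left residuals of $\vee$ in its two coordinates (in $\mathcal F^*$); for each $f$ and coordinate $i$ the residual $f^\sharp_i$ (in $\mathcal G^*$ if $\varepsilon_f(i)=1$, in $\mathcal F^*$ if $\varepsilon_f(i)=\partial$); for each $g$ and $i$ the residual $g^\flat_i$ (in $\mathcal F^*$ if $\varepsilon_g(i)=1$, in $\mathcal G^*$ if $\varepsilon_g(i)=\partial$), with the corresponding order-types. A perfect algebra is a complete, completely distributive lattice, completely join-generated by its completely join-prime elements, with operations $f$ (resp. $g$) which in each coordinate of order-type $1$ preserve all joins (resp. meets) and in each coordinate of order-type $\partial$ turn all meets into joins (resp. joins into meets); $\mathcal L^*$ is interpreted by the residuals. Nominals (conominals) are extra variables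 ranging over the completely join-irreducible (meet-irreducible) elements. **Signed trees.** The root of a term is signed $+$ or $-$; the sign is kept at $\wedge,\vee$ and at coordinates of order-type $1$, and flipped at coordinates of order-type $\partial$. Skeleton nodes are $\pm\wedge,\pm\vee,+f,-g$; PIA nodes are $\pm\wedge,\pm\vee,+g,-f$. Fix $\epsilon$ assigning $1$ or $\partial$ to each proposition letter, and an irreflexive transitive relation $\Omega$ on the letters. A leaf $+p$ with $\epsilon(p)=1$, or $-p$ with $\epsilon(p)=\partial$, is critical. * A signed term is *uniform PIA* if it is built from non-critical letters, $\bot$ and $\top$ by PIA nodes. * A signed term is *critical PIA* if it is a critical letter; or $+(\phi\wedge\phi')$ or $-(\phi\vee\phi')$ with both children critical PIA, or one of them critical PIA and the other the neutral constant ($\top$ resp. $\bot$); or has root $+\vee$, $-\wedge$, $+g$ or $-f$ with exactly one distinguished child critical PIA, all other children uniform PIA, and every letter of these $\Omega$-below every letter having a critical occurrence in the distinguished child. * A signed term is *restricted analytic* if it consists of Skeleton nodes and constants to which only critical PIA subtrees are attached. * $s\le t$ is *restricted left-analytic* (resp. *right-analytic*) $(\Omega,\epsilon)$-*inductive* if the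 head $+s$ (resp. $-t$) is restricted analytic, and the tail $-t$ (resp. $+s$) is of the same form except that exactly one uniform PIA subtree $\gamma$ is attached to its Skeleton. **Primitive inequalities.** Left-primitive terms $\psi$ and right-primitive terms $\phi$ are given by $\psi::=x\mid\top\mid\psi\vee\psi\mid\psi\wedge\psi\mid f(\ldots)$ and $\phi::=x\mid\bot\mid\phi\wedge\phi\mid\phi\vee\phi\mid g(\ldots)$, where in $f(\ldots)$ the coordinates of order-type $1$ carry $\psi$'s and those of order-type $\partial$ carry $\phi$'s, and in $g(\ldots)$ vice versa. An inequality $s_1\le s_2$ is left- (resp. right-) primitive if both sides are left- (resp. right-) primitive, each variable occurs at most once in $s_1$ (resp. $s_2$), $s_1$ and $s_2$ have the same order-type on common variables, and each variable occurs in $s_2$ (resp. $s_1$) with only one sign. It is pure if no proposition letter occurs in it. **ALBA** transforms finite families of quasi-inequalities of $\mathcal L^*$ with nominals and conominals. Its *reduction rules*, used in both directions, are: residuation; distribution of $\wedge,\vee$ and all connectives, and the laws for $\bot,\top$, inside terms; splitting of $\alpha\le\beta\wedge\gamma$ and $\alpha\vee\beta\le\gamma$; removal of lattice tautologies; first approximation,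 of the left and of the right side of the conclusion; approximation of one argument of a connective of $\mathcal F^*\cup\{\wedge\}$ below a nominal, or of $\mathcal G^*\cup\{\vee\}$ above a conominal, by a fresh nominal or conominal. Its *elimination rules* are monotone and antitone variable elimination and the right and left Ackermann rules. **Statement.** Let $s\le t$ be a restricted left-analytic or right-analytic $(\Omega,\epsilon)$-inductive $\mathcal L$-inequality, and let $\gamma$ be the unique uniform PIA subtree attached to the Skeleton of its tail. 1. There is an ALBA-reduction (elimination rules used only in the eliminating direction) of $s\le t$ to a finite set $\Lambda$ of pure $\mathcal L^*$-inequalities such that $s\le t$ is valid in exactly the same perfect algebras as $\Lambda$; all members of $\Lambda$ are left-primitive if $\gamma$ is signed $-$, and all are right-primitive if $\gamma$ is signed $+$. 2. If $s\le t$ is restricted left-analytic (resp. right-analytic), then, whatever the sign of $\gamma$, there is a finite set of pure left-primitive (resp. right-primitive) $\mathcal L^*$-inequalities that is obtained from $s\le t$ by the rules of ALBA, each used in either direction, and that is valid in exactly the same perfect algebras as $s\le t$. -/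

import Mathlib

universe u v w

namespace DLE

/-! ### Signs, order-types, signatures and terms -/

/-- The two signs `+`, `-` of nodes of signed generation trees; also the two possible values
`1 = pos` and `∂ = neg` of an order-type at a coordinate. -/
inductive Pol
  | pos
  | neg
  deriving DecidableEq

/-- The opposite sign. -/
def Pol.op : Pol → Pol
  | .pos => .neg
  | .neg => .pos

/-- `σ.mul e` is the sign of a child at a coordinate of order-type `e` of a node signed `σ`. -/
def Pol.mul : Pol → Pol → Pol
  | .pos, e => e
  | .neg, e => e.op

/-- The parameters of a language of distributive lattice expansions: two disjoint families of
connectives, each connective with a (possibly zero) arity and an order-type. -/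
structure DLESig where
  F : Type u
  G : Type v
  arF : F → ℕ
  arG : G → ℕ
  εF : (f : F) → Fin (arF f) → Pol
  εG : (g : G) → Fin (arG g) → Pol

/-- Terms over a set `V` of variables. -/
inductive Tm (S : DLESig.{u, v}) (V : Type w) : Type (max u v w)
  | var (x : V) : Tm S V
  | bot : Tm S V
  | top : Tm S V
  | and (a b : Tm S V) : Tm S V
  | or (a b : Tm S V) : Tm S V
  | fapp (f : S.F) (a : Fin (S.arF f) → Tm S V) : Tm S V
  | gapp (g : S.G) (a : Fin (S.arG g) → Tm S V) : Tm S V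

namespace Tm

variable {S : DLESig.{u, v}} {V : Type w}

/-- `Occ x t`: the variable `x` occurs in `t`. -/
def Occ (x : V) : Tm S V → Prop
  | var y => y = x
  | bot => False
  | top => False
  | and a b => Occ x a ∨ Occ x b
  | or a b => Occ x a ∨ Occ x b
  | fapp _ a => ∃ i, Occ x (a i)
  | gapp _ a => ∃ i, Occ x (a i)

/-- `OccS x τ t σ`: the signed generation tree of `t` whose root is signed `σ` has a leaf labelled
with the variable `x` and signed `τ`. -/
def OccS (x : V) (τ : Pol) : Tm S V → Pol → Prop
  | var y, σ => y = x ∧ σ = τ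
  | bot, _ => False
  | top, _ => False
  | and a b, σ => OccS x τ a σ ∨ OccS x τ b σ
  | or a b, σ => OccS x τ a σ ∨ OccS x τ b σ
  | fapp f a, σ => ∃ i, OccS x τ (a i) (σ.mul (S.εF f i))
  | gapp g a, σ => ∃ i, OccS x τ (a i) (σ.mul (S.εG g i))

open Classical in
/-- The number of occurrences of the variable `x`. -/
noncomputable def count (x : V) : Tm S V → ℕ
  | var y => if y = x then 1 else 0
  | bot => 0
  | top => 0
  | and a b => count x a + count x b
  | or a b => count x a + count x b
  | fapp _ a => ∑ i, count x (a i)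
  | gapp _ a => ∑ i, count x (a i)

/-- Uniform substitution of `r` for the variable `x`. -/
noncomputable def subst [DecidableEq V] (x : V) (r : Tm S V) : Tm S V → Tm S V
  | var y => if y = x then r else var y
  | bot => bot
  | top => top
  | and a b => and (subst x r a) (subst x r b)
  | or a b => or (subst x r a) (subst x r b)
  | fapp f a => fapp f (fun i => subst x r (a i))
  | gapp g a => gapp g (fun i => subst x r (a i))

/-- The term is positive (monotone) in `x`: all occurrences are positive in its positive tree. -/
def PositiveIn (x : V) (t : Tm S V) : Prop := ¬ OccS x .neg t .pos

/-- The term is negative (antitone) in `x`. -/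
def NegativeIn (x : V) (t : Tm S V) : Prop := ¬ OccS x .pos t .pos

/-- Finite joins; the empty one is `⊥`. -/
def bigOr : List (Tm S V) → Tm S V
  | [] => bot
  | a :: l => or a (bigOr l)

/-- Finite meets; the empty one is `⊤`. -/
def bigAnd : List (Tm S V) → Tm S V
  | [] => top
  | a :: l => and a (bigAnd l)

end Tm

/-! ### The expanded language -/

/-- The family `F*`: the connectives in `F`, the left residuals of `∨` in its two coordinates,
the Galois-adjoints of `f` in the coordinates of order-type `∂`, and the left residuals of `g` in
the coordinates of order-type `1`. -/
inductive StarF (S : DLESig.{u, v}) : Type (max u v)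
  | base (f : S.F)
  | coimpR
  | coimpL
  | sharp (f : S.F) (i : Fin (S.arF f)) (h : S.εF f i = .neg)
  | flat (g : S.G) (i : Fin (S.arG g)) (h : S.εG g i = .pos)

/-- The family `G*`. -/
inductive StarG (S : DLESig.{u, v}) : Type (max u v)
  | base (g : S.G)
  | imp
  | pmi
  | sharp (f : S.F) (i : Fin (S.arF f)) (h : S.εF f i = .pos)
  | flat (g : S.G) (i : Fin (S.arG g)) (h : S.εG g i = .neg)

/-- Arities of `F*`. -/
abbrev StarF.ar {S : DLESig.{u, v}} : StarF S → ℕ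
  | .base f => S.arF f
  | .coimpR => 2
  | .coimpL => 2
  | .sharp f _ _ => S.arF f
  | .flat g _ _ => S.arG g

/-- Arities of `G*`. -/
abbrev StarG.ar {S : DLESig.{u, v}} : StarG S → ℕ
  | .base g => S.arG g
  | .imp => 2
  | .pmi => 2
  | .sharp f _ _ => S.arF f
  | .flat g _ _ => S.arG g

/-- Order-types of `F*`; `coimpR` is `b >- a` (antitone, monotone) and `coimpL` is `a -< c`
(monotone, antitone). -/
abbrev StarF.ot {S : DLESig.{u, v}} : (k : StarF S) → Fin k.ar → Pol
  | .base f => S.εF f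
  | .coimpR => ![.neg, .pos]
  | .coimpL => ![.pos, .neg]
  | .sharp f _ _ => S.εF f
  | .flat g i _ => fun (j : Fin (S.arG g)) => if j = i then .pos else (S.εG g j).op

/-- Order-types of `G*`; `imp` is `a → c` (antitone, monotone) and `pmi` is `c ← b`
(monotone, antitone). -/
abbrev StarG.ot {S : DLESig.{u, v}} : (k : StarG S) → Fin k.ar → Pol
  | .base g => S.εG g
  | .imp => ![.neg, .pos]
  | .pmi => ![.pos, .neg]
  | .sharp f i _ => fun (j : Fin (S.arF f)) => if j = i then .pos else (S.εF f j).op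
  | .flat g _ _ => S.εG g

/-- The signature of the expanded language `L*`. -/
abbrev starSig (S : DLESig.{u, v}) : DLESig.{max u v, max u v} where
  F := StarF S
  G := StarG S
  arF := StarF.ar
  arG := StarG.ar
  εF := StarF.ot
  εG := StarG.ot

/-- Variables of the language on which ALBA operates: proposition letters, nominals and
conominals. -/
inductive Var
  | prop (n : ℕ)
  | nom (n : ℕ)
  | conom (n : ℕ)
  deriving DecidableEq

/-- Terms of `L*` over proposition letters, nominals and conominals. -/
abbrev STm (S : DLESig.{u, v}) := Tm (starSig S) Var

section StarTerms

variable {S : DLESig.{u, v}}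

/-- The inclusion of the base language into the expanded one. -/
def emb : Tm S ℕ → STm S
  | .var p => .var (.prop p)
  | .bot => .bot
  | .top => .top
  | .and a b => .and (emb a) (emb b)
  | .or a b => .or (emb a) (emb b)
  | .fapp f a => .fapp (S := starSig S) (StarF.base f) (fun i => emb (a i))
  | .gapp g a => .gapp (S := starSig S) (StarG.base g) (fun i => emb (a i))

/-- `f(a)` for `f` in `F`. -/
def tF (f : S.F) (a : Fin (S.arF f) → STm S) : STm S :=
  .fapp (S := starSig S) (StarF.base f) a

/-- `g(a)` for `g` in `G`. -/
def tG (g : S.G) (a : Fin (S.arG g) → STm S) : STm S :=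
  .gapp (S := starSig S) (StarG.base g) a

/-- `b >- a`. -/
def tCoimpR (b a : STm S) : STm S := .fapp (S := starSig S) StarF.coimpR ![b, a]

/-- `a -< c`. -/
def tCoimpL (a c : STm S) : STm S := .fapp (S := starSig S) StarF.coimpL ![a, c]

/-- `a → c`. -/
def tImp (a c : STm S) : STm S := .gapp (S := starSig S) StarG.imp ![a, c]

/-- `c ← b`. -/
def tPmi (c b : STm S) : STm S := .gapp (S := starSig S) StarG.pmi ![c, b]

/-- `f♯_i(a)` when the order-type of `f` at `i` is `∂`. -/
def tSharpF (f : S.F) (i : Fin (S.arF f)) (h : S.εF f i = .neg) (a : Fin (S.arF f) → STm S) :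
    STm S := .fapp (S := starSig S) (StarF.sharp f i h) a

/-- `f♯_i(a)` when the order-type of `f` at `i` is `1`. -/
def tSharpG (f : S.F) (i : Fin (S.arF f)) (h : S.εF f i = .pos) (a : Fin (S.arF f) → STm S) :
    STm S := .gapp (S := starSig S) (StarG.sharp f i h) a

/-- `g♭_i(a)` when the order-type of `g` at `i` is `1`. -/
def tFlatF (g : S.G) (i : Fin (S.arG g)) (h : S.εG g i = .pos) (a : Fin (S.arG g) → STm S) :
    STm S := .fapp (S := starSig S) (StarF.flat g i h) a

/-- `g♭_i(a)` when the order-type of `g` at `i` is `∂`. -/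
def tFlatG (g : S.G) (i : Fin (S.arG g)) (h : S.εG g i = .neg) (a : Fin (S.arG g) → STm S) :
    STm S := .gapp (S := starSig S) (StarG.flat g i h) a

end StarTerms

/-- Inequalities of the expanded language. -/
@[ext] structure Ineq (S : DLESig.{u, v}) where
  lhs : STm S
  rhs : STm S

/-- Quasi-inequalities: a finite conjunction of inequalities implies an inequality. -/
@[ext] structure Quasi (S : DLESig.{u, v}) where
  prem : Multiset (Ineq S)
  concl : Ineq S

/-- Inequalities as quasi-inequalities without premises. -/
def Ineq.toQuasi {S : DLESig.{u, v}} (e : Ineq S) : Quasi S := ⟨0, e⟩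

/-! ### Perfect algebras, validity -/

/-- Interpretations of the connectives as operations on `A`. -/
structure Interp (S : DLESig.{u, v}) (A : Type w) where
  fI : (f : S.F) → (Fin (S.arF f) → A) → A
  gI : (g : S.G) → (Fin (S.arG g) → A) → A

/-- Completely join-prime elements. -/
def ComplJoinPrime {A : Type w} [CompleteLattice A] (j : A) : Prop :=
  ∀ X : Set A, j ≤ sSup X → ∃ x ∈ X, j ≤ x

/-- Completely join-irreducible elements. -/
def ComplJoinIrred {A : Type w} [CompleteLattice A] (j : A) : Prop :=
  ∀ X : Set A, j = sSup X → j ∈ X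

/-- Completely meet-irreducible elements. -/
def ComplMeetIrred {A : Type w} [CompleteLattice A] (m : A) : Prop :=
  ∀ X : Set A, m = sInf X → m ∈ X

/-- Perfect algebras: a complete and completely distributive lattice, completely join-generated by
its completely join-prime elements, with operations that are in each coordinate completely
join-preserving or completely meet-reversing (for `F`), respectively completely meet-preserving or
completely join-reversing (for `G`), according to the order-type. -/
structure IsPerfectDLE {S : DLESig.{u, v}} {A : Type w} [CompletelyDistribLattice A]
    (I : Interp S A) : Prop where
  joinGen : ∀ a : A, a = sSup {j | ComplJoinPrime j ∧ j ≤ a}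
  f_pos : ∀ (f : S.F) (i : Fin (S.arF f)), S.εF f i = .pos →
    ∀ (a : Fin (S.arF f) → A) (X : Set A),
      I.fI f (Function.update a i (sSup X)) = sSup ((fun x => I.fI f (Function.update a i x)) '' X)
  f_neg : ∀ (f : S.F) (i : Fin (S.arF f)), S.εF f i = .neg →
    ∀ (a : Fin (S.arF f) → A) (X : Set A),
      I.fI f (Function.update a i (sInf X)) = sSup ((fun x => I.fI f (Function.update a i x)) '' X)
  g_pos : ∀ (g : S.G) (i : Fin (S.arG g)), S.εG g i = .pos →
    ∀ (a : Fin (S.arG g) → A) (X : Set A),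
      I.gI g (Function.update a i (sInf X)) = sInf ((fun x => I.gI g (Function.update a i x)) '' X)
  g_neg : ∀ (g : S.G) (i : Fin (S.arG g)), S.εG g i = .neg →
    ∀ (a : Fin (S.arG g) → A) (X : Set A),
      I.gI g (Function.update a i (sSup X)) = sInf ((fun x => I.gI g (Function.update a i x)) '' X)

section Semantics

variable {S : DLESig.{u, v}} {A : Type w}

/-- The value of a term. -/
def eval {V : Type*} [Lattice A] [BoundedOrder A] (I : Interp S A) (h : V → A) : Tm S V → A
  | .var x => h x
  | .bot => ⊥
  | .top => ⊤
  | .and a b => eval I h a ⊓ eval I h b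
  | .or a b => eval I h a ⊔ eval I h b
  | .fapp f a => I.fI f (fun i => eval I h (a i))
  | .gapp g a => I.gI g (fun i => eval I h (a i))

/-- The interpretation of `F*`: residuals and Galois-adjoints of the given operations. -/
def starFI [CompletelyDistribLattice A] (I : Interp S A) :
    (k : StarF S) → (Fin k.ar → A) → A
  | .base f => I.fI f
  | .coimpR => fun (a : Fin 2 → A) => a 1 \ a 0
  | .coimpL => fun (a : Fin 2 → A) => a 0 \ a 1
  | .sharp f i _ => fun a => sInf {c | I.fI f (Function.update a i c) ≤ a i}
  | .flat g i _ => fun a => sInf {c | a i ≤ I.gI g (Function.update a i c)}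

/-- The interpretation of `G*`. -/
def starGI [CompletelyDistribLattice A] (I : Interp S A) :
    (k : StarG S) → (Fin k.ar → A) → A
  | .base g => I.gI g
  | .imp => fun (a : Fin 2 → A) => a 0 ⇨ a 1
  | .pmi => fun (a : Fin 2 → A) => a 1 ⇨ a 0
  | .sharp f i _ => fun a => sSup {c | I.fI f (Function.update a i c) ≤ a i}
  | .flat g i _ => fun a => sSup {c | a i ≤ I.gI g (Function.update a i c)}

/-- The interpretation of the expanded language determined by that of the base language. -/
def starInterp [CompletelyDistribLattice A] (I : Interp S A) : Interp (starSig S) A where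
  fI := starFI I
  gI := starGI I

/-- Validity of an inequality `s ≤ t` of the base language. -/
def ValidBase [CompletelyDistribLattice A] (I : Interp S A) (s t : Tm S ℕ) : Prop :=
  ∀ h : ℕ → A, eval I h s ≤ eval I h t

/-- Assignments send nominals to completely join-irreducible elements and conominals to
completely meet-irreducible elements. -/
def Admissible [CompleteLattice A] (h : Var → A) : Prop :=
  (∀ n, ComplJoinIrred (h (.nom n))) ∧ (∀ n, ComplMeetIrred (h (.conom n)))

/-- Validity of an inequality of the expanded language. -/
def Ineq.Valid [CompletelyDistribLattice A] (I : Interp S A) (e : Ineq S) : Prop :=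
  ∀ h : Var → A, Admissible h → eval (starInterp I) h e.lhs ≤ eval (starInterp I) h e.rhs

end Semantics

/-! ### Restricted analytic inductive inequalities -/

section Analytic

variable {S : DLESig.{u, v}} (Ω : ℕ → ℕ → Prop) (ε : ℕ → Pol)

/-- `UniformPIA ε t σ`: the tree `σ t` consists of PIA nodes only and no leaf of it is
`ε`-critical. -/
def UniformPIA : Tm S ℕ → Pol → Prop
  | .var p, σ => σ ≠ ε p
  | .bot, _ => True
  | .top, _ => True
  | .and a b, σ => UniformPIA a σ ∧ UniformPIA b σ
  | .or a b, σ => UniformPIA a σ ∧ UniformPIA b σ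
  | .fapp f a, σ => σ = .neg ∧ ∀ i, UniformPIA (a i) (σ.mul (S.εF f i))
  | .gapp g a, σ => σ = .pos ∧ ∀ i, UniformPIA (a i) (σ.mul (S.εG g i))

/-- Every variable of `c` lies `Ω`-below every variable with a critical occurrence in `σ b`. -/
def DepBelow (c b : Tm S ℕ) (σ : Pol) : Prop :=
  ∀ q p, c.Occ q → b.OccS p (ε p) σ → Ω q p

/-- `CritPIA Ω ε t σ`: the tree `σ t` consists of PIA nodes only, has `ε`-critical leaves, and at
each SRR node (`+∨`, `+g`, `-∧`, `-f`) the critical branches run through exactly one child,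
the remaining children being uniform (without critical leaves) and `Ω`-below the critical
variables. At `+∧` and `-∨` all children have critical leaves, or are the neutral constant. -/
def CritPIA : Tm S ℕ → Pol → Prop
  | .var p, σ => σ = ε p
  | .bot, _ => False
  | .top, _ => False
  | .and a b, .pos =>
      (CritPIA a .pos ∧ CritPIA b .pos) ∨ (a = .top ∧ CritPIA b .pos) ∨
        (CritPIA a .pos ∧ b = .top)
  | .and a b, .neg =>
      (UniformPIA ε a .neg ∧ CritPIA b .neg ∧ DepBelow Ω ε a b .neg) ∨
        (CritPIA a .neg ∧ UniformPIA ε b .neg ∧ DepBelow Ω ε b a .neg)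
  | .or a b, .pos =>
      (UniformPIA ε a .pos ∧ CritPIA b .pos ∧ DepBelow Ω ε a b .pos) ∨
        (CritPIA a .pos ∧ UniformPIA ε b .pos ∧ DepBelow Ω ε b a .pos)
  | .or a b, .neg =>
      (CritPIA a .neg ∧ CritPIA b .neg) ∨ (a = .bot ∧ CritPIA b .neg) ∨
        (CritPIA a .neg ∧ b = .bot)
  | .fapp f a, σ => σ = .neg ∧ ∃ j, CritPIA (a j) (σ.mul (S.εF f j)) ∧
      ∀ i, i ≠ j → UniformPIA ε (a i) (σ.mul (S.εF f i)) ∧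
        DepBelow Ω ε (a i) (a j) (σ.mul (S.εF f j))
  | .gapp g a, σ => σ = .pos ∧ ∃ j, CritPIA (a j) (σ.mul (S.εG g j)) ∧
      ∀ i, i ≠ j → UniformPIA ε (a i) (σ.mul (S.εG g i)) ∧
        DepBelow Ω ε (a i) (a j) (σ.mul (S.εG g j))

/-- `RestrictedAnalytic Ω ε t σ`: the tree `σ t` is restricted analytic `(Ω, ε)`-inductive. It is a
Skeleton (nodes `±∧`, `±∨`, `+f`, `-g`, and constants as leaves) to which only PIA subtrees with
critical leaves are attached. -/
def RestrictedAnalytic : Tm S ℕ → Pol → Prop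
  | .var p, σ => CritPIA Ω ε (.var p : Tm S ℕ) σ
  | .bot, _ => True
  | .top, _ => True
  | .and a b, σ => (RestrictedAnalytic a σ ∧ RestrictedAnalytic b σ) ∨ CritPIA Ω ε (.and a b) σ
  | .or a b, σ => (RestrictedAnalytic a σ ∧ RestrictedAnalytic b σ) ∨ CritPIA Ω ε (.or a b) σ
  | .fapp f a, σ => (σ = .pos ∧ ∀ i, RestrictedAnalytic (a i) (σ.mul (S.εF f i))) ∨
      CritPIA Ω ε (.fapp f a) σ
  | .gapp g a, σ => (σ = .neg ∧ ∀ i, RestrictedAnalytic (a i) (σ.mul (S.εG g i))) ∨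
      CritPIA Ω ε (.gapp g a) σ

/-- `AnalyticOneUniform Ω ε π t σ`: the tree `σ t` is analytic `(Ω, ε)`-inductive and exactly one
of the PIA subtrees attached to its Skeleton is without critical leaves (it is
`ε^∂`-uniform); the root of that subtree is signed `π`. -/
def AnalyticOneUniform (π : Pol) : Tm S ℕ → Pol → Prop
  | .var p, σ => σ = π ∧ UniformPIA ε (.var p : Tm S ℕ) σ
  | .bot, σ => σ = π
  | .top, σ => σ = π
  | .and a b, σ => (σ = π ∧ UniformPIA ε (.and a b) σ) ∨
      (AnalyticOneUniform π a σ ∧ RestrictedAnalytic Ω ε b σ) ∨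
      (RestrictedAnalytic Ω ε a σ ∧ AnalyticOneUniform π b σ)
  | .or a b, σ => (σ = π ∧ UniformPIA ε (.or a b) σ) ∨
      (AnalyticOneUniform π a σ ∧ RestrictedAnalytic Ω ε b σ) ∨
      (RestrictedAnalytic Ω ε a σ ∧ AnalyticOneUniform π b σ)
  | .fapp f a, σ => (σ = π ∧ UniformPIA ε (.fapp f a) σ) ∨
      (σ = .pos ∧ ∃ j, AnalyticOneUniform π (a j) (σ.mul (S.εF f j)) ∧
        ∀ i, i ≠ j → RestrictedAnalytic Ω ε (a i) (σ.mul (S.εF f i)))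
  | .gapp g a, σ => (σ = π ∧ UniformPIA ε (.gapp g a) σ) ∨
      (σ = .neg ∧ ∃ j, AnalyticOneUniform π (a j) (σ.mul (S.εG g j)) ∧
        ∀ i, i ≠ j → RestrictedAnalytic Ω ε (a i) (σ.mul (S.εG g i)))

/-- `s ≤ t` is restricted left-analytic `(Ω, ε)`-inductive, and the unique `ε^∂`-uniform PIA subtree
attached to the Skeleton of its tail `-t` is signed `π`. -/
def RestrictedLeftAnalytic (π : Pol) (s t : Tm S ℕ) : Prop :=
  RestrictedAnalytic Ω ε s .pos ∧ AnalyticOneUniform Ω ε π t .neg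

/-- `s ≤ t` is restricted right-analytic `(Ω, ε)`-inductive, and the unique `ε^∂`-uniform PIA
subtree attached to the Skeleton of its tail `+s` is signed `π`. -/
def RestrictedRightAnalytic (π : Pol) (s t : Tm S ℕ) : Prop :=
  RestrictedAnalytic Ω ε t .neg ∧ AnalyticOneUniform Ω ε π s .pos

end Analytic

/-! ### Primitive inequalities -/

/-- `Prim t .pos`: `t` is a left-primitive formula; `Prim t .neg`: `t` is right-primitive. -/
def Prim {S : DLESig.{u, v}} {V : Type w} : Tm S V → Pol → Prop
  | .var _, _ => True
  | .bot, σ => σ = .neg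
  | .top, σ => σ = .pos
  | .and a b, σ => Prim a σ ∧ Prim b σ
  | .or a b, σ => Prim a σ ∧ Prim b σ
  | .fapp f a, σ => σ = .pos ∧ ∀ i, Prim (a i) (σ.mul (S.εF f i))
  | .gapp g a, σ => σ = .neg ∧ ∀ i, Prim (a i) (σ.mul (S.εG g i))

/-- Each variable occurs at most once. -/
def Scattered {S : DLESig.{u, v}} {V : Type w} (t : Tm S V) : Prop := ∀ x, t.count x ≤ 1

/-- The term is `η`-uniform for some order-type `η` on its variables. -/
def Uniform {S : DLESig.{u, v}} {V : Type w} (t : Tm S V) : Prop :=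
  ∃ η : V → Pol, ∀ x τ, t.OccS x τ .pos → τ = η x

/-- The two terms have the same order-type relative to the variables they have in common. -/
def SameOrderType {S : DLESig.{u, v}} {V : Type w} (s t : Tm S V) : Prop :=
  ∀ x, s.Occ x → t.Occ x → ∀ τ, s.OccS x τ .pos ↔ t.OccS x τ .pos

/-- Left-primitive inequalities: the left-hand side is the head. -/
def Ineq.LeftPrimitive {S : DLESig.{u, v}} (e : Ineq S) : Prop :=
  Prim e.lhs .pos ∧ Prim e.rhs .pos ∧ Scattered e.lhs ∧ SameOrderType e.lhs e.rhs ∧ Uniform e.rhs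

/-- Right-primitive inequalities: the right-hand side is the head. -/
def Ineq.RightPrimitive {S : DLESig.{u, v}} (e : Ineq S) : Prop :=
  Prim e.lhs .neg ∧ Prim e.rhs .neg ∧ Scattered e.rhs ∧ SameOrderType e.lhs e.rhs ∧ Uniform e.lhs

/-- An inequality is pure if no proposition letter occurs in it. -/
def Ineq.Pure {S : DLESig.{u, v}} (e : Ineq S) : Prop :=
  ∀ n, ¬ e.lhs.Occ (.prop n) ∧ ¬ e.rhs.Occ (.prop n)

/-! ### ALBA -/

section Alba

/-- One-step rewriting at the root: distribution of `∧`, `∨` and of the connectives, and the laws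
for the constants. -/
inductive RootRew {T : DLESig.{u, v}} {V : Type w} : Tm T V → Tm T V → Prop
  | andOrL (a b c : Tm T V) : RootRew (.and (.or a b) c) (.or (.and a c) (.and b c))
  | andOrR (a b c : Tm T V) : RootRew (.and c (.or a b)) (.or (.and c a) (.and c b))
  | orAndL (a b c : Tm T V) : RootRew (.or (.and a b) c) (.and (.or a c) (.or b c))
  | orAndR (a b c : Tm T V) : RootRew (.or c (.and a b)) (.and (.or c a) (.or c b))
  | fOr (f : T.F) (i : Fin (T.arF f)) (h : T.εF f i = .pos) (a : Fin (T.arF f) → Tm T V)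
      (x y : Tm T V) : RootRew (.fapp f (Function.update a i (.or x y)))
        (.or (.fapp f (Function.update a i x)) (.fapp f (Function.update a i y)))
  | fAnd (f : T.F) (i : Fin (T.arF f)) (h : T.εF f i = .neg) (a : Fin (T.arF f) → Tm T V)
      (x y : Tm T V) : RootRew (.fapp f (Function.update a i (.and x y)))
        (.or (.fapp f (Function.update a i x)) (.fapp f (Function.update a i y)))
  | gAnd (g : T.G) (i : Fin (T.arG g)) (h : T.εG g i = .pos) (a : Fin (T.arG g) → Tm T V)
      (x y : Tm T V) : RootRew (.gapp g (Function.update a i (.and x y)))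
        (.and (.gapp g (Function.update a i x)) (.gapp g (Function.update a i y)))
  | gOr (g : T.G) (i : Fin (T.arG g)) (h : T.εG g i = .neg) (a : Fin (T.arG g) → Tm T V)
      (x y : Tm T V) : RootRew (.gapp g (Function.update a i (.or x y)))
        (.and (.gapp g (Function.update a i x)) (.gapp g (Function.update a i y)))
  | fBot (f : T.F) (i : Fin (T.arF f)) (h : T.εF f i = .pos) (a : Fin (T.arF f) → Tm T V) :
      RootRew (.fapp f (Function.update a i .bot)) .bot
  | fTop (f : T.F) (i : Fin (T.arF f)) (h : T.εF f i = .neg) (a : Fin (T.arF f) → Tm T V) :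
      RootRew (.fapp f (Function.update a i .top)) .bot
  | gTop (g : T.G) (i : Fin (T.arG g)) (h : T.εG g i = .pos) (a : Fin (T.arG g) → Tm T V) :
      RootRew (.gapp g (Function.update a i .top)) .top
  | gBot (g : T.G) (i : Fin (T.arG g)) (h : T.εG g i = .neg) (a : Fin (T.arG g) → Tm T V) :
      RootRew (.gapp g (Function.update a i .bot)) .top
  | botAnd (a : Tm T V) : RootRew (.and .bot a) .bot
  | andBot (a : Tm T V) : RootRew (.and a .bot) .bot
  | topOr (a : Tm T V) : RootRew (.or .top a) .top
  | orTop (a : Tm T V) : RootRew (.or a .top) .top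
  | topAnd (a : Tm T V) : RootRew (.and .top a) a
  | andTop (a : Tm T V) : RootRew (.and a .top) a
  | botOr (a : Tm T V) : RootRew (.or .bot a) a
  | orBot (a : Tm T V) : RootRew (.or a .bot) a

/-- Rewriting of one subterm. -/
inductive Rew {T : DLESig.{u, v}} {V : Type w} : Tm T V → Tm T V → Prop
  | root {a b : Tm T V} : RootRew a b → Rew a b
  | andL {a b : Tm T V} (c : Tm T V) : Rew a b → Rew (.and a c) (.and b c)
  | andR {a b : Tm T V} (c : Tm T V) : Rew a b → Rew (.and c a) (.and c b)
  | orL {a b : Tm T V} (c : Tm T V) : Rew a b → Rew (.or a c) (.or b c)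
  | orR {a b : Tm T V} (c : Tm T V) : Rew a b → Rew (.or c a) (.or c b)
  | f (f : T.F) (i : Fin (T.arF f)) (c : Fin (T.arF f) → Tm T V) {a b : Tm T V} : Rew a b →
      Rew (.fapp f (Function.update c i a)) (.fapp f (Function.update c i b))
  | g (g : T.G) (i : Fin (T.arG g)) (c : Fin (T.arG g) → Tm T V) {a b : Tm T V} : Rew a b →
      Rew (.gapp g (Function.update c i a)) (.gapp g (Function.update c i b))

variable {S : DLESig.{u, v}}

/-- Rules that replace one inequality by another: residuation and adjunction for the lattice
connectives, for `F` and for `G`, and rewriting of either side. -/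
inductive IneqStep : Ineq S → Ineq S → Prop
  | andImp (a b c : STm S) : IneqStep ⟨.and a b, c⟩ ⟨b, tImp a c⟩
  | andPmi (a b c : STm S) : IneqStep ⟨.and a b, c⟩ ⟨a, tPmi c b⟩
  | orCoimpR (a b c : STm S) : IneqStep ⟨a, .or b c⟩ ⟨tCoimpR b a, c⟩
  | orCoimpL (a b c : STm S) : IneqStep ⟨a, .or b c⟩ ⟨tCoimpL a c, b⟩
  | fPos (f : S.F) (i : Fin (S.arF f)) (h : S.εF f i = .pos) (a : Fin (S.arF f) → STm S)
      (x y : STm S) : IneqStep ⟨tF f (Function.update a i x), y⟩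
        ⟨x, tSharpG f i h (Function.update a i y)⟩
  | fNeg (f : S.F) (i : Fin (S.arF f)) (h : S.εF f i = .neg) (a : Fin (S.arF f) → STm S)
      (x y : STm S) : IneqStep ⟨tF f (Function.update a i x), y⟩
        ⟨tSharpF f i h (Function.update a i y), x⟩
  | gPos (g : S.G) (i : Fin (S.arG g)) (h : S.εG g i = .pos) (a : Fin (S.arG g) → STm S)
      (x y : STm S) : IneqStep ⟨y, tG g (Function.update a i x)⟩
        ⟨tFlatF g i h (Function.update a i y), x⟩
  | gNeg (g : S.G) (i : Fin (S.arG g)) (h : S.εG g i = .neg) (a : Fin (S.arG g) → STm S)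
      (x y : STm S) : IneqStep ⟨y, tG g (Function.update a i x)⟩
        ⟨x, tFlatG g i h (Function.update a i y)⟩
  | rewL {a b : STm S} (c : STm S) : Rew a b → IneqStep ⟨a, c⟩ ⟨b, c⟩
  | rewR {a b : STm S} (c : STm S) : Rew a b → IneqStep ⟨c, a⟩ ⟨c, b⟩

/-- Tautological inequalities, which can be removed. -/
inductive Taut : Ineq S → Prop
  | bot (a : STm S) : Taut ⟨.bot, a⟩
  | top (a : STm S) : Taut ⟨a, .top⟩
  | refl (a : STm S) : Taut ⟨a, a⟩
  | inl (a b : STm S) : Taut ⟨a, .or a b⟩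
  | inr (a b : STm S) : Taut ⟨b, .or a b⟩
  | fst (a b : STm S) : Taut ⟨.and a b, a⟩
  | snd (a b : STm S) : Taut ⟨.and a b, b⟩

/-- Approximation rules, which replace one premise by two. `Approx x e e₁ e₂`: the premise `e` is
replaced by `e₁` and `e₂`, and `x` is the nominal or conominal introduced. -/
inductive Approx : Var → Ineq S → Ineq S → Ineq S → Prop
  | fPos (i j : ℕ) (f : (starSig S).F) (k : Fin ((starSig S).arF f)) (h : (starSig S).εF f k = .pos)
      (a : Fin ((starSig S).arF f) → STm S) (x : STm S) :
      Approx (.nom j) ⟨.var (.nom i), .fapp f (Function.update a k x)⟩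
        ⟨.var (.nom i), .fapp f (Function.update a k (.var (.nom j)))⟩ ⟨.var (.nom j), x⟩
  | fNeg (i n : ℕ) (f : (starSig S).F) (k : Fin ((starSig S).arF f)) (h : (starSig S).εF f k = .neg)
      (a : Fin ((starSig S).arF f) → STm S) (x : STm S) :
      Approx (.conom n) ⟨.var (.nom i), .fapp f (Function.update a k x)⟩
        ⟨.var (.nom i), .fapp f (Function.update a k (.var (.conom n)))⟩ ⟨x, .var (.conom n)⟩
  | gPos (m n : ℕ) (g : (starSig S).G) (k : Fin ((starSig S).arG g)) (h : (starSig S).εG g k = .pos)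
      (a : Fin ((starSig S).arG g) → STm S) (x : STm S) :
      Approx (.conom n) ⟨.gapp g (Function.update a k x), .var (.conom m)⟩
        ⟨.gapp g (Function.update a k (.var (.conom n))), .var (.conom m)⟩ ⟨x, .var (.conom n)⟩
  | gNeg (m j : ℕ) (g : (starSig S).G) (k : Fin ((starSig S).arG g)) (h : (starSig S).εG g k = .neg)
      (a : Fin ((starSig S).arG g) → STm S) (x : STm S) :
      Approx (.nom j) ⟨.gapp g (Function.update a k x), .var (.conom m)⟩
        ⟨.gapp g (Function.update a k (.var (.nom j))), .var (.conom m)⟩ ⟨.var (.nom j), x⟩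
  | andL (i j : ℕ) (x b : STm S) :
      Approx (.nom j) ⟨.var (.nom i), .and x b⟩
        ⟨.var (.nom i), .and (.var (.nom j)) b⟩ ⟨.var (.nom j), x⟩
  | andR (i j : ℕ) (x b : STm S) :
      Approx (.nom j) ⟨.var (.nom i), .and b x⟩
        ⟨.var (.nom i), .and b (.var (.nom j))⟩ ⟨.var (.nom j), x⟩
  | orL (m n : ℕ) (x b : STm S) :
      Approx (.conom n) ⟨.or x b, .var (.conom m)⟩
        ⟨.or (.var (.conom n)) b, .var (.conom m)⟩ ⟨x, .var (.conom n)⟩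
  | orR (m n : ℕ) (x b : STm S) :
      Approx (.conom n) ⟨.or b x, .var (.conom m)⟩
        ⟨.or b (.var (.conom n)), .var (.conom m)⟩ ⟨x, .var (.conom n)⟩

/-- The variable occurs in the inequality. -/
def Ineq.Occ (x : Var) (e : Ineq S) : Prop := e.lhs.Occ x ∨ e.rhs.Occ x

/-- The variable does not occur in the quasi-inequality. -/
def Quasi.Fresh (x : Var) (q : Quasi S) : Prop := (∀ e ∈ q.prem, ¬ e.Occ x) ∧ ¬ q.concl.Occ x

/-- Substitution in an inequality. -/
noncomputable def Ineq.subst (x : Var) (r : STm S) (e : Ineq S) : Ineq S :=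
  ⟨Tm.subst x r e.lhs, Tm.subst x r e.rhs⟩

/-- The rules of ALBA that do not eliminate proposition letters, as relations between the
finite families of quasi-inequalities before and after the application of the rule: residuation,
distribution and constant rules on a premise or on the conclusion, splitting, removal of
tautologies, first approximation of the left and of the right side of the conclusion, and
approximation of a premise. -/
inductive ReductionRule : Multiset (Quasi S) → Multiset (Quasi S) → Prop
  | prem (Γ : Multiset (Ineq S)) (c e e' : Ineq S) : IneqStep e e' →
      ReductionRule {⟨e ::ₘ Γ, c⟩} {⟨e' ::ₘ Γ, c⟩}
  | concl (Γ : Multiset (Ineq S)) (e e' : Ineq S) : IneqStep e e' →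
      ReductionRule {⟨Γ, e⟩} {⟨Γ, e'⟩}
  | premAnd (Γ : Multiset (Ineq S)) (c : Ineq S) (a x y : STm S) :
      ReductionRule {⟨⟨a, .and x y⟩ ::ₘ Γ, c⟩} {⟨⟨a, x⟩ ::ₘ ⟨a, y⟩ ::ₘ Γ, c⟩}
  | premOr (Γ : Multiset (Ineq S)) (c : Ineq S) (a x y : STm S) :
      ReductionRule {⟨⟨.or x y, a⟩ ::ₘ Γ, c⟩} {⟨⟨x, a⟩ ::ₘ ⟨y, a⟩ ::ₘ Γ, c⟩}
  | conclAnd (Γ : Multiset (Ineq S)) (a x y : STm S) :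
      ReductionRule {⟨Γ, ⟨a, .and x y⟩⟩} {⟨Γ, ⟨a, x⟩⟩, ⟨Γ, ⟨a, y⟩⟩}
  | conclOr (Γ : Multiset (Ineq S)) (a x y : STm S) :
      ReductionRule {⟨Γ, ⟨.or x y, a⟩⟩} {⟨Γ, ⟨x, a⟩⟩, ⟨Γ, ⟨y, a⟩⟩}
  | premTaut (Γ : Multiset (Ineq S)) (c e : Ineq S) : Taut e →
      ReductionRule {⟨e ::ₘ Γ, c⟩} {⟨Γ, c⟩}
  | conclTaut (Γ : Multiset (Ineq S)) (e : Ineq S) : Taut e → ReductionRule {⟨Γ, e⟩} 0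
  | firstL (Γ : Multiset (Ineq S)) (a b : STm S) (i : ℕ) : Quasi.Fresh (.nom i) ⟨Γ, ⟨a, b⟩⟩ →
      ReductionRule {⟨Γ, ⟨a, b⟩⟩} {⟨⟨.var (.nom i), a⟩ ::ₘ Γ, ⟨.var (.nom i), b⟩⟩}
  | firstR (Γ : Multiset (Ineq S)) (a b : STm S) (m : ℕ) : Quasi.Fresh (.conom m) ⟨Γ, ⟨a, b⟩⟩ →
      ReductionRule {⟨Γ, ⟨a, b⟩⟩} {⟨⟨b, .var (.conom m)⟩ ::ₘ Γ, ⟨a, .var (.conom m)⟩⟩}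
  | approx (Γ : Multiset (Ineq S)) (c e e₁ e₂ : Ineq S) (x : Var) : Approx x e e₁ e₂ →
      Quasi.Fresh x ⟨e ::ₘ Γ, c⟩ →
      ReductionRule {⟨e ::ₘ Γ, c⟩} {⟨e₁ ::ₘ e₂ ::ₘ Γ, c⟩}

/-- The rules of ALBA that eliminate a proposition letter: antitone and monotone variable
elimination, and the right and left Ackermann rules. -/
inductive EliminationRule : Multiset (Quasi S) → Multiset (Quasi S) → Prop
  | varBot (a b : STm S) (p : ℕ) : a.NegativeIn (.prop p) → b.PositiveIn (.prop p) →
      EliminationRule {⟨0, ⟨a, b⟩⟩} {⟨0, Ineq.subst (.prop p) .bot ⟨a, b⟩⟩}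
  | varTop (a b : STm S) (p : ℕ) : a.PositiveIn (.prop p) → b.NegativeIn (.prop p) →
      EliminationRule {⟨0, ⟨a, b⟩⟩} {⟨0, Ineq.subst (.prop p) .top ⟨a, b⟩⟩}
  | rightAckermann (p i m : ℕ) (α : List (STm S)) (Γ : Multiset (Ineq S)) :
      (∀ a ∈ α, ¬ a.Occ (.prop p)) →
      (∀ e ∈ Γ, e.lhs.PositiveIn (.prop p) ∧ e.rhs.NegativeIn (.prop p)) →
      EliminationRule
        {⟨(α.map fun a => (⟨a, .var (.prop p)⟩ : Ineq S) : Multiset (Ineq S)) + Γ,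
          ⟨.var (.nom i), .var (.conom m)⟩⟩}
        {⟨Γ.map (Ineq.subst (.prop p) (Tm.bigOr α)), ⟨.var (.nom i), .var (.conom m)⟩⟩}
  | leftAckermann (p i m : ℕ) (α : List (STm S)) (Γ : Multiset (Ineq S)) :
      (∀ a ∈ α, ¬ a.Occ (.prop p)) →
      (∀ e ∈ Γ, e.lhs.NegativeIn (.prop p) ∧ e.rhs.PositiveIn (.prop p)) →
      EliminationRule
        {⟨(α.map fun a => (⟨.var (.prop p), a⟩ : Ineq S) : Multiset (Ineq S)) + Γ,
          ⟨.var (.nom i), .var (.conom m)⟩⟩}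
        {⟨Γ.map (Ineq.subst (.prop p) (Tm.bigAnd α)), ⟨.var (.nom i), .var (.conom m)⟩⟩}

/-- One step of an ALBA-reduction of a finite family of quasi-inequalities: the application of one
rule to some of its members. The elimination rules can be applied only in the direction in which
they eliminate a proposition letter; the other rules can be applied in both directions. -/
def AlbaStep (X Y : Multiset (Quasi S)) : Prop :=
  ∃ P Q R : Multiset (Quasi S), (ReductionRule P Q ∨ ReductionRule Q P ∨ EliminationRule P Q) ∧
    X = P + R ∧ Y = Q + R

/-- The inequality `s ≤ t` is transformed by an ALBA-reduction into the finite set `Λ` of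
inequalities. -/
def AlbaReduces (s t : Tm S ℕ) (Λ : Multiset (Ineq S)) : Prop :=
  Relation.ReflTransGen AlbaStep {Ineq.toQuasi ⟨emb s, emb t⟩} (Λ.map Ineq.toQuasi)

/-- The inequality `s ≤ t` is transformed into the finite set `Λ` of inequalities by the rules of
ALBA, where all rules can be applied in both directions. -/
def AlbaInterderivable (s t : Tm S ℕ) (Λ : Multiset (Ineq S)) : Prop :=
  Relation.EqvGen AlbaStep {Ineq.toQuasi ⟨emb s, emb t⟩} (Λ.map Ineq.toQuasi)

/-- `s ≤ t` is valid on exactly the same perfect algebras (with carriers in `Type w`) as `Λ`. -/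
def EquivalentOnPerfect (s t : Tm S ℕ) (Λ : Multiset (Ineq S)) : Prop :=
  ∀ (A : Type w) [CompletelyDistribLattice A] (I : Interp S A), IsPerfectDLE I →
    (ValidBase I s t ↔ ∀ e ∈ Λ, e.Valid I)

end Alba

end DLE

/-
The parts of the proof: signed inequalities and connectives; abstraction of the critical subtrees by
fresh nominals and conominals; isolation of the uniform subtree; Ackermann elimination; removal of
constants; exchange of left- and right-primitive inequalities; soundness of the rules.
-/

namespace DLE

/-! ### Signed inequalities and connectives -/

/-! All arguments are carried out for a sign: `sle σ a b` is a ≤ b or b ≤ a, so that head and tail,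
F and G, ∧ and ∨, nominals and conominals need one treatment only.

The reduction rules are reversible. Hence an argument of a Skeleton node can be isolated by
residuation (`exists_residual`), treated as a whole side of the inequality, and put back. In this
way `abs_of_restrictedAnalytic` replaces every critical subtree α of the head by a fresh nominal 𝐣
with premise 𝐣 ≤ α, or by a fresh conominal 𝐦 with premise α ≤ 𝐦; joins met on the way split the
quasi-inequality. In the tail, `isolate` treats the siblings along the path to γ likewise and
residuates along that path. In the end γ is alone on one side, and the other side X is built from
nominals and conominals that occur once each. A branch of a split that does not contain γ receives a
constant in its place.

Proposition letters are now confined to γ and the premises. Residuating a premise down to its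
critical leaves (`critPIA_minVal`) yields bounds v ≤ p or p ≤ v in which all letters of v are
Ω-below p. First approximation moves γ among the premises, where its letters have the sign that the
Ackermann rules require. Transitivity of Ω keeps the bounds ordered after a substitution, and
irreflexivity keeps p out of its own bounds, so the letters can be eliminated in any order
(`eliminate_letters`). Undoing the approximations leaves a pure inequality between some γ' and X.
`GPrim` records that in the trees of both sides, with the sign opposite to that of γ at the root,
nominals are positive and conominals negative; this gives primitivity and equal order-types. X is
the scattered side, and the sign of γ decides whether it stands on the left or on the right.
Constants of the wrong sign in γ' are rewritten away (`GPrim.exists_rew`).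

The other kind of primitivity comes from `exchange`: a ≤ b amounts to 𝐣 - b ≤ 𝐣 - a for a fresh
nominal 𝐣, and dually, by reduction rules alone.

Semantic equivalence follows from soundness of every step (`AlbaStep.sound`). Perfection passes to
the residuals (`IsPerfectDLE.star`), irreducible elements generate from below and from above, and
the Ackermann rules rest on monotonicity. -/

@[simp] theorem Pol.op_op (σ : Pol) : σ.op.op = σ := by cases σ <;> rfl

@[simp] theorem Pol.mul_pos (σ : Pol) : σ.mul .pos = σ := by cases σ <;> rfl

@[simp] theorem Pol.mul_neg (σ : Pol) : σ.mul .neg = σ.op := by cases σ <;> rfl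

@[simp] theorem Pol.op_mul (σ e : Pol) : σ.op.mul e = (σ.mul e).op := by
  cases σ <;> cases e <;> rfl

theorem Pol.mul_op (σ e : Pol) : σ.mul e.op = (σ.mul e).op := by
  cases σ <;> cases e <;> rfl

theorem Pol.op_ne (σ : Pol) : σ.op ≠ σ := by cases σ <;> simp [Pol.op]

theorem Pol.eq_op_of_ne {σ τ : Pol} (h : σ ≠ τ) : σ.op = τ := by
  cases σ <;> cases τ <;> simp_all [Pol.op]

section Signed

variable {S : DLESig.{u, v}}

/-- `a ≤ b` if the sign is positive, `b ≤ a` if it is negative. -/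
def sle (σ : Pol) (a b : STm S) : Ineq S :=
  match σ with
  | .pos => ⟨a, b⟩
  | .neg => ⟨b, a⟩

/-- This identity lets the two sides of an inequality exchange roles, which is how an argument for
one side is reused for the other. -/
theorem sle_op (σ : Pol) (a b : STm S) : sle σ.op a b = sle σ b a := by cases σ <;> rfl

/-- The connectives that are residuated when they are signed `σ` and stand on the left-hand side
(`σ = +`) or right-hand side (`σ = -`) of an inequality. -/
inductive Conn (S : DLESig.{u, v}) : Pol → Type (max u v)
  | f (f : S.F) : Conn S .pos
  | g (g : S.G) : Conn S .neg
  | meet (σ : Pol) : Conn S σ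

/-- The arity. -/
def Conn.ar {σ : Pol} : Conn S σ → ℕ
  | .f k => S.arF k
  | .g k => S.arG k
  | .meet _ => 2

/-- The order-type. -/
def Conn.ot {σ : Pol} : (k : Conn S σ) → Fin k.ar → Pol
  | .f k => S.εF k
  | .g k => S.εG k
  | .meet _ => fun _ => .pos

/-- `∧` for the sign `+`, `∨` for the sign `-`. -/
def meetS {T : DLESig.{u, v}} {V : Type w} (σ : Pol) (a b : Tm T V) : Tm T V :=
  match σ with
  | .pos => .and a b
  | .neg => .or a b

/-- `∨` for the sign `+`, `∧` for the sign `-`. -/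
def joinS {T : DLESig.{u, v}} {V : Type w} (σ : Pol) (a b : Tm T V) : Tm T V :=
  match σ with
  | .pos => .or a b
  | .neg => .and a b

/-- `⊤` for the sign `+`, `⊥` for the sign `-`. -/
def unitS {T : DLESig.{u, v}} {V : Type w} (σ : Pol) : Tm T V :=
  match σ with
  | .pos => .top
  | .neg => .bot

/-- `⊥` for the sign `+`, `⊤` for the sign `-`. -/
def zeroS {T : DLESig.{u, v}} {V : Type w} (σ : Pol) : Tm T V :=
  match σ with
  | .pos => .bot
  | .neg => .top

/-- Application of a connective to terms of the base language. -/
def Conn.appB {V : Type w} {σ : Pol} : (k : Conn S σ) → (Fin k.ar → Tm S V) → Tm S V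
  | .f k => fun a => .fapp k a
  | .g k => fun a => .gapp k a
  | .meet σ => fun (a : Fin 2 → Tm S V) => meetS σ (a 0) (a 1)

/-- Application of a connective to terms of the expanded language. -/
def Conn.app {σ : Pol} : (k : Conn S σ) → (Fin k.ar → STm S) → STm S
  | .f k => fun a => tF k a
  | .g k => fun a => tG k a
  | .meet σ => fun (a : Fin 2 → STm S) => meetS σ (a 0) (a 1)

theorem emb_appB {σ : Pol} (k : Conn S σ) (a : Fin k.ar → Tm S ℕ) :
    emb (k.appB a) = k.app (fun i => emb (a i)) := by
  cases k with
  | f f => rfl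
  | g g => rfl
  | meet => cases σ <;> rfl

theorem emb_joinS (σ : Pol) (a b : Tm S ℕ) : emb (joinS σ a b) = joinS σ (emb a) (emb b) := by
  cases σ <;> rfl

/-- Induction on signed terms, by whether the root can be residuated or split. -/
theorem signed_induction {P : Tm S ℕ → Pol → Prop} (var : ∀ p σ, P (.var p) σ)
    (unit : ∀ σ, P (unitS σ) σ) (zero : ∀ σ, P (zeroS σ) σ)
    (join : ∀ σ a b, P a σ → P b σ → P (joinS σ a b) σ)
    (node : ∀ σ (k : Conn S σ) (a : Fin k.ar → Tm S ℕ),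
      (∀ i, P (a i) (σ.mul (k.ot i))) → P (k.appB a) σ)
    (cof : ∀ f a, P (.fapp f a) .neg) (cog : ∀ g a, P (.gapp g a) .pos) (t : Tm S ℕ) (σ : Pol) :
    P t σ := by
  induction t generalizing σ with
  | var p => exact var p σ
  | bot => cases σ; exacts [zero .pos, unit .neg]
  | top => cases σ; exacts [unit .pos, zero .neg]
  | and a b iha ihb =>
    cases σ
    · refine node .pos (.meet .pos) (![a, b] : Fin 2 → _) ?_
      intro (i : Fin 2); fin_cases i; exacts [iha _, ihb _]
    · exact join .neg a b (iha _) (ihb _)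
  | or a b iha ihb =>
    cases σ
    · exact join .pos a b (iha _) (ihb _)
    · refine node .neg (.meet .neg) (![a, b] : Fin 2 → _) ?_
      intro (i : Fin 2); fin_cases i; exacts [iha _, ihb _]
  | fapp f a ih =>
    cases σ
    · exact node .pos (.f f) a fun i => ih i _
    · exact cof f a
  | gapp g a ih =>
    cases σ
    · exact cog g a
    · exact node .neg (.g g) a fun i => ih i _

/-- Generalized primitive terms: the admissible signed variables are given by `L`, and `c` says
whether the constants can occur with any sign. -/
def GPrim {T : DLESig.{u, v}} {V : Type w} (L : V → Pol → Prop) (c : Prop) :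
    Tm T V → Pol → Prop
  | .var x, σ => L x σ
  | .bot, σ => σ = .neg ∨ c
  | .top, σ => σ = .pos ∨ c
  | .and a b, σ => GPrim L c a σ ∧ GPrim L c b σ
  | .or a b, σ => GPrim L c a σ ∧ GPrim L c b σ
  | .fapp f a, σ => σ = .pos ∧ ∀ i, GPrim L c (a i) (σ.mul (T.εF f i))
  | .gapp g a, σ => σ = .neg ∧ ∀ i, GPrim L c (a i) (σ.mul (T.εG g i))

theorem GPrim.prim {T : DLESig.{u, v}} {V : Type w} {L : V → Pol → Prop} {t : Tm T V} {σ : Pol}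
    (h : GPrim L False t σ) : Prim t σ := by
  induction t generalizing σ with
  | var x => trivial
  | bot => simpa [GPrim, Prim] using h
  | top => simpa [GPrim, Prim] using h
  | and a b iha ihb => exact ⟨iha h.1, ihb h.2⟩
  | or a b iha ihb => exact ⟨iha h.1, ihb h.2⟩
  | fapp f a ih => exact ⟨h.1, fun i => ih i (h.2 i)⟩
  | gapp f a ih => exact ⟨h.1, fun i => ih i (h.2 i)⟩

theorem GPrim.of_occS {T : DLESig.{u, v}} {V : Type w} {L : V → Pol → Prop} {c : Prop}
    {t : Tm T V} {σ τ : Pol} {x : V} (h : GPrim L c t σ) (ho : t.OccS x τ σ) : L x τ := by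
  induction t generalizing σ with
  | var y => obtain ⟨rfl, rfl⟩ := ho; exact h
  | bot => exact ho.elim
  | top => exact ho.elim
  | and a b iha ihb => exact ho.elim (iha h.1) (ihb h.2)
  | or a b iha ihb => exact ho.elim (iha h.1) (ihb h.2)
  | fapp f a ih => obtain ⟨i, hi⟩ := ho; exact ih i (h.2 i) hi
  | gapp f a ih => obtain ⟨i, hi⟩ := ho; exact ih i (h.2 i) hi

theorem occS_op {T : DLESig.{u, v}} {V : Type w} {t : Tm T V} {σ τ : Pol} {x : V} :
    t.OccS x τ σ.op ↔ t.OccS x τ.op σ := by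
  induction t generalizing σ with
  | var y => simp only [Tm.OccS]; cases σ <;> cases τ <;> simp [Pol.op]
  | bot => rfl
  | top => rfl
  | and a b iha ihb => simp only [Tm.OccS, iha, ihb]
  | or a b iha ihb => simp only [Tm.OccS, iha, ihb]
  | fapp f a ih => simp only [Tm.OccS, Pol.op_mul, ih]
  | gapp f a ih => simp only [Tm.OccS, Pol.op_mul, ih]

theorem occ_iff_occS {T : DLESig.{u, v}} {V : Type w} {t : Tm T V} (σ : Pol) {x : V} :
    t.Occ x ↔ ∃ τ, t.OccS x τ σ := by
  induction t generalizing σ with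
  | var y => simp [Tm.OccS, Tm.Occ]
  | bot => simp [Tm.OccS, Tm.Occ]
  | top => simp [Tm.OccS, Tm.Occ]
  | and a b iha ihb => simp only [Tm.OccS, Tm.Occ, iha σ, ihb σ, exists_or]
  | or a b iha ihb => simp only [Tm.OccS, Tm.Occ, iha σ, ihb σ, exists_or]
  | fapp f a ih =>
    simp only [Tm.OccS, Tm.Occ, fun i => ih i (σ.mul (T.εF f i))]; exact exists_comm
  | gapp f a ih =>
    simp only [Tm.OccS, Tm.Occ, fun i => ih i (σ.mul (T.εG f i))]; exact exists_comm

theorem occ_iff_count {T : DLESig.{u, v}} {V : Type w} {t : Tm T V} {x : V} :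
    t.Occ x ↔ t.count x ≠ 0 := by
  induction t with
  | var y => simp [Tm.Occ, Tm.count]
  | bot => simp [Tm.Occ, Tm.count]
  | top => simp [Tm.Occ, Tm.count]
  | and a b iha ihb => simp only [Tm.Occ, Tm.count, iha, ihb]; omega
  | or a b iha ihb => simp only [Tm.Occ, Tm.count, iha, ihb]; omega
  | fapp f a ih => simp [Tm.Occ, Tm.count, ih]
  | gapp f a ih => simp [Tm.Occ, Tm.count, ih]

theorem count_app {σ : Pol} (k : Conn S σ) (a : Fin k.ar → STm S) (x : Var) :
    (k.app a).count x = ∑ i, (a i).count x := by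
  cases k with
  | f f => rfl
  | g g => rfl
  | meet => cases σ <;> exact (Fin.sum_univ_two (fun i : Fin 2 => (a i).count x)).symm

theorem gprim_app {L : Var → Pol → Prop} {c : Prop} {σ : Pol} (k : Conn S σ)
    (a : Fin k.ar → STm S) : GPrim L c (k.app a) σ ↔ ∀ i, GPrim L c (a i) (σ.mul (k.ot i)) := by
  cases k with
  | f f => simp [Conn.app, tF, GPrim]; rfl
  | g g => simp [Conn.app, tG, GPrim]; rfl
  | meet =>
    refine Iff.trans ?_ (Fin.forall_fin_two (p := fun i : Fin 2 =>
      GPrim L c (a i) (σ.mul ((Conn.meet (S := S) σ).ot i)))).symm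
    cases σ <;> rfl

/-- Every argument of a residuated connective can be isolated. -/
theorem exists_residual {σ : Pol} (k : Conn S σ) (i : Fin k.ar) (a : Fin k.ar → STm S)
    (y : STm S) : ∃ r : STm S,
      (∀ x, IneqStep (sle σ (k.app (Function.update a i x)) y) (sle (σ.mul (k.ot i)) x r)) ∧
      (∀ z, r.count z = ∑ j, (Function.update a i y j).count z) ∧
      (∀ (L : Var → Pol → Prop) (c : Prop), GPrim L c y σ.op →
        (∀ j, j ≠ i → GPrim L c (a j) (σ.mul (k.ot j))) →
        GPrim L c r (σ.mul (k.ot i)).op) := by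
  cases k with
  | f f =>
    change Fin (S.arF f) at i
    change Fin (S.arF f) → STm S at a
    rcases h : S.εF f i with _ | _
    · refine ⟨tSharpG f i h (Function.update a i y), fun x => ?_, fun z => rfl,
        fun L c hy ha => ?_⟩
      · simp only [Conn.ot, h]
        exact IneqStep.fPos f i h a x y
      · simp only [Conn.ot, h]
        refine ⟨rfl, fun (j : Fin (S.arF f)) => ?_⟩
        -- The root of the residual has the opposite sign, while its order-type is reversed at all
        -- coordinates other than `i`. The two reversals cancel, so the other arguments keep their
        -- signs.
        change GPrim L c (Function.update a i y j)
          (Pol.mul .neg (if j = i then .pos else (S.εF f j).op))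
        by_cases hj : j = i
        · subst hj; rw [if_pos rfl, Function.update_self]; exact hy
        · rw [if_neg hj, Function.update_of_ne hj, Pol.mul_op]
          exact (Pol.op_mul .neg (S.εF f j)) ▸ ha j hj
    · refine ⟨tSharpF f i h (Function.update a i y), fun x => ?_, fun z => rfl,
        fun L c hy ha => ?_⟩
      · simp only [Conn.ot, h]
        exact IneqStep.fNeg f i h a x y
      · simp only [Conn.ot, h]
        refine ⟨rfl, fun (j : Fin (S.arF f)) => ?_⟩
        -- Here the residual keeps both the root sign and the order-type of `f`, so no signs change;
        -- only the coordinate `i` now holds `y`.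
        change GPrim L c (Function.update a i y j) (Pol.mul .pos (S.εF f j))
        by_cases hj : j = i
        · subst hj; rw [h, Function.update_self]; exact hy
        · rw [Function.update_of_ne hj]; exact ha j hj
  | g g =>
    change Fin (S.arG g) at i
    change Fin (S.arG g) → STm S at a
    rcases h : S.εG g i with _ | _
    · refine ⟨tFlatF g i h (Function.update a i y), fun x => ?_, fun z => rfl,
        fun L c hy ha => ?_⟩
      · simp only [Conn.ot, h]
        exact IneqStep.gPos g i h a x y
      · simp only [Conn.ot, h]
        refine ⟨rfl, fun (j : Fin (S.arG g)) => ?_⟩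
        change GPrim L c (Function.update a i y j)
          (Pol.mul .pos (if j = i then .pos else (S.εG g j).op))
        by_cases hj : j = i
        · subst hj; rw [if_pos rfl, Function.update_self]; exact hy
        · rw [if_neg hj, Function.update_of_ne hj, Pol.mul_op]
          exact (Pol.op_mul .pos (S.εG g j)) ▸ ha j hj
    · refine ⟨tFlatG g i h (Function.update a i y), fun x => ?_, fun z => rfl,
        fun L c hy ha => ?_⟩
      · simp only [Conn.ot, h]
        exact IneqStep.gNeg g i h a x y
      · simp only [Conn.ot, h]
        refine ⟨rfl, fun (j : Fin (S.arG g)) => ?_⟩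
        change GPrim L c (Function.update a i y j) (Pol.mul .neg (S.εG g j))
        by_cases hj : j = i
        · subst hj; rw [h, Function.update_self]; exact hy
        · rw [Function.update_of_ne hj]; exact ha j hj
  | meet =>
    change Fin 2 at i
    change Fin 2 → STm S at a
    have hs : ∀ z, ∑ j, (Function.update a i y j).count z =
      (Function.update a i y 0).count z + (Function.update a i y 1).count z :=
      fun z => Fin.sum_univ_two _
    fin_cases i
    · cases σ
      · refine ⟨tPmi y (a 1), fun x => IneqStep.andPmi x (a 1) y, fun z => ?_, fun L c hy ha => ?_⟩
        · refine Eq.trans ?_ (hs z).symm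
          exact Fin.sum_univ_two (fun i : Fin 2 => Tm.count z (![y, a 1] i))
        · refine ⟨rfl, fun (j : Fin 2) => ?_⟩
          fin_cases j
          · exact hy
          · exact ha (1 : Fin 2) (show (1 : Fin 2) ≠ 0 by decide)
      · refine ⟨tCoimpL y (a 1), fun x => IneqStep.orCoimpL y x (a 1), fun z => ?_, fun L c hy ha => ?_⟩
        · refine Eq.trans ?_ (hs z).symm
          exact Fin.sum_univ_two (fun i : Fin 2 => Tm.count z (![y, a 1] i))
        · refine ⟨rfl, fun (j : Fin 2) => ?_⟩
          fin_cases j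
          · exact hy
          · exact ha (1 : Fin 2) (show (1 : Fin 2) ≠ 0 by decide)
    · cases σ
      · refine ⟨tImp (a 0) y, fun x => IneqStep.andImp (a 0) x y, fun z => ?_, fun L c hy ha => ?_⟩
        · refine Eq.trans ?_ (hs z).symm
          exact Fin.sum_univ_two (fun i : Fin 2 => Tm.count z (![a 0, y] i))
        · refine ⟨rfl, fun (j : Fin 2) => ?_⟩
          fin_cases j
          · exact ha (0 : Fin 2) (show (0 : Fin 2) ≠ 1 by decide)
          · exact hy
      · refine ⟨tCoimpR (a 0) y, fun x => IneqStep.orCoimpR y (a 0) x, fun z => ?_, fun L c hy ha => ?_⟩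
        · refine Eq.trans ?_ (hs z).symm
          exact Fin.sum_univ_two (fun i : Fin 2 => Tm.count z (![a 0, y] i))
        · refine ⟨rfl, fun (j : Fin 2) => ?_⟩
          fin_cases j
          · exact ha (0 : Fin 2) (show (0 : Fin 2) ≠ 1 by decide)
          · exact hy

end Signed

/-! ### Bounds on nominals and conominals -/

section Reduction

variable {S : DLESig.{u, v}}

/-- The index of a nominal or conominal, increased by one. -/
def Var.idx : Var → ℕ
  | .prop _ => 0
  | .nom n => n + 1
  | .conom n => n + 1

/-- The nominals and conominals in the term have index below `N`. -/
def Bd (N : ℕ) (t : STm S) : Prop := ∀ x, t.count x ≠ 0 → x.idx ≤ N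

theorem Bd.mono {N M : ℕ} {t : STm S} (h : Bd N t) (hM : N ≤ M) : Bd M t :=
  fun x hx => (h x hx).trans hM

/-- The nominals and conominals in the inequality have index below `N`. -/
def Ineq.Bd (N : ℕ) (e : Ineq S) : Prop := DLE.Bd N e.lhs ∧ DLE.Bd N e.rhs

theorem bd_sle {N : ℕ} {σ : Pol} {a b : STm S} (ha : Bd N a) (hb : Bd N b) :
    (sle σ a b).Bd N := by
  cases σ; exacts [⟨ha, hb⟩, ⟨hb, ha⟩]

/-- The nominal (for `+`) or conominal (for `-`) with index `N`. -/
def freshVar (σ : Pol) (N : ℕ) : Var :=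
  match σ with
  | .pos => .nom N
  | .neg => .conom N

@[simp] theorem idx_freshVar (σ : Pol) (N : ℕ) : (freshVar σ N).idx = N + 1 := by cases σ <;> rfl

theorem count_var {T : DLESig.{u, v}} {V : Type w} (x y : V) :
    (Tm.var y : Tm T V).count x ≠ 0 ↔ y = x := by simp [Tm.count]

theorem not_occ_freshVar {N : ℕ} {t : STm S} (h : Bd N t) (σ : Pol) : ¬ t.Occ (freshVar σ N) := by
  intro ho
  have := h _ (occ_iff_count.1 ho)
  simp at this

theorem Ineq.Bd.not_occ {N : ℕ} {e : Ineq S} (h : e.Bd N) (σ : Pol) : ¬ e.Occ (freshVar σ N) :=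
  fun ho => ho.elim (not_occ_freshVar h.1 σ) (not_occ_freshVar h.2 σ)

theorem count_emb (t : Tm S ℕ) (x : Var) : (emb t).count x ≠ 0 → ∃ p, x = .prop p ∧ t.Occ p := by
  induction t with
  | var p => intro h; exact ⟨p, by simpa [emb, Tm.count, eq_comm] using h, rfl⟩
  | bot => intro h; exact (h rfl).elim
  | top => intro h; exact (h rfl).elim
  | and a b iha ihb =>
    simp only [emb, Tm.count, Tm.Occ]; intro h
    rcases Nat.eq_zero_or_pos ((emb a).count x) with h0 | h0
    · obtain ⟨p, hp⟩ := ihb (by omega); exact ⟨p, hp.1, .inr hp.2⟩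
    · obtain ⟨p, hp⟩ := iha (by omega); exact ⟨p, hp.1, .inl hp.2⟩
  | or a b iha ihb =>
    simp only [emb, Tm.count, Tm.Occ]; intro h
    rcases Nat.eq_zero_or_pos ((emb a).count x) with h0 | h0
    · obtain ⟨p, hp⟩ := ihb (by omega); exact ⟨p, hp.1, .inr hp.2⟩
    · obtain ⟨p, hp⟩ := iha (by omega); exact ⟨p, hp.1, .inl hp.2⟩
  | fapp f a ih =>
    intro h
    obtain ⟨i, -, hi⟩ := Finset.exists_ne_zero_of_sum_ne_zero h
    obtain ⟨p, hp⟩ := ih i hi; exact ⟨p, hp.1, i, hp.2⟩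
  | gapp f a ih =>
    intro h
    obtain ⟨i, -, hi⟩ := Finset.exists_ne_zero_of_sum_ne_zero h
    obtain ⟨p, hp⟩ := ih i hi; exact ⟨p, hp.1, i, hp.2⟩

/-- Letters have index 0, so terms of the base language satisfy every bound; in particular the bound
0 can be used at the start. -/
theorem bd_emb (N : ℕ) (t : Tm S ℕ) : Bd N (emb t) := by
  intro x hx
  obtain ⟨p, rfl, -⟩ := count_emb t x hx
  exact Nat.zero_le _

/-- Every variable is counted at most once and the counted variables have index in the interval
`[lo, hi)`. -/
def Slot (lo hi : ℕ) (c : Var → ℕ) : Prop := ∀ x, c x ≤ 1 ∧ (c x ≠ 0 → lo < x.idx ∧ x.idx ≤ hi)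

/-- The two intervals of indices are disjoint, so no variable is counted on both sides. This is the
source of scatteredness. -/
theorem Slot.add {lo mid hi : ℕ} {c d : Var → ℕ} (hc : Slot lo mid c) (hd : Slot mid hi d)
    (h₁ : lo ≤ mid) (h₂ : mid ≤ hi) : Slot lo hi (fun x => c x + d x) := by
  intro x
  have := hc x
  have := hd x
  refine ⟨?_, fun h => ?_⟩ <;> simp only at * <;>
  · by_cases h0 : c x = 0 <;> by_cases h1 : d x = 0 <;> simp_all <;> omega

theorem Slot.bd {lo hi : ℕ} {t : STm S} (h : Slot lo hi (fun x => t.count x)) : Bd hi t :=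
  fun x hx => ((h x).2 hx).2

theorem slot_zero (lo hi : ℕ) : Slot lo hi (fun _ => 0) := fun x => by simp

/-- The sign-respecting variables of pure terms: nominals are positive, conominals are negative. -/
def NomSign : Var → Pol → Prop
  | .prop _, _ => False
  | .nom _, σ => σ = .pos
  | .conom _, σ => σ = .neg

theorem nomSign_freshVar (σ : Pol) (N : ℕ) : NomSign (freshVar σ N) σ := by cases σ <;> rfl

/-! ### Reductions -/

/-- The quasi-inequality reduces to a finite family of quasi-inequalities that satisfy `P`. -/
def Red (q : Quasi S) (P : Quasi S → Prop) : Prop :=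
  ∃ Y : Multiset (Quasi S), Relation.ReflTransGen AlbaStep {q} Y ∧ ∀ q' ∈ Y, P q'

theorem AlbaStep.add {X Y : Multiset (Quasi S)} (h : AlbaStep X Y) (Z : Multiset (Quasi S)) :
    AlbaStep (X + Z) (Y + Z) := by
  obtain ⟨P, Q, R, h, rfl, rfl⟩ := h
  exact ⟨P, Q, R + Z, h, add_assoc .., add_assoc ..⟩

theorem steps_add_right {X Y : Multiset (Quasi S)} (h : Relation.ReflTransGen AlbaStep X Y)
    (Z : Multiset (Quasi S)) : Relation.ReflTransGen AlbaStep (X + Z) (Y + Z) :=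
  h.lift (· + Z) fun _ _ h => h.add Z

theorem steps_add {X Y X' Y' : Multiset (Quasi S)} (h : Relation.ReflTransGen AlbaStep X Y)
    (h' : Relation.ReflTransGen AlbaStep X' Y') :
    Relation.ReflTransGen AlbaStep (X + X') (Y + Y') := by
  refine (steps_add_right h X').trans ?_
  rw [add_comm Y, add_comm Y]
  exact steps_add_right h' Y

theorem ReductionRule.step {P Q : Multiset (Quasi S)} (h : ReductionRule P Q) : AlbaStep P Q :=
  ⟨P, Q, 0, .inl h, (add_zero _).symm, (add_zero _).symm⟩

theorem ReductionRule.step_symm {P Q : Multiset (Quasi S)} (h : ReductionRule P Q) :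
    AlbaStep Q P :=
  ⟨Q, P, 0, .inr (.inl h), (add_zero _).symm, (add_zero _).symm⟩

theorem EliminationRule.step {P Q : Multiset (Quasi S)} (h : EliminationRule P Q) : AlbaStep P Q :=
  ⟨P, Q, 0, .inr (.inr h), (add_zero _).symm, (add_zero _).symm⟩

theorem Red.pure {q : Quasi S} {P : Quasi S → Prop} (h : P q) : Red q P :=
  ⟨{q}, .refl, by simpa using h⟩

/-- A step acts on a part of the family and leaves the rest alone, so the members can be reduced
independently of each other. -/
theorem red_family {X : Multiset (Quasi S)} {P : Quasi S → Prop} (h : ∀ q ∈ X, Red q P) :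
    ∃ Y : Multiset (Quasi S), Relation.ReflTransGen AlbaStep X Y ∧ ∀ q' ∈ Y, P q' := by
  induction X using Multiset.induction_on with
  | empty => exact ⟨0, .refl, by simp⟩
  | cons q X ih =>
    obtain ⟨Y, hY, hP⟩ := ih fun q' hq' => h q' (Multiset.mem_cons_of_mem hq')
    obtain ⟨Z, hZ, hP'⟩ := h q (Multiset.mem_cons_self q X)
    refine ⟨Z + Y, ?_, fun q' hq' => (Multiset.mem_add.1 hq').elim (hP' q') (hP q')⟩
    rw [← Multiset.singleton_add]
    exact steps_add hZ hY

theorem Red.bind_steps {q : Quasi S} {X : Multiset (Quasi S)} {P : Quasi S → Prop}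
    (hs : Relation.ReflTransGen AlbaStep {q} X) (h : ∀ q ∈ X, Red q P) : Red q P := by
  obtain ⟨Y, hY, hP⟩ := red_family h
  exact ⟨Y, hs.trans hY, hP⟩

theorem Red.bind {q : Quasi S} {P Q : Quasi S → Prop} (h : Red q P)
    (h' : ∀ q, P q → Red q Q) : Red q Q := by
  obtain ⟨Y, hY, hP⟩ := h
  exact Red.bind_steps hY fun q hq => h' q (hP q hq)

theorem Red.steps {q q' : Quasi S} {P : Quasi S → Prop}
    (hs : Relation.ReflTransGen AlbaStep {q} {q'}) (h : Red q' P) : Red q P :=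
  Red.bind_steps hs (by simpa using h)

theorem Red.rule {q q' : Quasi S} {P : Quasi S → Prop} (hr : ReductionRule {q} {q'})
    (h : Red q' P) : Red q P := Red.steps (.single hr.step) h

theorem Red.rule_symm {q q' : Quasi S} {P : Quasi S → Prop} (hr : ReductionRule {q'} {q})
    (h : Red q' P) : Red q P := Red.steps (.single hr.step_symm) h

theorem ReductionRule.premJoin (σ : Pol) (Γ : Multiset (Ineq S)) (c : Ineq S) (x y a : STm S) :
    ReductionRule {⟨sle σ (joinS σ x y) a ::ₘ Γ, c⟩} {⟨sle σ x a ::ₘ sle σ y a ::ₘ Γ, c⟩} := by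
  cases σ
  · exact .premOr Γ c a x y
  · exact .premAnd Γ c a x y

theorem ReductionRule.conclJoin (σ : Pol) (Γ : Multiset (Ineq S)) (x y a : STm S) :
    ReductionRule {⟨Γ, sle σ (joinS σ x y) a⟩} {⟨Γ, sle σ x a⟩, ⟨Γ, sle σ y a⟩} := by
  cases σ
  · exact .conclOr Γ a x y
  · exact .conclAnd Γ a x y

theorem Taut.zero (σ : Pol) (a : STm S) : Taut (sle σ (zeroS σ) a) := by
  cases σ
  · exact .bot a
  · exact .top a

theorem ReductionRule.first (σ : Pol) {N : ℕ} {Γ : Multiset (Ineq S)} {a b : STm S}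
    (hΓ : ∀ e ∈ Γ, ¬ e.Occ (freshVar σ N)) (ha : ¬ a.Occ (freshVar σ N))
    (hb : ¬ b.Occ (freshVar σ N)) :
    ReductionRule {⟨Γ, sle σ a b⟩}
      {⟨sle σ.op a (.var (freshVar σ N)) ::ₘ Γ, sle σ (.var (freshVar σ N)) b⟩} := by
  cases σ
  · exact .firstL Γ a b N ⟨hΓ, fun h => h.elim ha hb⟩
  · exact .firstR Γ b a N ⟨hΓ, fun h => h.elim hb ha⟩

/-! ### Abstraction of the critical subtrees of restricted analytic trees -/

variable {Ω : ℕ → ℕ → Prop} {ε : ℕ → Pol}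

/-- Premises of the form `𝐣 ≤ α` or `α ≤ 𝐦` with `α` critical PIA. -/
def CritPrem (Ω : ℕ → ℕ → Prop) (ε : ℕ → Pol) (e : Ineq S) : Prop :=
  ∃ α τ x, CritPIA Ω ε α τ ∧ NomSign x τ ∧ e = sle τ.op (emb α) (.var x)

/-- Families of such premises in which the nominals and conominals have index below `N`. -/
def Ctx (Ω : ℕ → ℕ → Prop) (ε : ℕ → Pol) (N : ℕ) (Γ : Multiset (Ineq S)) : Prop :=
  ∀ e ∈ Γ, CritPrem Ω ε e ∧ e.Bd N

theorem Ctx.mono {N M : ℕ} {Γ : Multiset (Ineq S)} (h : Ctx Ω ε N Γ) (hM : N ≤ M) :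
    Ctx Ω ε M Γ := fun e he => ⟨(h e he).1, (h e he).2.1.mono hM, (h e he).2.2.mono hM⟩

/-- The critical subtrees of `σ t` can be abstracted by fresh nominals and conominals, after
the joins in it have been split. -/
def Abs (Ω : ℕ → ℕ → Prop) (ε : ℕ → Pol) (t : STm S) (σ : Pol) : Prop :=
  ∀ (N : ℕ) (Γ : Multiset (Ineq S)) (X : STm S), Ctx Ω ε N Γ → Bd N X →
    Red ⟨Γ, sle σ t X⟩ (fun q => ∃ N' Γ' t', N ≤ N' ∧ Ctx Ω ε N' Γ' ∧ GPrim NomSign False t' σ ∧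
      Slot N N' (fun x => t'.count x) ∧ q = ⟨Γ', sle σ t' X⟩)

/-- One first approximation suffices: the subtree becomes a new critical premise and a fresh
variable takes its place. -/
theorem abs_of_critPIA {α : Tm S ℕ} {σ : Pol} (h : CritPIA Ω ε α σ) : Abs Ω ε (emb α) σ := by
  intro N Γ X hΓ hX
  refine Red.rule (.first σ (fun e he => (hΓ e he).2.not_occ σ)
    (not_occ_freshVar (bd_emb N α) σ) (not_occ_freshVar hX σ)) (Red.pure ?_)
  have hb : Bd (N + 1) (.var (freshVar σ N) : STm S) := by
    intro x hx; rw [count_var] at hx; simp [← hx]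
  refine ⟨N + 1, _, .var (freshVar σ N), N.le_succ, ?_, nomSign_freshVar σ N, fun x => ⟨?_, fun hx => ?_⟩, rfl⟩
  · intro e he
    rcases Multiset.mem_cons.1 he with rfl | he
    · exact ⟨⟨α, σ, _, h, nomSign_freshVar σ N, rfl⟩, bd_sle (bd_emb _ _) hb⟩
    · exact hΓ.mono N.le_succ e he
  · simp only [Tm.count]; split <;> omega
  · rw [count_var] at hx; simp [← hx]

theorem abs_unit (σ : Pol) : Abs Ω ε (unitS σ : STm S) σ := by
  intro N Γ X hΓ hX
  refine Red.pure ⟨N, Γ, _, le_rfl, hΓ, ?_, ?_, rfl⟩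
  · cases σ; exacts [.inl rfl, .inl rfl]
  · cases σ <;> exact slot_zero N N

/-- The conclusion is a tautology, so the quasi-inequality disappears and the resulting family is
empty. -/
theorem abs_zero (σ : Pol) : Abs Ω ε (zeroS σ : STm S) σ := fun _ Γ X _ _ =>
  Red.bind_steps (.single (ReductionRule.conclTaut Γ _ (Taut.zero σ X)).step) (by simp)

theorem abs_join {σ : Pol} {a b : STm S} (ha : Abs Ω ε a σ) (hb : Abs Ω ε b σ) :
    Abs Ω ε (joinS σ a b) σ := by
  intro N Γ X hΓ hX
  refine Red.bind_steps (.single (ReductionRule.conclJoin σ Γ a b X).step) fun q hq => ?_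
  simp only [Multiset.insert_eq_cons, Multiset.mem_cons, Multiset.mem_singleton] at hq
  rcases hq with rfl | rfl
  -- The two parts are separate quasi-inequalities, so both may draw fresh variables from the same
  -- index `N`.
  exacts [ha N Γ X hΓ hX, hb N Γ X hΓ hX]

theorem Bd.residual {n N : ℕ} {r y : STm S} {a : Fin n → STm S} {i : Fin n}
    (hr : ∀ z, r.count z = ∑ j, (Function.update a i y j).count z) (ha : ∀ j, j ≠ i → Bd N (a j))
    (hy : Bd N y) : Bd N r := by
  intro x hx
  rw [hr] at hx
  obtain ⟨j, -, hj⟩ := Finset.exists_ne_zero_of_sum_ne_zero hx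
  by_cases h : j = i
  · subst h; rw [Function.update_self] at hj; exact hy x hj
  · rw [Function.update_of_ne h] at hj; exact ha j h x hj

/-- Abstraction in several arguments of a residuated connective. -/
theorem abs_arguments {σ : Pol} (k : Conn S σ) (s : Finset (Fin k.ar)) (a : Fin k.ar → STm S)
    (hs : ∀ i ∈ s, Abs Ω ε (a i) (σ.mul (k.ot i))) {N : ℕ} {Γ : Multiset (Ineq S)} {X : STm S}
    (hΓ : Ctx Ω ε N Γ) (ha : ∀ i, Bd N (a i)) (hX : Bd N X) :
    Red ⟨Γ, sle σ (k.app a) X⟩ (fun q => ∃ N' Γ' a', N ≤ N' ∧ Ctx Ω ε N' Γ' ∧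
      (∀ i ∉ s, a' i = a i) ∧ (∀ i ∈ s, GPrim NomSign False (a' i) (σ.mul (k.ot i))) ∧
      Slot N N' (fun x => ∑ i ∈ s, (a' i).count x) ∧ q = ⟨Γ', sle σ (k.app a') X⟩) := by
  induction s using Finset.induction_on generalizing a N Γ with
  | empty => exact Red.pure ⟨N, Γ, a, le_rfl, hΓ, fun _ _ => rfl, by simp, slot_zero N N, rfl⟩
  | insert i s hi ih =>
    -- The residual `r` does not depend on the argument at `i`. The same rule therefore isolates `a
    -- i` and, read backwards, puts the abstracted term `t` in its place.
    obtain ⟨r, hr, hrc, -⟩ := exists_residual k i a X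
    have hrb : Bd N r := Bd.residual hrc (fun j _ => ha j) hX
    have h0 := hr (a i)
    rw [Function.update_eq_self] at h0
    refine Red.rule (.concl Γ _ _ h0) ?_
    refine (hs i (Finset.mem_insert_self i s) N Γ r hΓ hrb).bind ?_
    rintro _ ⟨N₁, Γ₁, t, hN₁, hΓ₁, ht, hslot, rfl⟩
    refine Red.rule_symm (.concl Γ₁ _ _ (hr t)) ?_
    -- The remaining arguments take their fresh variables from `N₁` upwards, above all those used in
    -- `t`.
    refine (ih (Function.update a i t) (fun j hj => ?_) hΓ₁ (fun j => ?_) (hX.mono hN₁)).bind ?_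
    · rw [Function.update_of_ne (by rintro rfl; exact hi hj)]
      exact hs j (Finset.mem_insert_of_mem hj)
    · by_cases h : j = i
      · subst h; rw [Function.update_self]; exact hslot.bd
      · rw [Function.update_of_ne h]; exact (ha j).mono hN₁
    rintro _ ⟨N₂, Γ₂, a', hN₂, hΓ₂, ha', hg, hslot', rfl⟩
    have hi' : a' i = t := by rw [ha' i hi, Function.update_self]
    refine Red.pure ⟨N₂, Γ₂, a', hN₁.trans hN₂, hΓ₂, fun j hj => ?_, fun j hj => ?_, ?_, rfl⟩
    · rw [Finset.mem_insert, not_or] at hj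
      rw [ha' j hj.2, Function.update_of_ne hj.1]
    · rcases Finset.mem_insert.1 hj with rfl | hj
      · rw [hi']; exact ht
      · exact hg j hj
    · simp only [Finset.sum_insert hi, hi']
      exact hslot.add hslot' hN₁ hN₂

theorem abs_app {σ : Pol} (k : Conn S σ) (a : Fin k.ar → STm S) (ha : ∀ i N, Bd N (a i))
    (h : ∀ i, Abs Ω ε (a i) (σ.mul (k.ot i))) : Abs Ω ε (k.app a) σ := by
  intro N Γ X hΓ hX
  refine (abs_arguments k Finset.univ a (fun i _ => h i) hΓ (fun i => ha i N) hX).bind ?_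
  rintro _ ⟨N', Γ', a', hN, hΓ', -, hg, hslot, rfl⟩
  refine Red.pure ⟨N', Γ', k.app a', hN, hΓ', (gprim_app k a').2 fun i => hg i (Finset.mem_univ i),
    ?_, rfl⟩
  simpa only [count_app] using hslot

theorem restrictedAnalytic_join {σ : Pol} {a b : Tm S ℕ} :
    RestrictedAnalytic Ω ε (joinS σ a b) σ ↔
      (RestrictedAnalytic Ω ε a σ ∧ RestrictedAnalytic Ω ε b σ) ∨ CritPIA Ω ε (joinS σ a b) σ := by
  cases σ <;> simp only [joinS, RestrictedAnalytic]

theorem restrictedAnalytic_app {σ : Pol} {k : Conn S σ} {a : Fin k.ar → Tm S ℕ} :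
    RestrictedAnalytic Ω ε (k.appB a) σ ↔
      (∀ i, RestrictedAnalytic Ω ε (a i) (σ.mul (k.ot i))) ∨ CritPIA Ω ε (k.appB a) σ := by
  cases k with
  | f f => simp [Conn.appB, RestrictedAnalytic, Conn.ot]; rfl
  | g f => simp [Conn.appB, RestrictedAnalytic, Conn.ot]; rfl
  | meet =>
    refine Iff.trans ?_ (or_congr_left (Fin.forall_fin_two (p := fun i : Fin 2 =>
      RestrictedAnalytic Ω ε (a i) (σ.mul ((Conn.meet (S := S) σ).ot i))))).symm
    cases σ <;> simp only [Conn.appB, meetS, RestrictedAnalytic] <;> rfl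

theorem abs_of_restrictedAnalytic (t : Tm S ℕ) (σ : Pol) :
    RestrictedAnalytic Ω ε t σ → Abs Ω ε (emb t) σ := by
  induction t, σ using signed_induction with
  | var p σ => exact abs_of_critPIA
  | unit σ => intro _; cases σ <;> exact abs_unit _
  | zero σ => intro _; cases σ <;> exact abs_zero _
  | join σ a b iha ihb =>
    intro h
    rcases restrictedAnalytic_join.1 h with h | h
    · rw [emb_joinS]; exact abs_join (iha h.1) (ihb h.2)
    · exact abs_of_critPIA h
  | node σ k a ih =>
    intro h
    rcases restrictedAnalytic_app.1 h with h | h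
    · rw [emb_appB]; exact abs_app k _ (fun i N => bd_emb N _) fun i => ih i (h i)
    · exact abs_of_critPIA h
  | cof f a =>
    intro h
    exact abs_of_critPIA (h.resolve_left fun h' => by cases h'.1)
  | cog f a =>
    intro h
    exact abs_of_critPIA (h.resolve_left fun h' => by cases h'.1)

end Reduction

/-! ### Isolation of the uniform subtree of the tail -/

section Tail

variable {S : DLESig.{u, v}} {Ω : ℕ → ℕ → Prop} {ε : ℕ → Pol} {π : Pol}

theorem IneqStep.rew (σ : Pol) {a b : STm S} (c : STm S) (h : Rew a b) :
    IneqStep (sle σ a c) (sle σ b c) := by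
  cases σ; exacts [.rewL c h, .rewR c h]

theorem Rew.meet_unit {T : DLESig.{u, v}} {V : Type w} (σ : Pol) (a : Tm T V) :
    Rew (meetS σ a (unitS σ)) a := by
  cases σ; exacts [.root (.andTop a), .root (.orBot a)]

/-- Quasi-inequalities in which the uniform subtree `γ` is isolated on one side. -/
def Isolated (Ω : ℕ → ℕ → Prop) (ε : ℕ → Pol) (π : Pol) (q : Quasi S) : Prop :=
  ∃ N Γ γ X, Ctx Ω ε N Γ ∧ UniformPIA ε γ π ∧ GPrim NomSign False X π.op ∧
    Slot 0 N (fun x => X.count x) ∧ q = ⟨Γ, sle π (emb γ) X⟩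

/-- For the sign + this is the passage from A ≤ X to A ∧ ⊤ ≤ X and on to ⊤ ≤ A → X, so that ⊤ serves
as γ. For the sign - it is the dual passage with ⊥. -/
theorem isolate_unit {N : ℕ} {Γ : Multiset (Ineq S)} {A X : STm S} (hΓ : Ctx Ω ε N Γ)
    (hA : GPrim NomSign False A π) (hX : GPrim NomSign False X π.op)
    (hs : Slot 0 N (fun x => X.count x + A.count x)) :
    Red ⟨Γ, sle π A X⟩ (Isolated Ω ε π) := by
  obtain ⟨r, hr, hrc, hrg⟩ := exists_residual (Conn.meet (S := S) π) (1 : Fin 2)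
    (![A, unitS π] : Fin 2 → STm S) X
  refine Red.rule_symm (.concl Γ _ _ (.rew π X (Rew.meet_unit π A))) ?_
  have h1 : IneqStep (sle π (meetS π A (unitS π)) X) (sle π (unitS π) r) := by
    have := hr (unitS π)
    cases π <;> exact this
  refine Red.rule (.concl Γ _ _ h1) (Red.pure ⟨N, Γ, unitS π, r, hΓ, ?_, ?_, ?_, ?_⟩)
  · cases π <;> trivial
  · have := hrg NomSign False hX fun (j : Fin 2) hj => by
      fin_cases j
      · cases π <;> exact hA
      · exact absurd rfl hj
    cases π <;> exact this
  · have hc : (fun x => r.count x) = fun x => X.count x + A.count x := by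
      funext x
      rw [hrc, add_comm]
      exact Fin.sum_univ_two (fun j : Fin 2 =>
        (Function.update (![A, unitS π] : Fin 2 → STm S) (1 : Fin 2) X j).count x)
    rw [hc]; exact hs
  · cases π <;> rfl

/-- If no uniform subtree is attached then a constant plays its role. -/
theorem isolate_none {σ : Pol} {N : ℕ} {Γ : Multiset (Ineq S)} {t X : STm S}
    (ht : Abs Ω ε t σ) (hΓ : Ctx Ω ε N Γ)
    (hX : GPrim NomSign False X σ.op) (hs : Slot 0 N (fun x => X.count x)) :
    Red ⟨Γ, sle σ t X⟩ (Isolated Ω ε π) := by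
  refine (ht N Γ X hΓ hs.bd).bind ?_
  rintro _ ⟨N', Γ', A, hN, hΓ', hA, hsA, rfl⟩
  have hs' := hs.add hsA (Nat.zero_le _) hN
  by_cases h : σ = π
  · subst h; exact isolate_unit hΓ' hA hX hs'
  -- If the sign is the wrong one, the inequality is read from its other side: `X` is residuated
  -- away instead of `A`.
  · obtain rfl : σ = π.op := (Pol.eq_op_of_ne (Ne.symm h)).symm
    rw [sle_op]
    rw [Pol.op_op] at hX
    exact isolate_unit hΓ' hX hA (fun x => by beta_reduce; rw [add_comm]; exact hs' x)

theorem analyticOneUniform_join {σ : Pol} {a b : Tm S ℕ} :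
    AnalyticOneUniform Ω ε π (joinS σ a b) σ ↔ (σ = π ∧ UniformPIA ε (joinS σ a b) σ) ∨
      (AnalyticOneUniform Ω ε π a σ ∧ RestrictedAnalytic Ω ε b σ) ∨
      (RestrictedAnalytic Ω ε a σ ∧ AnalyticOneUniform Ω ε π b σ) := by
  cases σ <;> simp only [joinS, AnalyticOneUniform]

theorem analyticOneUniform_app {σ : Pol} {k : Conn S σ} {a : Fin k.ar → Tm S ℕ}
    (h : AnalyticOneUniform Ω ε π (k.appB a) σ) : (σ = π ∧ UniformPIA ε (k.appB a) σ) ∨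
      ∃ j, AnalyticOneUniform Ω ε π (a j) (σ.mul (k.ot j)) ∧
        ∀ i, i ≠ j → RestrictedAnalytic Ω ε (a i) (σ.mul (k.ot i)) := by
  cases k with
  | f f => exact h.imp_right And.right
  | g f => exact h.imp_right And.right
  | meet =>
    change Fin 2 → Tm S ℕ at a
    have h' : (σ = π ∧ UniformPIA ε ((Conn.meet (S := S) σ).appB a) σ) ∨
        (AnalyticOneUniform Ω ε π (a 0) σ ∧ RestrictedAnalytic Ω ε (a 1) σ) ∨
        (RestrictedAnalytic Ω ε (a 0) σ ∧ AnalyticOneUniform Ω ε π (a 1) σ) := by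
      cases σ <;> exact h
    refine h'.imp_right fun h => ?_
    have hm : ∀ i : Fin 2, σ.mul ((Conn.meet (S := S) σ).ot i) = σ := fun i => Pol.mul_pos σ
    rcases h with h | h
    · refine ⟨(0 : Fin 2), (hm 0).symm ▸ h.1, fun (i : Fin 2) hi => ?_⟩
      fin_cases i
      · exact absurd rfl hi
      · exact (hm 1).symm ▸ h.2
    · refine ⟨(1 : Fin 2), (hm 1).symm ▸ h.2, fun (i : Fin 2) hi => ?_⟩
      fin_cases i
      · exact (hm 0).symm ▸ h.1
      · exact absurd rfl hi

theorem isolate_uniform {σ : Pol} {t : Tm S ℕ} {N : ℕ} {Γ : Multiset (Ineq S)} {X : STm S}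
    (h : σ = π ∧ UniformPIA ε t σ) (hΓ : Ctx Ω ε N Γ)
    (hX : GPrim NomSign False X σ.op) (hs : Slot 0 N (fun x => X.count x)) :
    Red ⟨Γ, sle σ (emb t) X⟩ (Isolated Ω ε π) := by
  obtain ⟨rfl, h⟩ := h
  exact Red.pure ⟨N, Γ, t, X, hΓ, h, hX, hs, rfl⟩

/-- The path from the root of the tail to γ is followed. At a join the inequality splits; at any
other Skeleton node the siblings are abstracted first and the node is then residuated onto `X`,
which stays primitive and scattered because the siblings contain only fresh variables by then. -/
theorem isolate (t : Tm S ℕ) (σ : Pol) : AnalyticOneUniform Ω ε π t σ →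
    ∀ (N : ℕ) (Γ : Multiset (Ineq S)) (X : STm S), Ctx Ω ε N Γ →
      GPrim NomSign False X σ.op → Slot 0 N (fun x => X.count x) →
      Red ⟨Γ, sle σ (emb t) X⟩ (Isolated Ω ε π) := by
  induction t, σ using signed_induction with
  | var p σ => exact fun h N Γ X => isolate_uniform h
  | unit σ =>
    intro h N Γ X
    exact isolate_uniform ⟨by cases σ <;> exact h, by cases σ <;> trivial⟩
  | zero σ =>
    intro h N Γ X
    exact isolate_uniform ⟨by cases σ <;> exact h, by cases σ <;> trivial⟩
  | join σ a b iha ihb =>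
    intro h N Γ X hΓ hX hs
    rcases analyticOneUniform_join.1 h with h | h | h
    · exact isolate_uniform h hΓ hX hs
    all_goals
      rw [emb_joinS]
      refine Red.bind_steps (.single (ReductionRule.conclJoin σ Γ _ _ X).step) fun q hq => ?_
      simp only [Multiset.insert_eq_cons, Multiset.mem_cons, Multiset.mem_singleton] at hq
    · rcases hq with rfl | rfl
      · exact iha h.1 N Γ X hΓ hX hs
      · exact isolate_none (abs_of_restrictedAnalytic b σ h.2) hΓ hX hs
    · rcases hq with rfl | rfl
      · exact isolate_none (abs_of_restrictedAnalytic a σ h.1) hΓ hX hs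
      · exact ihb h.2 N Γ X hΓ hX hs
  | node σ k a ih =>
    intro h N Γ X hΓ hX hs
    rcases analyticOneUniform_app h with h | ⟨j, hj, h⟩
    · exact isolate_uniform h hΓ hX hs
    rw [emb_appB]
    refine (abs_arguments k (Finset.univ.erase j) _ (fun i hi => abs_of_restrictedAnalytic _ _
      (h i (Finset.ne_of_mem_erase hi))) hΓ (fun i => bd_emb N _) hs.bd).bind ?_
    rintro _ ⟨N', Γ', a', hN, hΓ', ha', hg, hs', rfl⟩
    obtain ⟨r, hr, hrc, hrg⟩ := exists_residual k j a' X
    have h0 := hr (a' j)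
    rw [Function.update_eq_self] at h0
    rw [ha' j (by simp)] at h0
    refine Red.rule (.concl Γ' _ _ h0) ?_
    refine ih j hj N' Γ' r hΓ' (hrg _ _ hX fun i hi => hg i (by simp [hi])) ?_
    have hc : (fun x => r.count x) =
        fun x => X.count x + ∑ i ∈ Finset.univ.erase j, (a' i).count x := by
      funext x
      rw [hrc, ← Finset.add_sum_erase _ _ (Finset.mem_univ j), Function.update_self]
      congr 1
      exact Finset.sum_congr rfl fun i hi => by
        rw [Function.update_of_ne (Finset.ne_of_mem_erase hi)]
    rw [hc]
    exact hs.add hs' (Nat.zero_le _) hN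
  | cof f a =>
    intro h N Γ X
    exact isolate_uniform (h.resolve_right fun h' => by cases h'.1)
  | cog f a =>
    intro h N Γ X
    exact isolate_uniform (h.resolve_right fun h' => by cases h'.1)

/-- Both kinds of inequalities are reduced to such quasi-inequalities. -/
theorem isolate_of_restricted {s t : Tm S ℕ}
    (h : RestrictedLeftAnalytic Ω ε π s t ∨ RestrictedRightAnalytic Ω ε π s t) :
    Red (Ineq.toQuasi ⟨emb s, emb t⟩) (Isolated Ω ε π) := by
  have key : ∀ (σ : Pol) (a b : Tm S ℕ), RestrictedAnalytic Ω ε a σ →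
      AnalyticOneUniform Ω ε π b σ.op →
      Red ⟨0, sle σ (emb a) (emb b)⟩ (Isolated Ω ε π) := by
    intro σ a b ha hb
    -- The head is abstracted while the tail `b` is still intact; `b` contains no nominals or
    -- conominals, so index 0 is fresh.
    refine (abs_of_restrictedAnalytic a σ ha 0 0 _ (by simp [Ctx]) (bd_emb 0 b)).bind ?_
    rintro _ ⟨N, Γ, X, -, hΓ, hX, hs, rfl⟩
    rw [← sle_op]
    exact isolate b σ.op hb N Γ X hΓ (by rwa [Pol.op_op]) hs
  exact h.elim (fun h => key .pos s t h.1 h.2) (fun h => key .neg t s h.1 h.2)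

end Tail

/-! ### Minimal valuations and Ackermann elimination -/

section Elimination

variable {S : DLESig.{u, v}} {Ω : ℕ → ℕ → Prop} {ε : ℕ → Pol} {π : Pol}

theorem Bd.of_occ {N : ℕ} {t : STm S} (h : ∀ x, t.Occ x → x.idx ≤ N) : Bd N t :=
  fun x hx => h x (occ_iff_count.2 hx)

theorem Bd.idx_le {N : ℕ} {t : STm S} (h : Bd N t) {x : Var} (hx : t.Occ x) : x.idx ≤ N :=
  h x (occ_iff_count.1 hx)

/-- Sign-respecting variables, where the sign of a proposition letter is given by `ε`. -/
def LetterSign (ε : ℕ → Pol) : Var → Pol → Prop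
  | .prop p, σ => σ = ε p
  | .nom _, σ => σ = .pos
  | .conom _, σ => σ = .neg

theorem NomSign.letterSign {x : Var} {σ : Pol} (h : NomSign x σ) : LetterSign ε x σ := by
  cases x; exacts [h.elim, h, h]

/-- A non-critical letter becomes correctly signed once the root sign is reversed, and PIA nodes
turn into Skeleton nodes. Constants are unrestricted in PIA terms, whence `True`. -/
theorem UniformPIA.gprim {t : Tm S ℕ} {σ : Pol} (h : UniformPIA ε t σ) :
    GPrim (LetterSign ε) True (emb t) σ.op := by
  induction t generalizing σ with
  | var p => exact Pol.eq_op_of_ne h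
  | bot => exact .inr trivial
  | top => exact .inr trivial
  | and a b iha ihb => exact ⟨iha h.1, ihb h.2⟩
  | or a b iha ihb => exact ⟨iha h.1, ihb h.2⟩
  | fapp f a ih =>
    obtain ⟨rfl, h⟩ := h
    exact ⟨rfl, fun i => by have := ih i (h i); rwa [← Pol.op_mul] at this⟩
  | gapp g a ih =>
    obtain ⟨rfl, h⟩ := h
    exact ⟨rfl, fun i => by have := ih i (h i); rwa [← Pol.op_mul] at this⟩

/-- The inequality expressing that `v` is below (for `ε p = 1`) or above (for `ε p = ∂`) the
letter `p`. -/
def valIneq (ε : ℕ → Pol) (pv : ℕ × STm S) : Ineq S := sle (ε pv.1) pv.2 (.var (.prop pv.1))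

/-- The conditions on a minimal valuation `v` of the letter `p`. -/
def IsMinVal (Ω : ℕ → ℕ → Prop) (ε : ℕ → Pol) (N : ℕ) (pv : ℕ × STm S) : Prop :=
  GPrim (LetterSign ε) True pv.2 (ε pv.1) ∧ (∀ q, pv.2.Occ (.prop q) → Ω q pv.1) ∧ Bd N pv.2

theorem critPIA_join {σ : Pol} {a b : Tm S ℕ} (h : CritPIA Ω ε (joinS σ a b) σ.op) :
    (CritPIA Ω ε a σ.op ∨ a = zeroS σ) ∧ (CritPIA Ω ε b σ.op ∨ b = zeroS σ) := by
  cases σ <;> simp only [joinS, Pol.op, CritPIA, zeroS] at h ⊢ <;> tauto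

theorem critPIA_app {σ : Pol} {k : Conn S σ} {a : Fin k.ar → Tm S ℕ}
    (h : CritPIA Ω ε (k.appB a) σ.op) : ∃ j, CritPIA Ω ε (a j) (σ.mul (k.ot j)).op ∧
      ∀ i, i ≠ j → UniformPIA ε (a i) (σ.mul (k.ot i)).op ∧
        DepBelow Ω ε (a i) (a j) (σ.mul (k.ot j)).op := by
  simp only [← Pol.op_mul]
  cases k with
  | f f => exact h.2
  | g f => exact h.2
  | meet =>
    change Fin 2 → Tm S ℕ at a
    have h' : (UniformPIA ε (a 0) σ.op ∧ CritPIA Ω ε (a 1) σ.op ∧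
          DepBelow Ω ε (a 0) (a 1) σ.op) ∨
        (CritPIA Ω ε (a 0) σ.op ∧ UniformPIA ε (a 1) σ.op ∧
          DepBelow Ω ε (a 1) (a 0) σ.op) := by
      cases σ <;> exact h
    have hm : ∀ i : Fin 2, σ.op.mul ((Conn.meet (S := S) σ).ot i) = σ.op :=
      fun i => Pol.mul_pos σ.op
    rcases h' with h | h
    · refine ⟨(1 : Fin 2), (hm 1).symm ▸ h.2.1, fun (i : Fin 2) hi => ?_⟩
      fin_cases i
      · exact ⟨(hm 0).symm ▸ h.1, (hm 1).symm ▸ h.2.2⟩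
      · exact absurd rfl hi
    · refine ⟨(0 : Fin 2), (hm 0).symm ▸ h.1, fun (i : Fin 2) hi => ?_⟩
      fin_cases i
      · exact absurd rfl hi
      · exact ⟨(hm 1).symm ▸ h.2.1, (hm 0).symm ▸ h.2.2⟩

theorem occS_appB {σ τ τ' : Pol} {k : Conn S σ} {a : Fin k.ar → Tm S ℕ} {p : ℕ} (j : Fin k.ar)
    (h : (a j).OccS p τ (τ'.mul (k.ot j))) : (k.appB a).OccS p τ τ' := by
  cases k with
  | f f => exact ⟨j, h⟩
  | g f => exact ⟨j, h⟩
  | meet =>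
    change Fin 2 at j
    change Fin 2 → Tm S ℕ at a
    have h' : (a j).OccS p τ τ' := by
      have := h
      rwa [show (Conn.meet (S := S) σ).ot j = .pos from rfl, Pol.mul_pos] at this
    have : (a 0).OccS p τ τ' ∨ (a 1).OccS p τ τ' := by
      fin_cases j; exacts [.inl h', .inr h']
    cases σ <;> exact this

theorem occS_joinS {σ τ τ' : Pol} {a b : Tm S ℕ} {p : ℕ} :
    (joinS σ a b).OccS p τ τ' ↔ a.OccS p τ τ' ∨ b.OccS p τ τ' := by
  cases σ <;> rfl

/-- Replacement of premises. -/
def PremSteps (Δ Δ' : Multiset (Ineq S)) : Prop := ∀ (Γ : Multiset (Ineq S)) (c : Ineq S),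
  Relation.ReflTransGen AlbaStep {(⟨Δ + Γ, c⟩ : Quasi S)} {⟨Δ' + Γ, c⟩}

theorem PremSteps.trans {Δ₁ Δ₂ Δ₃ : Multiset (Ineq S)} (h : PremSteps Δ₁ Δ₂)
    (h' : PremSteps Δ₂ Δ₃) : PremSteps Δ₁ Δ₃ := fun Γ c => (h Γ c).trans (h' Γ c)

theorem PremSteps.add {Δ₁ Δ₂ Δ₁' Δ₂' : Multiset (Ineq S)} (h : PremSteps Δ₁ Δ₁')
    (h' : PremSteps Δ₂ Δ₂') : PremSteps (Δ₁ + Δ₂) (Δ₁' + Δ₂') := by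
  intro Γ c
  have h1 := h (Δ₂ + Γ) c
  have h2 := h' (Δ₁' + Γ) c
  rw [← add_assoc, ← add_assoc] at h1 h2
  refine h1.trans ?_
  rwa [add_comm Δ₁' Δ₂, add_comm Δ₁' Δ₂']

theorem PremSteps.ineq {e e' : Ineq S} (h : IneqStep e e') : PremSteps {e} {e'} := fun Γ c => by
  simpa only [Multiset.singleton_add] using
    Relation.ReflTransGen.single (ReductionRule.prem Γ c e e' h).step

theorem PremSteps.taut {e : Ineq S} (h : Taut e) : PremSteps {e} 0 := fun Γ c => by
  simpa only [Multiset.singleton_add, zero_add] using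
    Relation.ReflTransGen.single (ReductionRule.premTaut Γ c e h).step

theorem PremSteps.join (σ : Pol) (x y a : STm S) :
    PremSteps {sle σ (joinS σ x y) a} ({sle σ x a} + {sle σ y a}) := fun Γ c => by
  simpa only [Multiset.singleton_add, Multiset.cons_add] using
    Relation.ReflTransGen.single (ReductionRule.premJoin σ Γ c x y a).step

/-- With the root sign reversed, a critical PIA term is decomposed like a Skeleton: +∧ and -∨ split,
the other nodes are residuated towards the distinguished child. The uniform siblings accumulate in
`x`. The last hypothesis is the invariant that the letters gathered so far lie Ω-below all critical
letters still to be reached. -/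
theorem critPIA_minVal (t : Tm S ℕ) (σ : Pol) : CritPIA Ω ε t σ.op →
    ∀ (N : ℕ) (x : STm S), GPrim (LetterSign ε) True x σ.op → Bd N x →
      (∀ q p, x.Occ (.prop q) → t.OccS p (ε p) σ.op → Ω q p) →
      ∃ V : Multiset (ℕ × STm S), (∀ pv ∈ V, IsMinVal Ω ε N pv) ∧
        PremSteps {sle σ (emb t) x} (V.map (valIneq ε)) := by
  induction t, σ using signed_induction with
  | var p σ =>
    intro (h : σ.op = ε p) N x hx hb hΩ
    refine ⟨{(p, x)}, ?_, ?_⟩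
    · simp only [Multiset.mem_singleton, forall_eq]
      exact ⟨h ▸ hx, fun q hq => hΩ q p hq ⟨rfl, h⟩, hb⟩
    · rw [Multiset.map_singleton, valIneq, ← h, sle_op]
      exact fun _ _ => .refl
  | unit σ => intro h; cases σ <;> exact h.elim
  | zero σ => intro h; cases σ <;> exact h.elim
  | join σ a b iha ihb =>
    intro h N x hx hb hΩ
    have key : ∀ t : Tm S ℕ, (CritPIA Ω ε t σ.op → ∀ (N : ℕ) (x : STm S),
        GPrim (LetterSign ε) True x σ.op → Bd N x →
        (∀ q p, x.Occ (.prop q) → t.OccS p (ε p) σ.op → Ω q p) →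
        ∃ V : Multiset (ℕ × STm S), (∀ pv ∈ V, IsMinVal Ω ε N pv) ∧
          PremSteps {sle σ (emb t) x} (V.map (valIneq ε))) →
        (∀ q p, x.Occ (.prop q) → t.OccS p (ε p) σ.op → Ω q p) →
        (CritPIA Ω ε t σ.op ∨ t = zeroS σ) →
        ∃ V : Multiset (ℕ × STm S), (∀ pv ∈ V, IsMinVal Ω ε N pv) ∧
          PremSteps {sle σ (emb t) x} (V.map (valIneq ε)) := by
      rintro t ih hΩ (h | rfl)
      · exact ih h N x hx hb hΩ
      -- A neutral constant yields a tautological premise, which contributes no valuation.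
      · refine ⟨0, by simp, ?_⟩
        have : Taut (sle σ (emb (zeroS σ : Tm S ℕ)) x) := by cases σ <;> exact Taut.zero _ x
        exact PremSteps.taut this
    obtain ⟨h1, h2⟩ := critPIA_join h
    obtain ⟨V, hV, hs⟩ := key a iha (fun q p hq hp => hΩ q p hq (occS_joinS.2 (.inl hp))) h1
    obtain ⟨W, hW, hs'⟩ := key b ihb (fun q p hq hp => hΩ q p hq (occS_joinS.2 (.inr hp))) h2
    refine ⟨V + W, fun pv hpv => (Multiset.mem_add.1 hpv).elim (hV pv) (hW pv), ?_⟩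
    rw [emb_joinS, Multiset.map_add]
    exact (PremSteps.join σ _ _ x).trans (hs.add hs')
  | node σ k a ih =>
    intro h N x hx hb hΩ
    obtain ⟨j, hj, hu⟩ := critPIA_app h
    obtain ⟨r, hr, hrc, hrg⟩ := exists_residual k j (fun i => emb (a i)) x
    have h0 := hr (emb (a j))
    rw [Function.update_eq_self_iff.2 rfl, ← emb_appB] at h0
    obtain ⟨V, hV, hs⟩ := ih j hj N r
      (hrg _ _ hx fun i hi => by simpa using (hu i hi).1.gprim)
      (Bd.residual hrc (fun i _ => bd_emb N _) hb) (fun q p hq hp => by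
        -- A letter of the residual comes either from the old bound, where the invariant applies, or
        -- from a uniform sibling, where the dependency condition of the node applies.
        rw [occ_iff_count, hrc] at hq
        obtain ⟨i, -, hi⟩ := Finset.exists_ne_zero_of_sum_ne_zero hq
        by_cases hij : i = j
        · subst hij
          rw [Function.update_self] at hi
          exact hΩ q p (occ_iff_count.2 hi) (occS_appB i (by rwa [Pol.op_mul]))
        · rw [Function.update_of_ne hij] at hi
          obtain ⟨q', hq', ho⟩ := count_emb _ _ hi
          cases hq'
          exact (hu i hij).2 q p ho hp)
    exact ⟨V, hV, (PremSteps.ineq h0).trans hs⟩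
  | cof f a => intro h; cases h.1
  | cog g a => intro h; cases h.1

theorem Ctx.minVal {N : ℕ} {Γ : Multiset (Ineq S)} (h : Ctx Ω ε N Γ) :
    ∃ V : Multiset (ℕ × STm S), (∀ pv ∈ V, IsMinVal Ω ε N pv) ∧
      PremSteps Γ (V.map (valIneq ε)) := by
  induction Γ using Multiset.induction_on with
  | empty => exact ⟨0, by simp, fun _ _ => .refl⟩
  | cons e Γ ih =>
    obtain ⟨V, hV, hs⟩ := ih fun e he => h e (Multiset.mem_cons_of_mem he)
    obtain ⟨⟨α, τ, x, hα, hx, rfl⟩, hb⟩ := h _ (Multiset.mem_cons_self e Γ)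
    have hbx : Bd N (.var x : STm S) := by
      cases τ; exacts [hb.1, hb.2]
    obtain ⟨W, hW, hs'⟩ := critPIA_minVal α τ.op (by rwa [Pol.op_op]) N (.var x)
      (by rw [Pol.op_op]; exact hx.letterSign) hbx (by
        -- The initial bound is a single nominal or conominal, so it contains no letters.
        rintro q p (rfl : x = _) -
        exact hx.elim)
    refine ⟨W + V, fun pv hpv => (Multiset.mem_add.1 hpv).elim (hW pv) (hV pv), ?_⟩
    rw [Multiset.map_add, ← Multiset.singleton_add]
    exact hs'.add hs

/-! ### Substitution -/

theorem occ_subst {T : DLESig.{u, v}} {V : Type w} [DecidableEq V] {x y : V} {r t : Tm T V}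
    (h : (Tm.subst x r t).Occ y) : (y ≠ x ∧ t.Occ y) ∨ (t.Occ x ∧ r.Occ y) := by
  induction t with
  | var z =>
    simp only [Tm.subst] at h
    split at h
    · exact .inr ⟨‹_›, h⟩
    · obtain rfl : z = y := h
      exact .inl ⟨‹_›, rfl⟩
  | bot => exact h.elim
  | top => exact h.elim
  | and a b iha ihb =>
    exact h.elim (fun h => (iha h).imp (.imp_right .inl) (.imp_left .inl))
      (fun h => (ihb h).imp (.imp_right .inr) (.imp_left .inr))
  | or a b iha ihb =>
    exact h.elim (fun h => (iha h).imp (.imp_right .inl) (.imp_left .inl))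
      (fun h => (ihb h).imp (.imp_right .inr) (.imp_left .inr))
  | fapp f a ih =>
    obtain ⟨i, h⟩ := h
    exact (ih i h).imp (.imp_right fun h => ⟨i, h⟩) (.imp_left fun h => ⟨i, h⟩)
  | gapp f a ih =>
    obtain ⟨i, h⟩ := h
    exact (ih i h).imp (.imp_right fun h => ⟨i, h⟩) (.imp_left fun h => ⟨i, h⟩)

theorem subst_of_not_occ {T : DLESig.{u, v}} {V : Type w} [DecidableEq V] {x : V} {r t : Tm T V}
    (h : ¬ t.Occ x) : Tm.subst x r t = t := by
  induction t with
  | var z => exact if_neg h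
  | bot => rfl
  | top => rfl
  | and a b iha ihb => simp only [Tm.Occ, not_or] at h; simp only [Tm.subst, iha h.1, ihb h.2]
  | or a b iha ihb => simp only [Tm.Occ, not_or] at h; simp only [Tm.subst, iha h.1, ihb h.2]
  | fapp f a ih =>
    simp only [Tm.Occ, not_exists] at h
    simp only [Tm.subst, fun i => ih i (h i)]
  | gapp f a ih =>
    simp only [Tm.Occ, not_exists] at h
    simp only [Tm.subst, fun i => ih i (h i)]

theorem GPrim.subst {T : DLESig.{u, v}} {V : Type w} [DecidableEq V] {L : V → Pol → Prop}
    {c : Prop} {x : V} {r t : Tm T V} {σ : Pol} (h : GPrim L c t σ)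
    (hr : ∀ τ, L x τ → GPrim L c r τ) : GPrim L c (Tm.subst x r t) σ := by
  induction t generalizing σ with
  | var z =>
    simp only [Tm.subst]
    split
    · subst_vars; exact hr σ h
    · exact h
  | bot => exact h
  | top => exact h
  | and a b iha ihb => exact ⟨iha h.1, ihb h.2⟩
  | or a b iha ihb => exact ⟨iha h.1, ihb h.2⟩
  | fapp f a ih => exact ⟨h.1, fun i => ih i (h.2 i)⟩
  | gapp f a ih => exact ⟨h.1, fun i => ih i (h.2 i)⟩

theorem subst_sle (σ : Pol) (x : Var) (r a b : STm S) :
    Ineq.subst x r (sle σ a b) = sle σ (Tm.subst x r a) (Tm.subst x r b) := by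
  cases σ <;> rfl

/-- Finite joins for the sign `+`, finite meets for the sign `-`. -/
def bigJoin {T : DLESig.{u, v}} {V : Type w} (σ : Pol) (l : List (Tm T V)) : Tm T V :=
  match σ with
  | .pos => Tm.bigOr l
  | .neg => Tm.bigAnd l

theorem occ_bigJoin {T : DLESig.{u, v}} {V : Type w} {σ : Pol} {l : List (Tm T V)} {x : V}
    (h : (bigJoin σ l).Occ x) : ∃ a ∈ l, a.Occ x := by
  induction l with
  | nil => cases σ <;> exact h.elim
  | cons a l ih =>
    have h' : a.Occ x ∨ (bigJoin σ l).Occ x := by cases σ <;> exact h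
    rcases h' with h | h
    · exact ⟨a, List.mem_cons_self, h⟩
    · obtain ⟨b, hb, hx⟩ := ih h; exact ⟨b, List.mem_cons_of_mem _ hb, hx⟩

/-- Constants must be allowed with any sign: a letter without bounds is replaced by the empty join
or meet, whose sign may be wrong. -/
theorem GPrim.bigJoin {T : DLESig.{u, v}} {V : Type w} {L : V → Pol → Prop} (σ : Pol) {τ : Pol}
    {l : List (Tm T V)} (h : ∀ a ∈ l, GPrim L True a τ) : GPrim L True (bigJoin σ l) τ := by
  induction l with
  | nil => cases σ <;> exact .inr trivial
  | cons a l ih =>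
    have h1 := h a List.mem_cons_self
    have h2 := ih fun b hb => h b (List.mem_cons_of_mem _ hb)
    cases σ <;> exact ⟨h1, h2⟩

/-- Inequalities in which an Ackermann rule can substitute for the letter `p`. -/
def Substitutable (σ : Pol) (p : ℕ) (e : Ineq S) : Prop :=
  match σ with
  | .pos => e.lhs.PositiveIn (.prop p) ∧ e.rhs.NegativeIn (.prop p)
  | .neg => e.lhs.NegativeIn (.prop p) ∧ e.rhs.PositiveIn (.prop p)

/-- If left sides are given the root sign + and right sides the root sign -, then substitutability
says that all occurrences of `p` are signed `σ`. Thus the signs recorded by `GPrim` are just what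
the Ackermann rules ask for. -/
theorem substitutable_sle {σ ρ : Pol} {p : ℕ} {a b : STm S}
    (ha : ∀ τ, a.OccS (.prop p) τ ρ → τ = σ) (hb : ¬ b.Occ (.prop p)) :
    Substitutable σ p (sle ρ a b) := by
  have hb' : ∀ τ, ¬ b.OccS (.prop p) τ .pos := fun τ h => hb ((occ_iff_occS .pos).2 ⟨τ, h⟩)
  cases ρ
  · have h : ¬ a.OccS (.prop p) σ.op .pos := fun h => Pol.op_ne σ (ha _ h)
    cases σ; exacts [⟨h, hb' _⟩, ⟨h, hb' _⟩]
  · have h : ¬ a.OccS (.prop p) σ .pos := fun h => by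
      have h' := ha σ.op ((occS_op (σ := .pos)).2 (by rwa [Pol.op_op]))
      exact Pol.op_ne σ h'
    cases σ; exacts [⟨hb' _, h⟩, ⟨hb' _, h⟩]

theorem EliminationRule.ackermann (σ : Pol) (p i m : ℕ) (α : List (STm S))
    (Γ : Multiset (Ineq S)) (hα : ∀ a ∈ α, ¬ a.Occ (.prop p))
    (hΓ : ∀ e ∈ Γ, Substitutable σ p e) :
    EliminationRule {⟨(α.map fun a => sle σ a (.var (.prop p)) : Multiset (Ineq S)) + Γ,
        ⟨.var (.nom i), .var (.conom m)⟩⟩}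
      {⟨Γ.map (Ineq.subst (.prop p) (bigJoin σ α)), ⟨.var (.nom i), .var (.conom m)⟩⟩} := by
  cases σ
  · exact .rightAckermann p i m α Γ hα hΓ
  · exact .leftAckermann p i m α Γ hα hΓ

/-- The quasi-inequality to which Ackermann elimination is applied. -/
def ackQuasi (ε : ℕ → Pol) (π : Pol) (N : ℕ) (X : STm S) (V : Multiset (ℕ × STm S)) (γ : STm S) :
    Quasi S :=
  ⟨V.map (valIneq ε) + {sle π.op γ (.var (freshVar π N)), sle π X (.var (freshVar π.op N))},
    ⟨.var (.nom N), .var (.conom N)⟩⟩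

theorem GPrim.not_occ_prop {X : STm S} {σ : Pol} (h : GPrim NomSign False X σ) (p : ℕ) :
    ¬ X.Occ (.prop p) := by
  intro ho
  obtain ⟨τ, hτ⟩ := (occ_iff_occS σ).1 ho
  exact (h.of_occS hτ).elim

theorem freshVar_ne_prop (σ : Pol) (N p : ℕ) : ¬ (.var (freshVar σ N) : STm S).Occ (.prop p) := by
  cases σ <;> exact fun h => by cases h

/-- Elimination of one letter. -/
theorem eliminate_letter (hirr : ∀ p, ¬ Ω p p) (htrans : ∀ p q r, Ω p q → Ω q r → Ω p r)
    {N : ℕ} {X : STm S} (hX : ∀ p, ¬ X.Occ (.prop p)) (p : ℕ) (P : Finset ℕ)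
    (V : Multiset (ℕ × STm S)) (γ : STm S)
    (hV : ∀ pv ∈ V, IsMinVal Ω ε N pv ∧ pv.1 ∈ insert p P ∧
      ∀ q, pv.2.Occ (.prop q) → q ∈ insert p P)
    (hγ : GPrim (LetterSign ε) True γ π.op) (hb : Bd N γ)
    (hl : ∀ q, γ.Occ (.prop q) → q ∈ insert p P) :
    ∃ V' γ', (∀ pv ∈ V', IsMinVal Ω ε N pv ∧ pv.1 ∈ P ∧ ∀ q, pv.2.Occ (.prop q) → q ∈ P) ∧
      GPrim (LetterSign ε) True γ' π.op ∧ Bd N γ' ∧ (∀ q, γ'.Occ (.prop q) → q ∈ P) ∧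
      AlbaStep {ackQuasi ε π N X V γ} {ackQuasi ε π N X V' γ'} := by
  -- All bounds on `p` are gathered into one join or meet `r`, according to `ε p`; if there are
  -- none, `r` is a constant.
  set A : Multiset (STm S) := (V.filter (fun pv => pv.1 = p)).map Prod.snd with hA
  have hAmem : ∀ a ∈ A, (p, a) ∈ V := by
    intro a ha
    obtain ⟨⟨q, v⟩, hqv, rfl⟩ := Multiset.mem_map.1 ha
    obtain ⟨h1, h2⟩ := Multiset.mem_filter.1 hqv
    simp only at h2; subst h2; exact h1
  set r : STm S := bigJoin (ε p) A.toList with hr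
  have hro : ∀ x, r.Occ x → ∃ a ∈ A, a.Occ x := fun x hx => by
    obtain ⟨a, ha, h⟩ := occ_bigJoin hx; exact ⟨a, Multiset.mem_toList.1 ha, h⟩
  have hrg : ∀ τ, LetterSign ε (.prop p) τ → GPrim (LetterSign ε) True r τ := by
    rintro τ (rfl : τ = ε p)
    exact GPrim.bigJoin _ fun a ha => (hV _ (hAmem a (Multiset.mem_toList.1 ha))).1.1
  have hrΩ : ∀ q, r.Occ (.prop q) → Ω q p := fun q hq => by
    obtain ⟨a, ha, h⟩ := hro _ hq; exact (hV _ (hAmem a ha)).1.2.1 q h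
  have hsub : ∀ v : STm S, Bd N v → (∀ q, v.Occ (.prop q) → q ∈ insert p P) →
      Bd N (Tm.subst (.prop p) r v) ∧
      ∀ q, (Tm.subst (.prop p) r v).Occ (.prop q) → q ∈ P := by
    intro v hv hvl
    refine ⟨Bd.of_occ fun x hx => ?_, fun q hq => ?_⟩
    · rcases occ_subst hx with h | h
      · exact hv.idx_le h.2
      · obtain ⟨a, ha, h'⟩ := hro _ h.2
        exact (hV _ (hAmem a ha)).1.2.2.idx_le h'
    · rcases occ_subst hq with h | h
      · exact (Finset.mem_insert.1 (hvl q h.2)).resolve_left (by simpa using h.1)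
      · obtain ⟨a, ha, h'⟩ := hro _ h.2
        refine (Finset.mem_insert.1 ((hV _ (hAmem a ha)).2.2 q h')).resolve_left ?_
        rintro rfl
        -- Irreflexivity ensures that `p` does not reappear through its own valuation.
        exact hirr _ (hrΩ _ h.2)
  refine ⟨(V.filter (fun pv => ¬ pv.1 = p)).map fun pv => (pv.1, Tm.subst (.prop p) r pv.2),
    Tm.subst (.prop p) r γ, ?_, hγ.subst hrg, (hsub γ hb hl).1, (hsub γ hb hl).2, ?_⟩
  · intro pv hpv
    obtain ⟨⟨q, v⟩, hqv, rfl⟩ := Multiset.mem_map.1 hpv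
    obtain ⟨h1, h2⟩ := Multiset.mem_filter.1 hqv
    obtain ⟨⟨hg, hΩ, hbv⟩, hq, hvl⟩ := hV _ h1
    refine ⟨⟨hg.subst hrg, fun q' hq' => ?_, (hsub v hbv hvl).1⟩,
      (Finset.mem_insert.1 hq).resolve_left h2, (hsub v hbv hvl).2⟩
    rcases occ_subst hq' with h | h
    · exact hΩ q' h.2
    -- A letter brought in by `r` is below `p`, and `p` is below the letter being bounded;
    -- transitivity restores the order condition.
    · exact htrans _ _ _ (hrΩ q' h.2) (hΩ p h.1)
  · set Γ : Multiset (Ineq S) := (V.filter (fun pv => ¬ pv.1 = p)).map (valIneq ε) +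
      {sle π.op γ (.var (freshVar π N)), sle π X (.var (freshVar π.op N))} with hΓ
    have h1 := (EliminationRule.ackermann (S := S) (ε p) p N N A.toList Γ
      (fun a ha ho => hirr _ ((hV _ (hAmem a (Multiset.mem_toList.1 ha))).1.2.1 p ho))
      (fun e he => by
        rcases Multiset.mem_add.1 he with he | he
        · obtain ⟨⟨q, v⟩, hqv, rfl⟩ := Multiset.mem_map.1 he
          obtain ⟨h1, h2⟩ := Multiset.mem_filter.1 hqv
          exact substitutable_sle (fun τ hτ => (hV _ h1).1.1.of_occS hτ)
            (fun ho => h2 (by cases ho; rfl))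
        · simp only [Multiset.insert_eq_cons, Multiset.mem_cons, Multiset.mem_singleton] at he
          rcases he with rfl | rfl
          · exact substitutable_sle (fun τ hτ => hγ.of_occS hτ) (freshVar_ne_prop _ _ _)
          · exact substitutable_sle
              (fun τ hτ => (hX p ((occ_iff_occS π).2 ⟨τ, hτ⟩)).elim)
              (freshVar_ne_prop _ _ _))).step
    -- It remains to match the form of the rule: the valuations of `p` form the list part, and the
    -- substitution changes neither the other letters nor `X` nor the two approximating variables.
    convert h1 using 2
    · rw [ackQuasi, hΓ, ← add_assoc]
      congr 2
      conv_lhs => rw [← Multiset.filter_add_not (fun pv : ℕ × STm S => pv.1 = p) V,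
        Multiset.map_add]
      congr 1
      rw [← Multiset.map_coe, Multiset.coe_toList, hA, Multiset.map_map]
      refine Multiset.map_congr rfl fun pv hpv => ?_
      rw [← (Multiset.mem_filter.1 hpv).2]; rfl
    · rw [ackQuasi, hΓ, Multiset.map_add, Multiset.map_map, Multiset.map_map]
      congr 2
      · refine Multiset.map_congr rfl fun pv hpv => ?_
        simp only [Function.comp, valIneq, subst_sle]
        rw [subst_of_not_occ (t := .var (Var.prop pv.1))]
        intro h
        exact (Multiset.mem_filter.1 hpv).2 (by cases h; rfl)
      · simp only [Multiset.insert_eq_cons, Multiset.map_cons, Multiset.map_singleton, subst_sle]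
        rw [subst_of_not_occ (hX p), subst_of_not_occ (freshVar_ne_prop _ _ _),
          subst_of_not_occ (freshVar_ne_prop _ _ _)]

/-- Elimination of all letters. -/
theorem eliminate_letters (hirr : ∀ p, ¬ Ω p p) (htrans : ∀ p q r, Ω p q → Ω q r → Ω p r)
    {N : ℕ} {X : STm S} (hX : ∀ p, ¬ X.Occ (.prop p)) (P : Finset ℕ)
    (V : Multiset (ℕ × STm S)) (γ : STm S)
    (hV : ∀ pv ∈ V, IsMinVal Ω ε N pv ∧ pv.1 ∈ P ∧ ∀ q, pv.2.Occ (.prop q) → q ∈ P)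
    (hγ : GPrim (LetterSign ε) True γ π.op) (hb : Bd N γ) (hl : ∀ q, γ.Occ (.prop q) → q ∈ P) :
    ∃ γ', GPrim (LetterSign ε) True γ' π.op ∧ Bd N γ' ∧ (∀ q, ¬ γ'.Occ (.prop q)) ∧
      Relation.ReflTransGen AlbaStep {ackQuasi ε π N X V γ} {ackQuasi ε π N X 0 γ'} := by
  -- The set of letters is exhausted in an arbitrary order; the order conditions on the valuations
  -- are preserved whichever letter is taken.
  induction P using Finset.induction_on generalizing V γ with
  | empty =>
    obtain rfl : V = 0 := Multiset.eq_zero_of_forall_notMem fun pv hpv => by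
      simpa using (hV pv hpv).2.1
    exact ⟨γ, hγ, hb, fun q hq => by simpa using hl q hq, .refl⟩
  | insert p P _ ih =>
    obtain ⟨V', γ', hV', hγ', hb', hl', hs⟩ :=
      eliminate_letter hirr htrans hX p P V γ hV hγ hb hl
    obtain ⟨δ, h1, h2, h3, hs'⟩ := ih V' γ' hV' hγ' hb' hl'
    exact ⟨δ, h1, h2, h3, .head hs hs'⟩

theorem exists_letters (t : STm S) : ∃ P : Finset ℕ, ∀ q, t.Occ (.prop q) → q ∈ P := by
  induction t with
  | var x =>
    cases x with
    | prop p => exact ⟨{p}, fun q hq => by cases hq; simp⟩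
    | nom n => exact ⟨∅, fun q hq => by cases hq⟩
    | conom n => exact ⟨∅, fun q hq => by cases hq⟩
  | bot => exact ⟨∅, fun q hq => hq.elim⟩
  | top => exact ⟨∅, fun q hq => hq.elim⟩
  | and a b iha ihb =>
    obtain ⟨P, hP⟩ := iha
    obtain ⟨Q, hQ⟩ := ihb
    exact ⟨P ∪ Q, fun q hq => Finset.mem_union.2 (hq.imp (hP q) (hQ q))⟩
  | or a b iha ihb =>
    obtain ⟨P, hP⟩ := iha
    obtain ⟨Q, hQ⟩ := ihb
    exact ⟨P ∪ Q, fun q hq => Finset.mem_union.2 (hq.imp (hP q) (hQ q))⟩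
  | fapp f a ih =>
    choose P hP using ih
    exact ⟨Finset.univ.biUnion P, fun q ⟨i, hi⟩ =>
      Finset.mem_biUnion.2 ⟨i, Finset.mem_univ i, hP i q hi⟩⟩
  | gapp f a ih =>
    choose P hP using ih
    exact ⟨Finset.univ.biUnion P, fun q ⟨i, hi⟩ =>
      Finset.mem_biUnion.2 ⟨i, Finset.mem_univ i, hP i q hi⟩⟩

theorem exists_letters_family (V : Multiset (ℕ × STm S)) :
    ∃ P : Finset ℕ, ∀ pv ∈ V, pv.1 ∈ P ∧ ∀ q, pv.2.Occ (.prop q) → q ∈ P := by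
  choose P hP using exists_letters (S := S)
  classical
  refine ⟨V.toFinset.biUnion fun pv => insert pv.1 (P pv.2), fun pv hpv => ⟨?_, fun q hq => ?_⟩⟩ <;>
    refine Finset.mem_biUnion.2 ⟨pv, Multiset.mem_toFinset.2 hpv, ?_⟩
  · exact Finset.mem_insert_self _ _
  · exact Finset.mem_insert_of_mem (hP _ q hq)

end Elimination

/-! ### Removal of constants -/

section Constants

/-- Rewriting changes one argument at a time, so the arguments are replaced coordinate by coordinate
through the intermediate tuples `s.piecewise b a`. -/
theorem rew_fapp {T : DLESig.{u, v}} {V : Type w} (f : T.F) {a b : Fin (T.arF f) → Tm T V}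
    (h : ∀ i, Relation.ReflTransGen Rew (a i) (b i)) :
    Relation.ReflTransGen Rew (Tm.fapp f a) (Tm.fapp f b) := by
  have key : ∀ s : Finset (Fin (T.arF f)),
      Relation.ReflTransGen Rew (Tm.fapp f a) (Tm.fapp f (s.piecewise b a)) := by
    intro s
    induction s using Finset.induction_on with
    | empty => rw [Finset.piecewise_empty]
    | insert j s hj ih =>
      refine ih.trans ?_
      rw [Finset.piecewise_insert]
      have := (h j).lift (fun x => Tm.fapp f (Function.update (s.piecewise b a) j x))
        fun x y hxy => Rew.f f j _ hxy
      have hu : Function.update (s.piecewise b a) j (a j) = s.piecewise b a :=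
        Function.update_eq_self_iff.2 (Finset.piecewise_eq_of_notMem s b a hj).symm
      rwa [Function.onFun, hu] at this
  simpa using key Finset.univ

theorem rew_gapp {T : DLESig.{u, v}} {V : Type w} (g : T.G) {a b : Fin (T.arG g) → Tm T V}
    (h : ∀ i, Relation.ReflTransGen Rew (a i) (b i)) :
    Relation.ReflTransGen Rew (Tm.gapp g a) (Tm.gapp g b) := by
  have key : ∀ s : Finset (Fin (T.arG g)),
      Relation.ReflTransGen Rew (Tm.gapp g a) (Tm.gapp g (s.piecewise b a)) := by
    intro s
    induction s using Finset.induction_on with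
    | empty => rw [Finset.piecewise_empty]
    | insert j s hj ih =>
      refine ih.trans ?_
      rw [Finset.piecewise_insert]
      have := (h j).lift (fun x => Tm.gapp g (Function.update (s.piecewise b a) j x))
        fun x y hxy => Rew.g g j _ hxy
      have hu : Function.update (s.piecewise b a) j (a j) = s.piecewise b a :=
        Function.update_eq_self_iff.2 (Finset.piecewise_eq_of_notMem s b a hj).symm
      rwa [Function.onFun, hu] at this
  simpa using key Finset.univ

theorem rew_and {T : DLESig.{u, v}} {V : Type w} {a a' b b' : Tm T V}
    (h : Relation.ReflTransGen Rew a a') (h' : Relation.ReflTransGen Rew b b') :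
    Relation.ReflTransGen Rew (Tm.and a b) (Tm.and a' b') :=
  (h.lift (fun x => Tm.and x b) fun _ _ => Rew.andL b).trans
    (h'.lift (fun x => Tm.and a' x) fun _ _ => Rew.andR a')

theorem rew_or {T : DLESig.{u, v}} {V : Type w} {a a' b b' : Tm T V}
    (h : Relation.ReflTransGen Rew a a') (h' : Relation.ReflTransGen Rew b b') :
    Relation.ReflTransGen Rew (Tm.or a b) (Tm.or a' b') :=
  (h.lift (fun x => Tm.or x b) fun _ _ => Rew.orL b).trans
    (h'.lift (fun x => Tm.or a' x) fun _ _ => Rew.orR a')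

/-- The constants with the wrong sign can be removed, unless the term reduces to such a
constant. -/
theorem GPrim.exists_rew {T : DLESig.{u, v}} {V : Type w} {L : V → Pol → Prop} {t : Tm T V}
    {σ : Pol} (h : GPrim L True t σ) :
    ∃ t', Relation.ReflTransGen Rew t t' ∧ (GPrim L False t' σ ∨ t' = zeroS σ) := by
  induction t generalizing σ with
  | var x => exact ⟨_, .refl, .inl h⟩
  | bot => cases σ; exacts [⟨_, .refl, .inr rfl⟩, ⟨_, .refl, .inl (.inl rfl)⟩]
  | top => cases σ; exacts [⟨_, .refl, .inl (.inl rfl)⟩, ⟨_, .refl, .inr rfl⟩]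
  | and a b iha ihb =>
    obtain ⟨a', ha, ha'⟩ := iha h.1
    obtain ⟨b', hb, hb'⟩ := ihb h.2
    have hr := rew_and ha hb
    -- For the positive sign the wrong constant ⊥ absorbs the conjunction; for the negative sign the
    -- wrong constant ⊤ is neutral in it.
    cases σ
    · rcases ha' with ha' | rfl
      · rcases hb' with hb' | rfl
        · exact ⟨_, hr, .inl ⟨ha', hb'⟩⟩
        · exact ⟨_, hr.tail (.root (.andBot _)), .inr rfl⟩
      · exact ⟨_, hr.tail (.root (.botAnd _)), .inr rfl⟩
    · rcases ha' with ha' | rfl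
      · rcases hb' with hb' | rfl
        · exact ⟨_, hr, .inl ⟨ha', hb'⟩⟩
        · exact ⟨_, hr.tail (.root (.andTop _)), .inl ha'⟩
      · exact ⟨_, hr.tail (.root (.topAnd _)), hb'⟩
  | or a b iha ihb =>
    obtain ⟨a', ha, ha'⟩ := iha h.1
    obtain ⟨b', hb, hb'⟩ := ihb h.2
    have hr := rew_or ha hb
    cases σ
    · rcases ha' with ha' | rfl
      · rcases hb' with hb' | rfl
        · exact ⟨_, hr, .inl ⟨ha', hb'⟩⟩
        · exact ⟨_, hr.tail (.root (.orBot _)), .inl ha'⟩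
      · exact ⟨_, hr.tail (.root (.botOr _)), hb'⟩
    · rcases ha' with ha' | rfl
      · rcases hb' with hb' | rfl
        · exact ⟨_, hr, .inl ⟨ha', hb'⟩⟩
        · exact ⟨_, hr.tail (.root (.orTop _)), .inr rfl⟩
      · exact ⟨_, hr.tail (.root (.topOr _)), .inr rfl⟩
  | fapp f a ih =>
    obtain ⟨rfl, h⟩ := h
    choose b hb hb' using fun i => ih i (h i)
    have hr := rew_fapp f hb
    -- A wrong constant is ⊥ at a coordinate of order-type 1 and ⊤ at one of order-type ∂; in both
    -- cases it collapses the whole term to ⊥, again a constant of the wrong sign.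
    by_cases hz : ∃ i, b i = zeroS (Pol.pos.mul (T.εF f i))
    · obtain ⟨i, hi⟩ := hz
      rw [← Function.update_eq_self i b, hi] at hr
      refine ⟨.bot, hr.tail (.root ?_), .inr rfl⟩
      rcases he : T.εF f i with _ | _
      · exact .fBot f i he b
      · exact .fTop f i he b
    · exact ⟨_, hr, .inl ⟨rfl, fun i => (hb' i).resolve_right fun h => hz ⟨i, h⟩⟩⟩
  | gapp g a ih =>
    obtain ⟨rfl, h⟩ := h
    choose b hb hb' using fun i => ih i (h i)
    have hr := rew_gapp g hb
    by_cases hz : ∃ i, b i = zeroS (Pol.neg.mul (T.εG g i))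
    · obtain ⟨i, hi⟩ := hz
      rw [← Function.update_eq_self i b, hi] at hr
      refine ⟨.top, hr.tail (.root ?_), .inr rfl⟩
      rcases he : T.εG g i with _ | _
      · exact .gTop g i he b
      · exact .gBot g i he b
    · exact ⟨_, hr, .inl ⟨rfl, fun i => (hb' i).resolve_right fun h => hz ⟨i, h⟩⟩⟩

theorem GPrim.congr_occS {T : DLESig.{u, v}} {V : Type w} {L L' : V → Pol → Prop} {c : Prop}
    {t : Tm T V} {σ : Pol} (h : GPrim L c t σ)
    (hL : ∀ x τ, t.OccS x τ σ → L x τ → L' x τ) : GPrim L' c t σ := by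
  induction t generalizing σ with
  | var x => exact hL _ _ ⟨rfl, rfl⟩ h
  | bot => exact h
  | top => exact h
  | and a b iha ihb =>
    exact ⟨iha h.1 fun x τ hx => hL x τ (.inl hx), ihb h.2 fun x τ hx => hL x τ (.inr hx)⟩
  | or a b iha ihb =>
    exact ⟨iha h.1 fun x τ hx => hL x τ (.inl hx), ihb h.2 fun x τ hx => hL x τ (.inr hx)⟩
  | fapp f a ih => exact ⟨h.1, fun i => ih i (h.2 i) fun x τ hx => hL x τ ⟨i, hx⟩⟩
  | gapp f a ih => exact ⟨h.1, fun i => ih i (h.2 i) fun x τ hx => hL x τ ⟨i, hx⟩⟩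

end Constants

/-! ### Reduction to primitive inequalities -/

section Primitive

variable {S : DLESig.{u, v}} {Ω : ℕ → ℕ → Prop} {ε : ℕ → Pol} {π : Pol}

/-- Right-primitive inequalities for the sign `+`, left-primitive ones for the sign `-`. -/
def SPrimitive (π : Pol) (e : Ineq S) : Prop :=
  match π with
  | .pos => e.RightPrimitive
  | .neg => e.LeftPrimitive

theorem SameOrderType.symm {T : DLESig.{u, v}} {V : Type w} {s t : Tm T V}
    (h : SameOrderType s t) : SameOrderType t s := fun x hs ht τ => (h x ht hs τ).symm

theorem sPrimitive_sle {a b : STm S} : SPrimitive π (sle π a b) ↔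
    Prim a π.op ∧ Prim b π.op ∧ Scattered b ∧ SameOrderType a b ∧ Uniform a := by
  cases π
  · exact Iff.rfl
  · constructor
    · rintro ⟨h1, h2, h3, h4, h5⟩; exact ⟨h2, h1, h3, h4.symm, h5⟩
    · rintro ⟨h1, h2, h3, h4, h5⟩; exact ⟨h2, h1, h3, h4.symm, h5⟩

theorem pure_sle {a b : STm S} :
    (sle π a b).Pure ↔ (∀ p, ¬ a.Occ (.prop p)) ∧ ∀ p, ¬ b.Occ (.prop p) := by
  cases π
  · exact forall_and
  · exact ⟨fun h => ⟨fun p => (h p).2, fun p => (h p).1⟩, fun h p => ⟨h.2 p, h.1 p⟩⟩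

/-- The sign with which nominals and conominals occur. -/
def Var.sign : Var → Pol
  | .prop _ => .pos
  | .nom _ => .pos
  | .conom _ => .neg

theorem NomSign.eq_sign {x : Var} {σ : Pol} (h : NomSign x σ) : σ = x.sign := by
  cases x; exacts [h.elim, h, h]

/-- The sign of an occurrence is forced by the kind of the variable. Two such terms with the same
root sign therefore agree in order-type on common variables, and each of them is uniform. -/
theorem GPrim.occS_iff {c : Prop} {t : STm S} (h : GPrim NomSign c t π.op) {x : Var} {τ : Pol} :
    t.OccS x τ .pos ↔ t.Occ x ∧ π.op.mul τ = x.sign := by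
  have key : ∀ τ, t.OccS x τ π.op → τ = x.sign := fun τ ho => (h.of_occS ho).eq_sign
  have h1 : t.OccS x τ .pos ↔ t.OccS x (π.op.mul τ) π.op := by
    cases π
    · change _ ↔ t.OccS x τ.op .neg
      rw [show Pol.neg = Pol.pos.op from rfl, occS_op, Pol.op_op]
    · rfl
  rw [h1]
  constructor
  · exact fun ho => ⟨(occ_iff_occS π.op).2 ⟨_, ho⟩, key _ ho⟩
  · rintro ⟨ho, he⟩
    obtain ⟨τ', ho⟩ := (occ_iff_occS π.op).1 ho
    rw [he, ← key τ' ho]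
    exact ho

theorem Slot.not_occ {N : ℕ} {X : STm S} (h : Slot 0 N (fun x => X.count x)) (σ : Pol) :
    ¬ X.Occ (freshVar σ N) := not_occ_freshVar h.bd σ

theorem freshVar_op_ne (σ : Pol) (N : ℕ) : freshVar σ N ≠ freshVar σ.op N := by
  cases σ <;> exact fun h => by cases h

/-- Once γ is pure, only its constants of the wrong sign stand in the way of primitivity. -/
theorem exists_primitive {N : ℕ} {γ X : STm S} (hγ : GPrim NomSign True γ π.op)
    (hX : GPrim NomSign False X π.op) (hs : Slot 0 N (fun x => X.count x)) :
    Red ⟨0, sle π γ X⟩ (fun q => ∃ e : Ineq S, q = e.toQuasi ∧ e.Pure ∧ SPrimitive π e) := by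
  obtain ⟨γ', hr, hγ'⟩ := hγ.exists_rew
  have h0 : Relation.ReflTransGen AlbaStep {(⟨0, sle π γ X⟩ : Quasi S)} {⟨0, sle π γ' X⟩} :=
    hr.lift (fun t => ({⟨0, sle π t X⟩} : Multiset (Quasi S)))
      fun a b hab => (ReductionRule.concl 0 _ _ (.rew π X hab)).step
  refine Red.steps h0 ?_
  have hsc : Scattered X := fun x => (hs x).1
  rcases hγ' with hγ' | rfl
  · refine Red.pure ⟨_, rfl, pure_sle.2 ⟨hγ'.not_occ_prop, hX.not_occ_prop⟩,
      sPrimitive_sle.2 ⟨hγ'.prim, hX.prim, hsc, fun x h1 h2 τ => ?_, ?_⟩⟩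
    · rw [hγ'.occS_iff, hX.occS_iff]; simp [h1, h2]
    · refine ⟨fun x => π.op.mul x.sign, fun x τ hx => ?_⟩
      change τ = π.op.mul x.sign
      rw [← (hγ'.occS_iff.1 hx).2]
      cases π <;> cases τ <;> rfl
  -- Here γ has collapsed to ⊤ (for +) or ⊥ (for -), which is not primitive. A first approximation
  -- puts a fresh nominal or conominal in its place, and the premise so created is a tautology.
  · have hz : ¬ (zeroS π.op : STm S).Occ (freshVar π N) := by cases π <;> exact id
    refine Red.rule (.first π (by simp) hz (hs.not_occ π)) ?_
    refine Red.rule (.premTaut 0 _ _ (Taut.zero π.op _)) ?_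
    refine Red.pure ⟨_, rfl, pure_sle.2 ⟨freshVar_ne_prop π N, hX.not_occ_prop⟩,
      sPrimitive_sle.2 ⟨trivial, hX.prim, hsc, fun x h1 h2 τ => ?_, ?_⟩⟩
    · cases h1; exact (hs.not_occ π h2).elim
    · exact ⟨fun _ => .pos, fun x τ hx => hx.2.symm⟩

/-- The Ackermann rules require a conclusion 𝐣 ≤ 𝐦, so both sides are approximated before the
elimination; afterwards the same two steps are reversed. -/
theorem Isolated.exists_primitive (hirr : ∀ p, ¬ Ω p p)
    (htrans : ∀ p q r, Ω p q → Ω q r → Ω p r) {q : Quasi S} (h : Isolated Ω ε π q) :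
    Red q (fun q => ∃ e : Ineq S, q = e.toQuasi ∧ e.Pure ∧ SPrimitive π e) := by
  obtain ⟨N, Γ, γ, X, hΓ, hγ, hX, hs, rfl⟩ := h
  have hne : ∀ (σ : Pol), ¬ (.var (freshVar σ N) : STm S).Occ (freshVar σ.op N) :=
    fun σ => freshVar_op_ne σ N
  have hnp : ∀ {δ : STm S}, Bd N δ → ¬ (sle π.op δ (.var (freshVar π N))).Occ (freshVar π.op N) := by
    intro δ hδ
    have h1 := not_occ_freshVar hδ π.op
    have h2 := hne π
    generalize freshVar π.op N = x at h1 h2 ⊢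
    generalize freshVar π N = y at h1 h2 ⊢
    cases π
    · exact fun h => h.elim h2 h1
    · exact fun h => h.elim h1 h2
  refine Red.rule (.first π (fun e he => (hΓ e he).2.not_occ π) (not_occ_freshVar (bd_emb N γ) π)
    (hs.not_occ π)) ?_
  rw [← sle_op π X]
  refine Red.rule (.first π.op (fun e he => ?_) (hs.not_occ π.op) (hne π)) ?_
  · rcases Multiset.mem_cons.1 he with rfl | he
    · exact hnp (bd_emb N γ)
    · exact (hΓ e he).2.not_occ π.op
  obtain ⟨V, hV, hVs⟩ := hΓ.minVal
  rw [Pol.op_op]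
  -- One of the two fresh variables is the nominal and the other the conominal of index `N`, so the
  -- conclusion has the required form for either sign.
  have hc : (sle π.op (.var (freshVar π.op N)) (.var (freshVar π N)) : Ineq S) =
      ⟨.var (.nom N), .var (.conom N)⟩ := by cases π <;> rfl
  obtain ⟨P, hP⟩ := exists_letters_family V
  obtain ⟨P', hP'⟩ := exists_letters (emb γ)
  obtain ⟨δ, hδ, hδb, hδl, hsteps⟩ := eliminate_letters (ε := ε) (π := π) hirr htrans
    hX.not_occ_prop (P ∪ P') V (emb γ)
    (fun pv hpv => ⟨hV pv hpv, Finset.mem_union_left _ (hP pv hpv).1,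
      fun q hq => Finset.mem_union_left _ ((hP pv hpv).2 q hq)⟩)
    hγ.gprim (bd_emb N γ) (fun q hq => Finset.mem_union_right _ (hP' q hq))
  have h1 := hVs {sle π.op (emb γ) (.var (freshVar π N)), sle π X (.var (freshVar π.op N))}
    ⟨.var (.nom N), .var (.conom N)⟩
  have hre : Γ + {sle π.op (emb γ) (.var (freshVar π N)), sle π X (.var (freshVar π.op N))} =
      sle π X (.var (freshVar π.op N)) ::ₘ sle π.op (emb γ) (.var (freshVar π N)) ::ₘ Γ := by
    rw [add_comm, Multiset.insert_eq_cons, Multiset.cons_add, Multiset.singleton_add,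
      Multiset.cons_swap]
  rw [hre] at h1
  rw [hc]
  refine Red.steps (h1.trans hsteps) ?_
  -- No valuations are left. The premises on `δ` and `X` are the traces of the two first
  -- approximations, which are now undone one after the other.
  rw [ackQuasi, ← hc, Multiset.map_zero, zero_add, Multiset.pair_comm, Multiset.insert_eq_cons]
  have hu := ReductionRule.first π.op (N := N)
    (Γ := {sle π.op δ (.var (freshVar π N))}) (a := X) (b := .var (freshVar π N))
    (by simpa using hnp hδb) (hs.not_occ π.op) (hne π)
  rw [Pol.op_op] at hu
  refine Red.rule_symm hu ?_
  rw [sle_op π X]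
  refine Red.rule_symm (.first π (by simp) (not_occ_freshVar hδb π) (hs.not_occ π)) ?_
  refine DLE.exists_primitive (hδ.congr_occS fun x τ hx hL => ?_) hX hs
  cases x with
  | prop p => exact hδl p ((occ_iff_occS π.op).2 ⟨τ, hx⟩)
  | nom n => exact hL
  | conom n => exact hL

end Primitive

/-! ### Exchange of left-primitive and right-primitive inequalities -/

section Exchange

variable {S : DLESig.{u, v}} {π : Pol}

/-- The residual of `∧` (for `+`) or `∨` (for `-`) in the second coordinate. -/
def impS (σ : Pol) (a y : STm S) : STm S :=
  match σ with
  | .pos => tImp a y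
  | .neg => tCoimpR a y

theorem IneqStep.imp (σ : Pol) (a x y : STm S) :
    IneqStep (sle σ (meetS σ a x) y) (sle σ x (impS σ a y)) := by
  cases σ
  · exact .andImp a x y
  · exact .orCoimpR y a x

theorem joinS_eq_meetS {T : DLESig.{u, v}} {V : Type w} (σ : Pol) (a b : Tm T V) :
    joinS σ a b = meetS σ.op a b := by cases σ <;> rfl

theorem occS_impS {σ : Pol} {a y : STm S} {x : Var} {τ ρ : Pol} :
    (impS σ a y).OccS x τ ρ ↔ a.OccS x τ ρ.op ∨ y.OccS x τ ρ := by
  have h : (∃ i : Fin 2, (![a, y] i).OccS x τ (ρ.mul ((![.neg, .pos] : Fin 2 → Pol) i))) ↔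
      a.OccS x τ ρ.op ∨ y.OccS x τ ρ := by
    rw [Fin.exists_fin_two]; simp
  cases σ <;> exact h

theorem occ_impS {σ : Pol} {a y : STm S} {x : Var} :
    (impS σ a y).Occ x ↔ a.Occ x ∨ y.Occ x := by
  have h : (∃ i : Fin 2, (![a, y] i).Occ x) ↔ a.Occ x ∨ y.Occ x := by
    rw [Fin.exists_fin_two]; simp
  cases σ <;> exact h

theorem count_impS {σ : Pol} {a y : STm S} {x : Var} :
    (impS σ a y).count x = a.count x + y.count x := by
  cases σ <;> exact Fin.sum_univ_two (fun i : Fin 2 => (![a, y] i).count x)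

theorem prim_impS {σ : Pol} {a y : STm S} (ha : Prim a σ) (hy : Prim y σ.op) :
    Prim (impS σ a y) σ.op := by
  cases σ
  · refine ⟨rfl, fun (i : Fin 2) => ?_⟩
    fin_cases i; exacts [ha, hy]
  · refine ⟨rfl, fun (i : Fin 2) => ?_⟩
    fin_cases i; exacts [ha, hy]

theorem exists_bd (t : STm S) : ∃ N, Bd N t := by
  have : ∃ N : ℕ, ∀ x, t.Occ x → x.idx ≤ N := by
    induction t with
    | var x => exact ⟨x.idx, fun y hy => by cases hy; exact le_rfl⟩
    | bot => exact ⟨0, fun y hy => hy.elim⟩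
    | top => exact ⟨0, fun y hy => hy.elim⟩
    | and a b iha ihb =>
      obtain ⟨N, hN⟩ := iha
      obtain ⟨M, hM⟩ := ihb
      exact ⟨max N M, fun x hx => le_max_iff.2 (hx.imp (hN x) (hM x))⟩
    | or a b iha ihb =>
      obtain ⟨N, hN⟩ := iha
      obtain ⟨M, hM⟩ := ihb
      exact ⟨max N M, fun x hx => le_max_iff.2 (hx.imp (hN x) (hM x))⟩
    | fapp f a ih =>
      choose N hN using ih
      exact ⟨∑ i, N i, fun x ⟨i, hi⟩ => (hN i x hi).trans
        (Finset.single_le_sum (fun _ _ => Nat.zero_le _) (Finset.mem_univ i))⟩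
    | gapp f a ih =>
      choose N hN using ih
      exact ⟨∑ i, N i, fun x ⟨i, hi⟩ => (hN i x hi).trans
        (Finset.single_le_sum (fun _ _ => Nat.zero_le _) (Finset.mem_univ i))⟩
  obtain ⟨N, hN⟩ := this
  exact ⟨N, Bd.of_occ hN⟩

/-- `a ≤ b` is reduced to `𝐣 - b ≤ 𝐣 - a` for a fresh nominal `𝐣`, and dually. -/
theorem exchange_steps {N : ℕ} {a b : STm S} (ha : ∀ σ, ¬ a.Occ (freshVar σ N))
    (hb : ∀ σ, ¬ b.Occ (freshVar σ N)) :
    Relation.ReflTransGen AlbaStep {(⟨0, sle π a b⟩ : Quasi S)}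
      {⟨0, sle π.op (impS π.op a (.var (freshVar π N))) (impS π.op b (.var (freshVar π N)))⟩} := by
  have hne : ¬ (.var (freshVar π.op N) : STm S).Occ (freshVar π N) :=
    fun h => freshVar_op_ne π N (Eq.symm h)
  have hne' : ¬ (.var (freshVar π N) : STm S).Occ (freshVar π.op N) := freshVar_op_ne π N
  generalize hj : freshVar π N = j at hne hne'
  generalize hm : freshVar π.op N = m at hne hne'
  -- For the sign +, with 𝐦 fresh, the premise b ≤ 𝐦 appears and the conclusion is a ≤ 𝐦.
  have r1 := ReductionRule.first π.op (N := N) (Γ := (0 : Multiset (Ineq S))) (a := b) (b := a)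
    (by simp) (hb _) (ha _)
  -- Read backwards, this adds a copy with conclusion 𝐦 ≤ 𝐦, which merges with the first into a ∨ 𝐦
  -- ≤ 𝐦. The added 𝐦 is what permits residuation after the next approximation, where 𝐣 ≤ a ∨ 𝐦
  -- becomes 𝐣 - a ≤ 𝐦.
  have r2 := ReductionRule.conclTaut (S := S) {sle π b (.var m)} (sle π (.var m) (.var m))
    (by cases π <;> exact .refl _)
  have r3 := ReductionRule.conclJoin π {sle π b (.var m)} a (.var m) (.var m)
  have hbm : ¬ (sle π b (.var m)).Occ j := by
    have := hj ▸ hb π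
    cases π
    · exact fun h => h.elim this hne
    · exact fun h => h.elim hne this
  have r4 := ReductionRule.first π (N := N) (Γ := {sle π b (.var m)}) (a := joinS π a (.var m))
    (b := .var m) (by simpa [hj] using hbm)
    (by rw [hj]; have := hj ▸ ha π; cases π <;> exact fun h => h.elim this hne)
    (by rw [hj]; exact hne)
  have s5 := IneqStep.imp π.op a (.var m) (.var j)
  rw [← joinS_eq_meetS] at s5
  have r5 := ReductionRule.prem {sle π b (.var m)} (sle π (.var j) (.var m)) _ _ s5
  -- Read backwards, the premises b ≤ 𝐦 and 𝐣 - a ≤ 𝐦 merge into one with left side b ∨ (𝐣 - a).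
  -- Undoing the approximation by 𝐦 then gives 𝐣 ≤ b ∨ (𝐣 - a), and a last residuation gives 𝐣 - b ≤
  -- 𝐣 - a.
  have r6 := ReductionRule.premJoin π 0 (sle π (.var j) (.var m)) b (impS π.op a (.var j)) (.var m)
  have hmo : ¬ (impS π.op a (.var j)).Occ m := by
    rw [occ_impS]; exact fun h => h.elim (hm ▸ ha π.op) hne'
  have r7 := ReductionRule.first π.op (N := N) (Γ := (0 : Multiset (Ineq S)))
    (a := joinS π b (impS π.op a (.var j))) (b := .var j) (by simp)
    (by rw [hm]; have := hm ▸ hb π.op; cases π <;> exact fun h => h.elim this hmo)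
    (by rw [hm]; exact hne')
  have s8 := IneqStep.imp π.op b (impS π.op a (.var j)) (.var j)
  rw [← joinS_eq_meetS] at s8
  have r8 := ReductionRule.concl 0 _ _ s8
  simp only [hj, hm, sle_op, Pol.op_op, Multiset.cons_zero] at r1 r2 r3 r4 r5 r6 r7 r8 ⊢
  rw [show sle π b (.var m) ::ₘ {sle π (impS π.op a (.var j)) (.var m)} =
    sle π (impS π.op a (.var j)) (.var m) ::ₘ {sle π b (.var m)} from Multiset.pair_comm _ _] at r6
  have e2 : AlbaStep {(⟨{sle π b (.var m)}, sle π a (.var m)⟩ : Quasi S)}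
      {⟨{sle π b (.var m)}, sle π a (.var m)⟩, ⟨{sle π b (.var m)}, sle π (.var m) (.var m)⟩} := by
    have := r2.step_symm.add {⟨{sle π b (.var m)}, sle π a (.var m)⟩}
    rwa [zero_add, add_comm, Multiset.singleton_add] at this
  exact .head r1.step <| .head e2 <| .head r3.step_symm <| .head r4.step <| .head r5.step <|
    .head r6.step_symm <| .head r7.step_symm <| .single r8.step

/-- The signs of all old variables are reversed on both sides, so the order-types still agree. The
fresh variable occurs once, positively, on each side, and the scattered side is still the one that
contains `b`. -/
theorem sPrimitive_exchange {N : ℕ} {a b : STm S} (ha : ¬ a.Occ (freshVar π N))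
    (hb : ¬ b.Occ (freshVar π N)) (h : SPrimitive π (sle π a b)) :
    SPrimitive π.op (sle π.op (impS π.op a (.var (freshVar π N)))
      (impS π.op b (.var (freshVar π N)))) := by
  generalize freshVar π N = j at ha hb ⊢
  rw [sPrimitive_sle] at h ⊢
  obtain ⟨h1, h2, h3, h4, η, h5⟩ := h
  have hp : Prim (.var j : STm S) π.op.op := trivial
  have hv : ∀ x τ, (.var j : STm S).OccS x τ .pos ↔ x = j ∧ τ = .pos := fun x τ =>
    ⟨fun h => ⟨h.1.symm, h.2.symm⟩, fun h => ⟨h.1.symm, h.2.symm⟩⟩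
  have hn : ∀ t : STm S, ¬ t.Occ j → ∀ τ σ, ¬ t.OccS j τ σ := fun t ht τ σ h =>
    ht ((occ_iff_occS σ).2 ⟨τ, h⟩)
  refine ⟨prim_impS h1 hp, prim_impS h2 hp, fun x => ?_, fun x hx hx' τ => ?_,
    fun x => if x = j then .pos else (η x).op, fun x τ hx => ?_⟩
  · rw [count_impS]
    have := h3 x
    by_cases hx : j = x
    · subst hx
      have : b.count j = 0 := by_contra fun h => hb (occ_iff_count.2 h)
      simp [this, Tm.count]
    · simpa [Tm.count, hx] using this
  · simp only [occS_impS, hv, occS_op]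
    by_cases hj : x = j
    · subst hj; simp [hn _ ha, hn _ hb]
    · simp only [hj, false_and, or_false]
      rw [occ_impS] at hx hx'
      exact h4 x (hx.resolve_right fun h => hj (Eq.symm h))
        (hx'.resolve_right fun h => hj (Eq.symm h)) _
  · simp only [occS_impS, hv, occS_op] at hx
    by_cases hj : x = j
    · subst hj
      simpa [hn _ ha] using hx
    · simp only [hj, false_and, or_false, if_false] at hx ⊢
      rw [← h5 x _ hx, Pol.op_op]

theorem exchange {e : Ineq S} (hp : e.Pure) (h : SPrimitive π e) :
    Red e.toQuasi (fun q => ∃ e : Ineq S, q = e.toQuasi ∧ e.Pure ∧ SPrimitive π.op e) := by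
  obtain ⟨a, b, rfl⟩ : ∃ a b, e = sle π a b := by
    cases π
    exacts [⟨e.lhs, e.rhs, rfl⟩, ⟨e.rhs, e.lhs, rfl⟩]
  obtain ⟨N, hN⟩ := exists_bd a
  obtain ⟨M, hM⟩ := exists_bd b
  have ha := not_occ_freshVar (hN.mono (le_max_left N M))
  have hb := not_occ_freshVar (hM.mono (le_max_right N M))
  obtain ⟨hp1, hp2⟩ := pure_sle.1 hp
  refine Red.steps (exchange_steps ha hb) (Red.pure ⟨_, rfl, pure_sle.2 ⟨fun p => ?_, fun p => ?_⟩,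
    sPrimitive_exchange (ha π) (hb π) h⟩) <;> rw [occ_impS]
  · exact fun h => h.elim (hp1 p) (freshVar_ne_prop _ _ _)
  · exact fun h => h.elim (hp2 p) (freshVar_ne_prop _ _ _)

end Exchange

/-! ### Reduction to a prescribed kind of primitive inequality -/

section Main

variable {S : DLESig.{u, v}} {Ω : ℕ → ℕ → Prop} {ε : ℕ → Pol} {π : Pol}

theorem Red.exists_family {e : Ineq S} {P : Ineq S → Prop}
    (h : Red e.toQuasi (fun q => ∃ e : Ineq S, q = e.toQuasi ∧ P e)) :
    ∃ Λ : Multiset (Ineq S), (∀ e ∈ Λ, P e) ∧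
      Relation.ReflTransGen AlbaStep {e.toQuasi} (Λ.map Ineq.toQuasi) := by
  obtain ⟨Y, hY, hP⟩ := h
  refine ⟨Y.map Quasi.concl, fun e he => ?_, ?_⟩
  · obtain ⟨q, hq, rfl⟩ := Multiset.mem_map.1 he
    obtain ⟨e, rfl, hPe⟩ := hP q hq
    exact hPe
  · rw [Multiset.map_map]
    convert hY
    conv_rhs => rw [← Multiset.map_id Y]
    refine Multiset.map_congr rfl fun q hq => ?_
    obtain ⟨e, rfl, -⟩ := hP q hq
    rfl

theorem red_sPrimitive (hirr : ∀ p, ¬ Ω p p) (htrans : ∀ p q r, Ω p q → Ω q r → Ω p r)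
    {s t : Tm S ℕ}
    (h : RestrictedLeftAnalytic Ω ε π s t ∨ RestrictedRightAnalytic Ω ε π s t) :
    Red (Ineq.toQuasi ⟨emb s, emb t⟩)
      (fun q => ∃ e : Ineq S, q = e.toQuasi ∧ e.Pure ∧ SPrimitive π e) :=
  (isolate_of_restricted h).bind fun _ hq => hq.exists_primitive hirr htrans

theorem red_sPrimitive_of_sign (hirr : ∀ p, ¬ Ω p p)
    (htrans : ∀ p q r, Ω p q → Ω q r → Ω p r) {s t : Tm S ℕ}
    (h : RestrictedLeftAnalytic Ω ε π s t ∨ RestrictedRightAnalytic Ω ε π s t) (σ : Pol) :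
    Red (Ineq.toQuasi ⟨emb s, emb t⟩)
      (fun q => ∃ e : Ineq S, q = e.toQuasi ∧ e.Pure ∧ SPrimitive σ e) := by
  by_cases hσ : π = σ
  · subst hσ; exact red_sPrimitive hirr htrans h
  · rw [← Pol.eq_op_of_ne hσ]
    refine (red_sPrimitive hirr htrans h).bind ?_
    rintro _ ⟨e, rfl, hp, hs⟩
    exact exchange hp hs

end Main

/-! ### Perfect algebras -/

section Lattice

/-- The adjoint criterion for complete lattices. Applied to order duals it covers all four kinds of
residuals. -/
theorem le_sSup_iff_of_map_sSup {A B : Type*} [CompleteLattice A] [CompleteLattice B] {φ : A → B}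
    (h : ∀ X : Set A, φ (sSup X) = sSup (φ '' X)) (b : B) (d : A) :
    d ≤ sSup {c | φ c ≤ b} ↔ φ d ≤ b := by
  constructor
  · intro hd
    have hm : φ d ≤ φ (sSup {c | φ c ≤ b}) := by
      rw [← sup_eq_right.2 hd, ← sSup_pair, h, Set.image_pair, sSup_pair]
      exact le_sup_left
    refine hm.trans ?_
    rw [h]
    exact sSup_le (by rintro _ ⟨c, hc, rfl⟩; exact hc)
  · exact fun hd => le_sSup hd

theorem mono_of_map_sSup {A B : Type*} [CompleteLattice A] [CompleteLattice B] {φ : A → B}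
    (h : ∀ X : Set A, φ (sSup X) = sSup (φ '' X)) : Monotone φ := by
  intro x y hxy
  rw [← sup_eq_right.2 hxy, ← sSup_pair, h, Set.image_pair, sSup_pair]
  exact le_sup_left

variable {A : Type w} [CompletelyDistribLattice A]

/-- Distributivity gives j = ⋁ (j ⊓ x), so irreducibility makes some j ⊓ x equal to j: irreducible
elements are prime. -/
theorem ComplJoinIrred.exists_le {j : A} (hj : ComplJoinIrred j) {X : Set A} (h : j ≤ sSup X) :
    ∃ x ∈ X, j ≤ x := by
  have h1 : j = sSup ((fun x => j ⊓ x) '' X) := by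
    rw [sSup_image, ← inf_sSup_eq, inf_eq_left.2 h]
  obtain ⟨x, hx, hjx⟩ := hj _ h1
  exact ⟨x, hx, inf_eq_left.1 hjx⟩

theorem ComplMeetIrred.exists_le {m : A} (hm : ComplMeetIrred m) {X : Set A} (h : sInf X ≤ m) :
    ∃ x ∈ X, x ≤ m := by
  have h1 : m = sInf ((fun x => m ⊔ x) '' X) := by
    rw [sInf_image, ← sup_sInf_eq, sup_eq_left.2 h]
  obtain ⟨x, hx, hmx⟩ := hm _ h1
  exact ⟨x, hx, sup_eq_left.1 hmx⟩

theorem ComplJoinPrime.complJoinIrred {j : A} (hj : ComplJoinPrime j) : ComplJoinIrred j := by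
  intro X hX
  obtain ⟨x, hx, hjx⟩ := hj X hX.le
  rwa [le_antisymm hjx (hX ▸ le_sSup hx)]

/-- The join of the elements not above a completely join-prime j is the largest such element. If it
is the infimum of other elements, they are all strictly above it, hence above j, and so is their
infimum, a contradiction. -/
theorem ComplJoinPrime.complMeetIrred {j : A} (hj : ComplJoinPrime j) :
    ComplMeetIrred (sSup {x | ¬ j ≤ x}) := by
  have hk : ¬ j ≤ sSup {x | ¬ j ≤ x} := fun h => by
    obtain ⟨x, hx, hjx⟩ := hj _ h; exact hx hjx
  intro X hX
  by_contra hn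
  refine hk (hX ▸ le_sInf fun x hx => ?_)
  by_contra hjx
  exact hn (le_antisymm (le_sSup hjx) (hX ▸ sInf_le hx) ▸ hx)

variable {T : DLESig.{u, v}} {J : Interp T A}

theorem IsPerfectDLE.eq_sSup (h : IsPerfectDLE J) (a : A) :
    a = sSup {j | ComplJoinIrred j ∧ j ≤ a} := by
  refine le_antisymm ?_ (sSup_le fun j hj => hj.2)
  conv_lhs => rw [h.joinGen a]
  exact sSup_le_sSup fun j hj => ⟨hj.1.complJoinIrred, hj.2⟩

/-- Generation by meet-irreducibles is not part of the definition. If j is join-prime and not below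
`a`, then the largest element not above j is a meet-irreducible above `a`, and it excludes j from
the infimum. -/
theorem IsPerfectDLE.eq_sInf (h : IsPerfectDLE J) (a : A) :
    a = sInf {m | ComplMeetIrred m ∧ a ≤ m} := by
  refine le_antisymm (le_sInf fun m hm => hm.2) ?_
  rw [h.joinGen (sInf _)]
  refine sSup_le fun j hj => ?_
  by_contra hja
  have h1 : j ≤ sSup {x | ¬ j ≤ x} :=
    hj.2.trans (sInf_le ⟨hj.1.complMeetIrred, le_sSup hja⟩)
  obtain ⟨x, hx, hjx⟩ := hj.1 _ h1
  exact hx hjx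

/-- The order in the direction given by the sign. -/
def OrdLe (τ : Pol) (a b : A) : Prop :=
  match τ with
  | .pos => a ≤ b
  | .neg => b ≤ a

theorem ordLe_op {τ : Pol} {a b : A} : OrdLe τ.op a b ↔ OrdLe τ b a := by cases τ <;> rfl

theorem OrdLe.refl (τ : Pol) (a : A) : OrdLe τ a a := by cases τ <;> exact le_rfl

theorem le_of_coordinatewise {n : ℕ} {η : Fin n → Pol} {φ : (Fin n → A) → A}
    (h : ∀ i a x y, OrdLe (η i) x y → φ (Function.update a i x) ≤ φ (Function.update a i y))
    {a b : Fin n → A} (hab : ∀ i, OrdLe (η i) (a i) (b i)) : φ a ≤ φ b := by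
  have key : ∀ s : Finset (Fin n), φ a ≤ φ (s.piecewise b a) := by
    intro s
    induction s using Finset.induction_on with
    | empty => rw [Finset.piecewise_empty]
    | insert j s hj ih =>
      refine ih.trans ?_
      rw [Finset.piecewise_insert]
      have hu : Function.update (s.piecewise b a) j (a j) = s.piecewise b a :=
        Function.update_eq_self_iff.2 (Finset.piecewise_eq_of_notMem s b a hj).symm
      conv_lhs => rw [← hu]
      exact h j _ _ _ (hab j)
  simpa using key Finset.univ

theorem IsPerfectDLE.f_mono (h : IsPerfectDLE J) (f : T.F) (i : Fin (T.arF f))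
    (a : Fin (T.arF f) → A) (x y : A) (hxy : OrdLe (T.εF f i) x y) :
    J.fI f (Function.update a i x) ≤ J.fI f (Function.update a i y) := by
  rcases he : T.εF f i with _ | _ <;> rw [he] at hxy
  · exact mono_of_map_sSup
      (φ := fun x : A => J.fI f (Function.update a i x)) (h.f_pos f i he a) hxy
  -- In the dual order of the argument, an operation turning meets into joins preserves joins.
  · exact mono_of_map_sSup (A := Aᵒᵈ)
      (φ := fun x : A => J.fI f (Function.update a i x)) (h.f_neg f i he a) hxy

theorem IsPerfectDLE.g_mono (h : IsPerfectDLE J) (g : T.G) (i : Fin (T.arG g))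
    (a : Fin (T.arG g) → A) (x y : A) (hxy : OrdLe (T.εG g i) x y) :
    J.gI g (Function.update a i x) ≤ J.gI g (Function.update a i y) := by
  rcases he : T.εG g i with _ | _ <;> rw [he] at hxy
  · exact mono_of_map_sSup (A := Aᵒᵈ) (B := Aᵒᵈ)
      (φ := fun x : A => J.gI g (Function.update a i x)) (h.g_pos g i he a) hxy
  · exact mono_of_map_sSup (B := Aᵒᵈ)
      (φ := fun x : A => J.gI g (Function.update a i x)) (h.g_neg g i he a) hxy

theorem eval_mono {V : Type*} (h : IsPerfectDLE J) {h₁ h₂ : V → A} {t : Tm T V} {σ : Pol}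
    (hx : ∀ x τ, t.OccS x τ σ → OrdLe τ (h₁ x) (h₂ x)) :
    OrdLe σ (eval J h₁ t) (eval J h₂ t) := by
  induction t generalizing σ with
  | var x => exact hx x σ ⟨rfl, rfl⟩
  | bot => exact OrdLe.refl _ _
  | top => exact OrdLe.refl _ _
  | and a b iha ihb =>
    have h1 := iha fun x τ ho => hx x τ (.inl ho)
    have h2 := ihb fun x τ ho => hx x τ (.inr ho)
    cases σ <;> exact inf_le_inf h1 h2
  | or a b iha ihb =>
    have h1 := iha fun x τ ho => hx x τ (.inl ho)
    have h2 := ihb fun x τ ho => hx x τ (.inr ho)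
    cases σ <;> exact sup_le_sup h1 h2
  | fapp f a ih =>
    have h1 := fun i => ih i fun x τ ho => hx x τ ⟨i, ho⟩
    cases σ
    · exact le_of_coordinatewise (h.f_mono f) h1
    · exact le_of_coordinatewise (h.f_mono f) fun i => ordLe_op.1 (h1 i)
  | gapp g a ih =>
    have h1 := fun i => ih i fun x τ ho => hx x τ ⟨i, ho⟩
    cases σ
    · exact le_of_coordinatewise (h.g_mono g) h1
    · exact le_of_coordinatewise (h.g_mono g) fun i => ordLe_op.1 (h1 i)

theorem eval_congr {V : Type*} {h₁ h₂ : V → A} {t : Tm T V} (hx : ∀ x, t.Occ x → h₁ x = h₂ x) :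
    eval J h₁ t = eval J h₂ t := by
  induction t with
  | var x => exact hx x rfl
  | bot => rfl
  | top => rfl
  | and a b iha ihb =>
    simp only [eval, iha fun x h => hx x (.inl h), ihb fun x h => hx x (.inr h)]
  | or a b iha ihb =>
    simp only [eval, iha fun x h => hx x (.inl h), ihb fun x h => hx x (.inr h)]
  | fapp f a ih => simp only [eval, fun i => ih i fun x h => hx x ⟨i, h⟩]
  | gapp f a ih => simp only [eval, fun i => ih i fun x h => hx x ⟨i, h⟩]

theorem eval_update {V : Type*} {h : V → A} {n : ℕ} (a : Fin n → Tm T V) (i : Fin n)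
    (x : Tm T V) : (fun j => eval J h (Function.update a i x j)) =
      Function.update (fun j => eval J h (a j)) i (eval J h x) := by
  funext j
  by_cases hj : j = i
  · subst hj; simp
  · simp [hj]

theorem eval_subst {V : Type*} [DecidableEq V] {h : V → A} {x : V} {r t : Tm T V} :
    eval J h (Tm.subst x r t) = eval J (Function.update h x (eval J h r)) t := by
  induction t with
  | var y =>
    by_cases hy : y = x
    · subst hy; simp [Tm.subst, eval]
    · simp [Tm.subst, eval, hy]
  | bot => rfl
  | top => rfl
  | and a b iha ihb => simp only [Tm.subst, eval, iha, ihb]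
  | or a b iha ihb => simp only [Tm.subst, eval, iha, ihb]
  | fapp f a ih => simp only [Tm.subst, eval, ih]
  | gapp f a ih => simp only [Tm.subst, eval, ih]

theorem RootRew.eval_eq {V : Type*} (hJ : IsPerfectDLE J) {a b : Tm T V} (h : RootRew a b)
    (e : V → A) : eval J e a = eval J e b := by
  cases h with
  | andOrL => exact inf_sup_right _ _ _
  | andOrR => exact inf_sup_left _ _ _
  | orAndL => exact sup_inf_right _ _ _
  | orAndR => exact sup_inf_left _ _ _
  | fOr f i h a x y =>
    simp only [eval, eval_update, ← sSup_pair (a := eval J e x), hJ.f_pos f i h, Set.image_pair]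
    exact sSup_pair
  | fAnd f i h a x y =>
    simp only [eval, eval_update, ← sInf_pair (a := eval J e x), hJ.f_neg f i h, Set.image_pair]
    exact sSup_pair
  | gAnd f i h a x y =>
    simp only [eval, eval_update, ← sInf_pair (a := eval J e x), hJ.g_pos f i h, Set.image_pair]
    exact sInf_pair
  | gOr f i h a x y =>
    simp only [eval, eval_update, ← sSup_pair (a := eval J e x), hJ.g_neg f i h, Set.image_pair]
    exact sInf_pair
  | fBot f i h a =>
    simp only [eval, eval_update, ← sSup_empty, hJ.f_pos f i h, Set.image_empty]
  | fTop f i h a =>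
    simp only [eval, eval_update, ← sInf_empty, hJ.f_neg f i h, Set.image_empty, sSup_empty]
  | gTop f i h a =>
    simp only [eval, eval_update, ← sInf_empty, hJ.g_pos f i h, Set.image_empty]
  | gBot f i h a =>
    simp only [eval, eval_update, ← sSup_empty, hJ.g_neg f i h, Set.image_empty, sInf_empty]
  | botAnd => exact bot_inf_eq _
  | andBot => exact inf_bot_eq _
  | topOr => exact top_sup_eq _
  | orTop => exact sup_top_eq _
  | topAnd => exact top_inf_eq _
  | andTop => exact inf_top_eq _
  | botOr => exact bot_sup_eq _
  | orBot => exact sup_bot_eq _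

theorem Rew.eval_eq {V : Type*} (hJ : IsPerfectDLE J) {a b : Tm T V} (h : Rew a b)
    (e : V → A) : eval J e a = eval J e b := by
  induction h with
  | root h => exact h.eval_eq hJ e
  | andL c _ ih => simp only [eval, ih]
  | andR c _ ih => simp only [eval, ih]
  | orL c _ ih => simp only [eval, ih]
  | orR c _ ih => simp only [eval, ih]
  | f f i c _ ih => simp only [eval, eval_update, ih]
  | g g i c _ ih => simp only [eval, eval_update, ih]

end Lattice

/-! ### Adjunction laws and perfection of the expanded language -/

section Star

variable {S : DLESig.{u, v}} {A : Type w} [CompletelyDistribLattice A] {I : Interp S A}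

theorem sharpF_le_iff (hI : IsPerfectDLE I) (f : S.F) (i : Fin (S.arF f)) (h : S.εF f i = .neg)
    (a : Fin (S.arF f) → A) (c : A) :
    starFI I (.sharp f i h) a ≤ c ↔ I.fI f (Function.update a i c) ≤ a i :=
  le_sSup_iff_of_map_sSup (A := Aᵒᵈ)
    (φ := fun x : A => I.fI f (Function.update a i x)) (hI.f_neg f i h a) (a i) c

theorem le_sharpG_iff (hI : IsPerfectDLE I) (f : S.F) (i : Fin (S.arF f)) (h : S.εF f i = .pos)
    (a : Fin (S.arF f) → A) (c : A) :
    c ≤ starGI I (.sharp f i h) a ↔ I.fI f (Function.update a i c) ≤ a i :=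
  le_sSup_iff_of_map_sSup
    (φ := fun x : A => I.fI f (Function.update a i x)) (hI.f_pos f i h a) (a i) c

theorem flatF_le_iff (hI : IsPerfectDLE I) (g : S.G) (i : Fin (S.arG g)) (h : S.εG g i = .pos)
    (a : Fin (S.arG g) → A) (c : A) :
    starFI I (.flat g i h) a ≤ c ↔ a i ≤ I.gI g (Function.update a i c) :=
  le_sSup_iff_of_map_sSup (A := Aᵒᵈ) (B := Aᵒᵈ)
    (φ := fun x : A => I.gI g (Function.update a i x)) (hI.g_pos g i h a) (a i) c

theorem le_flatG_iff (hI : IsPerfectDLE I) (g : S.G) (i : Fin (S.arG g)) (h : S.εG g i = .neg)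
    (a : Fin (S.arG g) → A) (c : A) :
    c ≤ starGI I (.flat g i h) a ↔ a i ≤ I.gI g (Function.update a i c) :=
  le_sSup_iff_of_map_sSup (B := Aᵒᵈ)
    (φ := fun x : A => I.gI g (Function.update a i x)) (hI.g_neg g i h a) (a i) c

/-- It reduces preservation of joins by a residual to the adjunction law, where the defining
property of the original operation can be applied. -/
theorem eq_sSup_image {φ : A → A} {a : A} {X : Set A} (h : ∀ c, a ≤ c ↔ ∀ x ∈ X, φ x ≤ c) :
    a = sSup (φ '' X) :=
  eq_of_forall_ge_iff fun c => by rw [h, sSup_le_iff, Set.forall_mem_image]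

theorem eq_sInf_image {φ : A → A} {a : A} {X : Set A} (h : ∀ c, c ≤ a ↔ ∀ x ∈ X, c ≤ φ x) :
    a = sInf (φ '' X) :=
  eq_of_forall_le_iff fun c => by rw [h, le_sInf_iff, Set.forall_mem_image]

/-- By adjunction, a residual lies below `c` exactly when an inequality for the original operation
holds. At the residuated coordinate this is the universal property of a supremum or infimum; at
another coordinate it is the preservation property of the original operation there. -/
theorem starInterp_f_pos (hI : IsPerfectDLE I) (k : StarF S) (i : Fin k.ar) (h : k.ot i = .pos)
    (a : Fin k.ar → A) (X : Set A) : starFI I k (Function.update a i (sSup X)) =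
      sSup ((fun x => starFI I k (Function.update a i x)) '' X) := by
  cases k with
  | base f => exact hI.f_pos f i h a X
  | coimpR =>
    change Fin 2 at i
    fin_cases i
    · cases h
    · exact eq_sSup_image fun c => by
        change sSup X \ a (0 : Fin 2) ≤ c ↔ ∀ x ∈ X, x \ a (0 : Fin 2) ≤ c
        simp only [sdiff_le_iff, sSup_le_iff]
  | coimpL =>
    change Fin 2 at i
    fin_cases i
    · exact eq_sSup_image fun c => by
        change sSup X \ a (1 : Fin 2) ≤ c ↔ ∀ x ∈ X, x \ a (1 : Fin 2) ≤ c
        simp only [sdiff_le_iff, sSup_le_iff]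
    · cases h
  | sharp f j hj =>
    change Fin (S.arF f) at i
    change Fin (S.arF f) → A at a
    refine eq_sSup_image fun c => ?_
    simp only [sharpF_le_iff hI]
    -- The residuated coordinate of this connective has order-type ∂, so it is not the coordinate
    -- under consideration.
    have hij : j ≠ i := by
      rintro rfl
      have h' : S.εF f j = .pos := h
      rw [hj] at h'; cases h'
    simp only [Function.update_of_ne hij, Function.update_comm hij.symm, hI.f_pos f i h,
      sSup_le_iff, Set.forall_mem_image]
  | flat g j hj =>
    change Fin (S.arG g) at i
    change Fin (S.arG g) → A at a
    refine eq_sSup_image fun c => ?_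
    simp only [flatF_le_iff hI]
    by_cases hij : j = i
    · subst hij; simp only [Function.update_self, Function.update_idem, sSup_le_iff]
    · have h' : S.εG g i = .neg := by
        have : (if i = j then Pol.pos else (S.εG g i).op) = .pos := h
        rw [if_neg (Ne.symm hij)] at this
        cases he : S.εG g i <;> simp_all [Pol.op]
      simp only [Function.update_of_ne hij, Function.update_comm (Ne.symm hij), hI.g_neg g i h',
        le_sInf_iff, Set.forall_mem_image]

theorem starInterp_f_neg (hI : IsPerfectDLE I) (k : StarF S) (i : Fin k.ar) (h : k.ot i = .neg)
    (a : Fin k.ar → A) (X : Set A) : starFI I k (Function.update a i (sInf X)) =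
      sSup ((fun x => starFI I k (Function.update a i x)) '' X) := by
  cases k with
  | base f => exact hI.f_neg f i h a X
  | coimpR =>
    change Fin 2 at i
    fin_cases i
    · exact eq_sSup_image fun c => by
        change a (1 : Fin 2) \ sInf X ≤ c ↔ ∀ x ∈ X, a (1 : Fin 2) \ x ≤ c
        simp only [sdiff_le_iff, sInf_sup_eq, le_iInf_iff]
    · cases h
  | coimpL =>
    change Fin 2 at i
    fin_cases i
    · cases h
    · exact eq_sSup_image fun c => by
        change a (0 : Fin 2) \ sInf X ≤ c ↔ ∀ x ∈ X, a (0 : Fin 2) \ x ≤ c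
        simp only [sdiff_le_iff, sInf_sup_eq, le_iInf_iff]
  | sharp f j hj =>
    change Fin (S.arF f) at i
    change Fin (S.arF f) → A at a
    refine eq_sSup_image fun c => ?_
    simp only [sharpF_le_iff hI]
    by_cases hij : j = i
    · subst hij; simp only [Function.update_self, Function.update_idem, le_sInf_iff]
    · simp only [Function.update_of_ne hij, Function.update_comm (Ne.symm hij), hI.f_neg f i h,
        sSup_le_iff, Set.forall_mem_image]
  | flat g j hj =>
    change Fin (S.arG g) at i
    change Fin (S.arG g) → A at a
    refine eq_sSup_image fun c => ?_
    simp only [flatF_le_iff hI]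
    have h1 : (if i = j then Pol.pos else (S.εG g i).op) = .neg := h
    have hij : j ≠ i := by
      rintro rfl
      rw [if_pos rfl] at h1; cases h1
    have h' : S.εG g i = .pos := by
      rw [if_neg hij.symm] at h1
      cases he : S.εG g i <;> simp_all [Pol.op]
    simp only [Function.update_of_ne hij, Function.update_comm (Ne.symm hij), hI.g_pos g i h',
      le_sInf_iff, Set.forall_mem_image]

theorem starInterp_g_pos (hI : IsPerfectDLE I) (k : StarG S) (i : Fin k.ar) (h : k.ot i = .pos)
    (a : Fin k.ar → A) (X : Set A) : starGI I k (Function.update a i (sInf X)) =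
      sInf ((fun x => starGI I k (Function.update a i x)) '' X) := by
  cases k with
  | base f => exact hI.g_pos f i h a X
  | imp =>
    change Fin 2 at i
    fin_cases i
    · cases h
    · exact eq_sInf_image fun c => by
        change c ≤ a (0 : Fin 2) ⇨ sInf X ↔ ∀ x ∈ X, c ≤ a (0 : Fin 2) ⇨ x
        simp only [le_himp_iff, le_sInf_iff]
  | pmi =>
    change Fin 2 at i
    fin_cases i
    · exact eq_sInf_image fun c => by
        change c ≤ a (1 : Fin 2) ⇨ sInf X ↔ ∀ x ∈ X, c ≤ a (1 : Fin 2) ⇨ x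
        simp only [le_himp_iff, le_sInf_iff]
    · cases h
  | sharp f j hj =>
    change Fin (S.arF f) at i
    change Fin (S.arF f) → A at a
    refine eq_sInf_image fun c => ?_
    simp only [le_sharpG_iff hI]
    by_cases hij : j = i
    · subst hij; simp only [Function.update_self, Function.update_idem, le_sInf_iff]
    · have h' : S.εF f i = .neg := by
        have : (if i = j then Pol.pos else (S.εF f i).op) = .pos := h
        rw [if_neg (Ne.symm hij)] at this
        cases he : S.εF f i <;> simp_all [Pol.op]
      simp only [Function.update_of_ne hij, Function.update_comm (Ne.symm hij), hI.f_neg f i h',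
        sSup_le_iff, Set.forall_mem_image]
  | flat g j hj =>
    change Fin (S.arG g) at i
    change Fin (S.arG g) → A at a
    refine eq_sInf_image fun c => ?_
    simp only [le_flatG_iff hI]
    have hij : j ≠ i := by
      rintro rfl
      have h' : S.εG g j = .pos := h
      rw [hj] at h'; cases h'
    simp only [Function.update_of_ne hij, Function.update_comm hij.symm, hI.g_pos g i h,
      le_sInf_iff, Set.forall_mem_image]

theorem starInterp_g_neg (hI : IsPerfectDLE I) (k : StarG S) (i : Fin k.ar) (h : k.ot i = .neg)
    (a : Fin k.ar → A) (X : Set A) : starGI I k (Function.update a i (sSup X)) =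
      sInf ((fun x => starGI I k (Function.update a i x)) '' X) := by
  cases k with
  | base f => exact hI.g_neg f i h a X
  | imp =>
    change Fin 2 at i
    fin_cases i
    · exact eq_sInf_image fun c => by
        change c ≤ sSup X ⇨ a (1 : Fin 2) ↔ ∀ x ∈ X, c ≤ x ⇨ a (1 : Fin 2)
        simp only [le_himp_iff, inf_sSup_eq, iSup_le_iff]
    · cases h
  | pmi =>
    change Fin 2 at i
    fin_cases i
    · cases h
    · exact eq_sInf_image fun c => by
        change c ≤ sSup X ⇨ a (0 : Fin 2) ↔ ∀ x ∈ X, c ≤ x ⇨ a (0 : Fin 2)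
        simp only [le_himp_iff, inf_sSup_eq, iSup_le_iff]
  | sharp f j hj =>
    change Fin (S.arF f) at i
    change Fin (S.arF f) → A at a
    refine eq_sInf_image fun c => ?_
    simp only [le_sharpG_iff hI]
    have h1 : (if i = j then Pol.pos else (S.εF f i).op) = .neg := h
    have hij : j ≠ i := by
      rintro rfl
      rw [if_pos rfl] at h1; cases h1
    have h' : S.εF f i = .pos := by
      rw [if_neg hij.symm] at h1
      cases he : S.εF f i <;> simp_all [Pol.op]
    simp only [Function.update_of_ne hij, Function.update_comm (Ne.symm hij), hI.f_pos f i h',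
      sSup_le_iff, Set.forall_mem_image]
  | flat g j hj =>
    change Fin (S.arG g) at i
    change Fin (S.arG g) → A at a
    refine eq_sInf_image fun c => ?_
    simp only [le_flatG_iff hI]
    by_cases hij : j = i
    · subst hij; simp only [Function.update_self, Function.update_idem, sSup_le_iff]
    · simp only [Function.update_of_ne hij, Function.update_comm (Ne.symm hij), hI.g_neg g i h,
        le_sInf_iff, Set.forall_mem_image]

/-- The interpretation of the expanded language is perfect. -/
theorem IsPerfectDLE.star (hI : IsPerfectDLE I) : IsPerfectDLE (starInterp I) where
  joinGen := hI.joinGen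
  f_pos := starInterp_f_pos hI
  f_neg := starInterp_f_neg hI
  g_pos := starInterp_g_pos hI
  g_neg := starInterp_g_neg hI

end Star

/-! ### Soundness of the rules of ALBA -/

section Soundness

variable {S : DLESig.{u, v}} {A : Type w} [CompletelyDistribLattice A] {I : Interp S A}

/-- Satisfaction of an inequality under an assignment. -/
def Ineq.Sat (I : Interp S A) (h : Var → A) (e : Ineq S) : Prop :=
  eval (starInterp I) h e.lhs ≤ eval (starInterp I) h e.rhs

/-- Validity of a quasi-inequality. -/
def Quasi.Valid (I : Interp S A) (q : Quasi S) : Prop :=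
  ∀ h : Var → A, Admissible h → (∀ e ∈ q.prem, e.Sat I h) → q.concl.Sat I h

theorem IneqStep.sat_iff (hI : IsPerfectDLE I) {e e' : Ineq S} (hs : IneqStep e e') (h : Var → A) :
    e.Sat I h ↔ e'.Sat I h := by
  cases hs with
  | andImp a b c => exact le_himp_iff'.symm
  | andPmi a b c => exact le_himp_iff.symm
  | orCoimpR a b c => exact sdiff_le_iff.symm
  | orCoimpL a b c => exact sdiff_le_iff'.symm
  | fPos f i hf a x y =>
    have := le_sharpG_iff hI f i hf (Function.update (fun j => eval (starInterp I) h (a j)) i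
      (eval (starInterp I) h y)) (eval (starInterp I) h x)
    rw [Function.update_self, Function.update_idem, ← eval_update, ← eval_update] at this
    exact this.symm
  | fNeg f i hf a x y =>
    have := sharpF_le_iff hI f i hf (Function.update (fun j => eval (starInterp I) h (a j)) i
      (eval (starInterp I) h y)) (eval (starInterp I) h x)
    rw [Function.update_self, Function.update_idem, ← eval_update, ← eval_update] at this
    exact this.symm
  | gPos f i hf a x y =>
    have := flatF_le_iff hI f i hf (Function.update (fun j => eval (starInterp I) h (a j)) i
      (eval (starInterp I) h y)) (eval (starInterp I) h x)
    rw [Function.update_self, Function.update_idem, ← eval_update, ← eval_update] at this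
    exact this.symm
  | gNeg f i hf a x y =>
    have := le_flatG_iff hI f i hf (Function.update (fun j => eval (starInterp I) h (a j)) i
      (eval (starInterp I) h y)) (eval (starInterp I) h x)
    rw [Function.update_self, Function.update_idem, ← eval_update, ← eval_update] at this
    exact this.symm
  | rewL c hr => simp only [Ineq.Sat, hr.eval_eq hI.star h]
  | rewR c hr => simp only [Ineq.Sat, hr.eval_eq hI.star h]

theorem Taut.sat {e : Ineq S} (ht : Taut e) (h : Var → A) : e.Sat I h := by
  cases ht with
  | bot => exact bot_le
  | top => exact le_top
  | refl => exact le_rfl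
  | inl => exact le_sup_left
  | inr => exact le_sup_right
  | fst => exact inf_le_left
  | snd => exact inf_le_right

theorem Ineq.sat_congr {h h' : Var → A} {e : Ineq S} (he : ∀ x, e.Occ x → h x = h' x) :
    e.Sat I h ↔ e.Sat I h' := by
  simp only [Ineq.Sat, eval_congr fun x hx => he x (.inl hx), eval_congr fun x hx => he x (.inr hx)]

theorem Ineq.sat_update {h : Var → A} {e : Ineq S} {x : Var} (he : ¬ e.Occ x) (v : A) :
    e.Sat I (Function.update h x v) ↔ e.Sat I h :=
  Ineq.sat_congr fun y hy => Function.update_of_ne (by rintro rfl; exact he hy) _ _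

theorem eval_update_of_not_occ {h : Var → A} {t : STm S} {x : Var} (ht : ¬ t.Occ x) (v : A) :
    eval (starInterp I) (Function.update h x v) t = eval (starInterp I) h t :=
  eval_congr fun y hy => Function.update_of_ne (by rintro rfl; exact ht hy) _ _

theorem Admissible.update_nom {h : Var → A} (hh : Admissible h) (n : ℕ) {j : A}
    (hj : ComplJoinIrred j) : Admissible (Function.update h (.nom n) j) := by
  refine ⟨fun m => ?_, fun m => ?_⟩
  · by_cases hm : m = n
    · subst hm; simpa using hj
    · rw [Function.update_of_ne (by simpa using hm)]; exact hh.1 m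
  · rw [Function.update_of_ne (by simp)]; exact hh.2 m

theorem Admissible.update_conom {h : Var → A} (hh : Admissible h) (n : ℕ) {m : A}
    (hm : ComplMeetIrred m) : Admissible (Function.update h (.conom n) m) := by
  refine ⟨fun k => ?_, fun k => ?_⟩
  · rw [Function.update_of_ne (by simp)]; exact hh.1 k
  · by_cases hk : k = n
    · subst hk; simpa using hm
    · rw [Function.update_of_ne (by simpa using hk)]; exact hh.2 k

theorem Admissible.update_prop {h : Var → A} (hh : Admissible h) (n : ℕ) (a : A) :
    Admissible (Function.update h (.prop n) a) :=
  ⟨fun k => by rw [Function.update_of_ne (by simp)]; exact hh.1 k,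
    fun k => by rw [Function.update_of_ne (by simp)]; exact hh.2 k⟩

theorem eval_arguments {h : Var → A} {n : ℕ} {a : Fin n → STm S} {k : Fin n} {y : Var}
    {v : A} (ha : ∀ l, l ≠ k → ¬ (a l).Occ y) :
    (fun l => eval (starInterp I) (Function.update h y v) (Function.update a k (.var y) l)) =
      Function.update (fun l => eval (starInterp I) h (a l)) k v := by
  rw [eval_update]
  funext l
  by_cases hl : l = k
  · subst hl; simp [eval]
  · rw [Function.update_of_ne hl, Function.update_of_ne hl, eval_update_of_not_occ (ha l hl)]

theorem not_occ_arguments {n : ℕ} {a : Fin n → STm S} {k : Fin n} {x : STm S} {y : Var}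
    (h : ¬ ∃ l, (Function.update a k x l).Occ y) :
    (∀ l, l ≠ k → ¬ (a l).Occ y) ∧ ¬ x.Occ y := by
  refine ⟨fun l hl ho => h ⟨l, ?_⟩, fun ho => h ⟨k, ?_⟩⟩
  · rwa [Function.update_of_ne hl]
  · rwa [Function.update_self]

/-- The premises introduced by an approximation rule imply the original one. -/
theorem Approx.sat (hI : IsPerfectDLE I) {x : Var} {e e₁ e₂ : Ineq S} (ha : Approx x e e₁ e₂)
    {h : Var → A} (h₁ : e₁.Sat I h) (h₂ : e₂.Sat I h) : e.Sat I h := by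
  cases ha with
  | fPos i j f k hk a x =>
    refine h₁.trans ?_
    simp only [eval, eval_update]
    exact hI.star.f_mono f k _ _ _ (by rw [hk]; exact h₂)
  | fNeg i j f k hk a x =>
    refine h₁.trans ?_
    simp only [eval, eval_update]
    exact hI.star.f_mono f k _ _ _ (by rw [hk]; exact h₂)
  | gPos i j f k hk a x =>
    refine le_trans ?_ h₁
    simp only [eval, eval_update]
    exact hI.star.g_mono f k _ _ _ (by rw [hk]; exact h₂)
  | gNeg i j f k hk a x =>
    refine le_trans ?_ h₁
    simp only [eval, eval_update]
    exact hI.star.g_mono f k _ _ _ (by rw [hk]; exact h₂)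
  | andL => exact h₁.trans (inf_le_inf_right _ h₂)
  | andR => exact h₁.trans (inf_le_inf_left _ h₂)
  | orL => exact le_trans (sup_le_sup_right h₂ _) h₁
  | orR => exact le_trans (sup_le_sup_left h₂ _) h₁

/-- A value for the variable introduced by an approximation rule. -/
theorem Approx.exists_sat (hI : IsPerfectDLE I) {x : Var} {e e₁ e₂ : Ineq S}
    (ha : Approx x e e₁ e₂) (hx : ¬ e.Occ x) {h : Var → A} (hh : Admissible h)
    (he : e.Sat I h) : ∃ v, Admissible (Function.update h x v) ∧
      e₁.Sat I (Function.update h x v) ∧ e₂.Sat I (Function.update h x v) := by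
  have hP := hI.star
  simp only [Ineq.Occ, not_or] at hx
  cases ha with
  | fPos i j f k hk a x =>
    obtain ⟨h1, h2⟩ := hx
    obtain ⟨h2, h3⟩ := not_occ_arguments h2
    simp only [Ineq.Sat, eval, eval_update] at he
    -- The argument is a join of irreducibles and `f` distributes over it; as the nominal on the
    -- left is prime, it lies below the value at one of them, and that one is the witness.
    rw [hP.eq_sSup (eval (starInterp I) h x), hP.f_pos f k hk] at he
    obtain ⟨_, ⟨v, ⟨hv, hvx⟩, rfl⟩, hle⟩ := (hh.1 i).exists_le he
    refine ⟨v, hh.update_nom j hv, ?_, ?_⟩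
    · simp only [Ineq.Sat, eval_update_of_not_occ h1]
      simp only [eval, eval_arguments h2]
      exact hle
    · simp only [Ineq.Sat, eval_update_of_not_occ h3]
      simpa [eval] using hvx
  | fNeg i j f k hk a x =>
    obtain ⟨h1, h2⟩ := hx
    obtain ⟨h2, h3⟩ := not_occ_arguments h2
    simp only [Ineq.Sat, eval, eval_update] at he
    rw [hP.eq_sInf (eval (starInterp I) h x), hP.f_neg f k hk] at he
    obtain ⟨_, ⟨v, ⟨hv, hvx⟩, rfl⟩, hle⟩ := (hh.1 i).exists_le he
    refine ⟨v, hh.update_conom j hv, ?_, ?_⟩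
    · simp only [Ineq.Sat, eval_update_of_not_occ h1]
      simp only [eval, eval_arguments h2]
      exact hle
    · simp only [Ineq.Sat, eval_update_of_not_occ h3]
      simpa [eval] using hvx
  | gPos i j f k hk a x =>
    obtain ⟨h2, h1⟩ := hx
    obtain ⟨h2, h3⟩ := not_occ_arguments h2
    simp only [Ineq.Sat, eval, eval_update] at he
    rw [hP.eq_sInf (eval (starInterp I) h x), hP.g_pos f k hk] at he
    obtain ⟨_, ⟨v, ⟨hv, hvx⟩, rfl⟩, hle⟩ := (hh.2 i).exists_le he
    refine ⟨v, hh.update_conom j hv, ?_, ?_⟩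
    · simp only [Ineq.Sat, eval_update_of_not_occ h1]
      simp only [eval, eval_arguments h2]
      exact hle
    · simp only [Ineq.Sat, eval_update_of_not_occ h3]
      simpa [eval] using hvx
  | gNeg i j f k hk a x =>
    obtain ⟨h2, h1⟩ := hx
    obtain ⟨h2, h3⟩ := not_occ_arguments h2
    simp only [Ineq.Sat, eval, eval_update] at he
    rw [hP.eq_sSup (eval (starInterp I) h x), hP.g_neg f k hk] at he
    obtain ⟨_, ⟨v, ⟨hv, hvx⟩, rfl⟩, hle⟩ := (hh.2 i).exists_le he
    refine ⟨v, hh.update_nom j hv, ?_, ?_⟩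
    · simp only [Ineq.Sat, eval_update_of_not_occ h1]
      simp only [eval, eval_arguments h2]
      exact hle
    · simp only [Ineq.Sat, eval_update_of_not_occ h3]
      simpa [eval] using hvx
  | andL i j x b =>
    simp only [Tm.Occ, not_or] at hx
    obtain ⟨h1, h2, h3⟩ := hx
    -- Below a meet, the nominal on the left can itself serve as the value of the new one.
    refine ⟨h (.nom i), hh.update_nom j (hh.1 i), ?_, ?_⟩
    · simp only [Ineq.Sat, eval, eval_update_of_not_occ h3, Function.update_self,
        Function.update_of_ne h1]
      exact le_inf le_rfl (he.trans inf_le_right)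
    · simp only [Ineq.Sat, eval_update_of_not_occ h2]
      simp only [eval, Function.update_self]
      exact he.trans inf_le_left
  | andR i j x b =>
    simp only [Tm.Occ, not_or] at hx
    obtain ⟨h1, h3, h2⟩ := hx
    refine ⟨h (.nom i), hh.update_nom j (hh.1 i), ?_, ?_⟩
    · simp only [Ineq.Sat, eval, eval_update_of_not_occ h3, Function.update_self,
        Function.update_of_ne h1]
      exact le_inf (he.trans inf_le_left) le_rfl
    · simp only [Ineq.Sat, eval_update_of_not_occ h2]
      simp only [eval, Function.update_self]
      exact he.trans inf_le_right
  | orL i j x b =>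
    simp only [Tm.Occ, not_or] at hx
    obtain ⟨⟨h2, h3⟩, h1⟩ := hx
    refine ⟨h (.conom i), hh.update_conom j (hh.2 i), ?_, ?_⟩
    · simp only [Ineq.Sat, eval, eval_update_of_not_occ h3, Function.update_self,
        Function.update_of_ne h1]
      exact sup_le le_rfl (le_sup_right.trans he)
    · simp only [Ineq.Sat, eval_update_of_not_occ h2]
      simp only [eval, Function.update_self]
      exact le_sup_left.trans he
  | orR i j x b =>
    simp only [Tm.Occ, not_or] at hx
    obtain ⟨⟨h3, h2⟩, h1⟩ := hx
    refine ⟨h (.conom i), hh.update_conom j (hh.2 i), ?_, ?_⟩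
    · simp only [Ineq.Sat, eval, eval_update_of_not_occ h3, Function.update_self,
        Function.update_of_ne h1]
      exact sup_le (le_sup_left.trans he) le_rfl
    · simp only [Ineq.Sat, eval_update_of_not_occ h2]
      simp only [eval, Function.update_self]
      exact le_sup_right.trans he

theorem forall_sat_update {h : Var → A} {Γ : Multiset (Ineq S)} {x : Var}
    (hΓ : ∀ e ∈ Γ, ¬ e.Occ x) (v : A) :
    (∀ e ∈ Γ, e.Sat I (Function.update h x v)) ↔ ∀ e ∈ Γ, e.Sat I h :=
  forall₂_congr fun e he => Ineq.sat_update (hΓ e he) v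

theorem ReductionRule.sound (hI : IsPerfectDLE I) {P Q : Multiset (Quasi S)}
    (hr : ReductionRule P Q) : (∀ q ∈ P, q.Valid I) ↔ ∀ q ∈ Q, q.Valid I := by
  cases hr with
  | prem Γ c e e' hs =>
    simp only [Multiset.mem_singleton, forall_eq, Quasi.Valid, Multiset.forall_mem_cons,
      hs.sat_iff hI]
  | concl Γ e e' hs =>
    simp only [Multiset.mem_singleton, forall_eq, Quasi.Valid, hs.sat_iff hI]
  | premAnd Γ c a x y =>
    simp only [Multiset.mem_singleton, forall_eq, Quasi.Valid, Multiset.forall_mem_cons, Ineq.Sat,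
      eval, le_inf_iff, and_assoc]
  | premOr Γ c a x y =>
    simp only [Multiset.mem_singleton, forall_eq, Quasi.Valid, Multiset.forall_mem_cons, Ineq.Sat,
      eval, sup_le_iff, and_assoc]
  | conclAnd Γ a x y =>
    simp only [Multiset.insert_eq_cons, Multiset.forall_mem_cons, Multiset.mem_singleton,
      forall_eq, Quasi.Valid, Ineq.Sat, eval, le_inf_iff]
    exact ⟨fun h => ⟨fun e he hp => (h e he hp).1, fun e he hp => (h e he hp).2⟩,
      fun h e he hp => ⟨h.1 e he hp, h.2 e he hp⟩⟩
  | conclOr Γ a x y =>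
    simp only [Multiset.insert_eq_cons, Multiset.forall_mem_cons, Multiset.mem_singleton,
      forall_eq, Quasi.Valid, Ineq.Sat, eval, sup_le_iff]
    exact ⟨fun h => ⟨fun e he hp => (h e he hp).1, fun e he hp => (h e he hp).2⟩,
      fun h e he hp => ⟨h.1 e he hp, h.2 e he hp⟩⟩
  | premTaut Γ c e ht =>
    simp only [Multiset.mem_singleton, forall_eq, Quasi.Valid, Multiset.forall_mem_cons, ht.sat,
      true_and]
  | conclTaut Γ e ht =>
    simp [Quasi.Valid, ht.sat]
  | firstL Γ a b i hf =>
    simp only [Multiset.mem_singleton, forall_eq]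
    obtain ⟨hΓ, hab⟩ := hf
    simp only [Ineq.Occ, not_or] at hab
    constructor
    · intro hv h hh hp
      rw [Multiset.forall_mem_cons] at hp
      exact hp.1.trans (hv h hh hp.2)
    · intro hv h hh hp
      change eval (starInterp I) h a ≤ eval (starInterp I) h b
      -- The left side is the join of the irreducibles below it; each of them is a legitimate value
      -- for the fresh nominal.
      rw [hI.star.eq_sSup (eval (starInterp I) h a)]
      refine sSup_le fun j hj => ?_
      have := hv _ (hh.update_nom i hj.1) (by
        rw [Multiset.forall_mem_cons, forall_sat_update hΓ]
        refine ⟨?_, hp⟩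
        simp only [Ineq.Sat, eval_update_of_not_occ hab.1]
        simpa [eval] using hj.2)
      simp only [Ineq.Sat, eval_update_of_not_occ hab.2] at this
      simpa [eval] using this
  | firstR Γ a b m hf =>
    simp only [Multiset.mem_singleton, forall_eq]
    obtain ⟨hΓ, hab⟩ := hf
    simp only [Ineq.Occ, not_or] at hab
    constructor
    · intro hv h hh hp
      rw [Multiset.forall_mem_cons] at hp
      exact (hv h hh hp.2).trans hp.1
    · intro hv h hh hp
      change eval (starInterp I) h a ≤ eval (starInterp I) h b
      rw [hI.star.eq_sInf (eval (starInterp I) h b)]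
      refine le_sInf fun j hj => ?_
      have := hv _ (hh.update_conom m hj.1) (by
        rw [Multiset.forall_mem_cons, forall_sat_update hΓ]
        refine ⟨?_, hp⟩
        simp only [Ineq.Sat, eval_update_of_not_occ hab.2]
        simpa [eval] using hj.2)
      simp only [Ineq.Sat, eval_update_of_not_occ hab.1] at this
      simpa [eval] using this
  | approx Γ c e e₁ e₂ x ha hf =>
    simp only [Multiset.mem_singleton, forall_eq]
    obtain ⟨hΓ, hc⟩ := hf
    constructor
    · intro hv h hh hp
      simp only [Multiset.forall_mem_cons] at hp
      exact hv h hh (Multiset.forall_mem_cons.2 ⟨ha.sat hI hp.1 hp.2.1, hp.2.2⟩)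
    · intro hv h hh hp
      simp only [Multiset.forall_mem_cons] at hp hΓ
      obtain ⟨v, hadm, h1, h2⟩ := ha.exists_sat hI hΓ.1 hh hp.1
      have := hv _ hadm (by
        simp only [Multiset.forall_mem_cons, forall_sat_update hΓ.2]
        exact ⟨h1, h2, hp.2⟩)
      exact (Ineq.sat_update hc v).1 this

theorem sat_subst {h : Var → A} {x : Var} {r : STm S} {e : Ineq S} :
    (Ineq.subst x r e).Sat I h ↔
      e.Sat I (Function.update h x (eval (starInterp I) h r)) := by
  simp only [Ineq.Sat, Ineq.subst, eval_subst]

theorem ordLe_eval_update (hI : IsPerfectDLE I) {h : Var → A} {p : ℕ} {v : A} {σ τ : Pol}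
    {t : STm S} (hv : OrdLe σ v (h (.prop p))) (ht : ¬ t.OccS (.prop p) σ.op τ) :
    OrdLe τ (eval (starInterp I) (Function.update h (.prop p) v) t) (eval (starInterp I) h t) := by
  refine eval_mono hI.star fun x ρ ho => ?_
  by_cases hx : x = .prop p
  · subst hx
    rw [Function.update_self]
    obtain rfl : ρ = σ := by
      by_contra hne
      exact ht (Pol.eq_op_of_ne (Ne.symm hne) ▸ ho)
    exact hv
  · rw [Function.update_of_ne hx]; exact OrdLe.refl _ _

theorem Substitutable.sat_update (hI : IsPerfectDLE I) {σ : Pol} {p : ℕ} {e : Ineq S}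
    (he : Substitutable σ p e) {h : Var → A} {v : A} (hv : OrdLe σ v (h (.prop p)))
    (hs : e.Sat I h) : e.Sat I (Function.update h (.prop p) v) := by
  have h1 : ¬ e.lhs.OccS (.prop p) σ.op .pos ∧ ¬ e.rhs.OccS (.prop p) σ.op .neg := by
    rw [show Pol.neg = Pol.pos.op from rfl, occS_op, Pol.op_op]
    cases σ <;> exact he
  have hl : eval (starInterp I) (Function.update h (.prop p) v) e.lhs ≤
    eval (starInterp I) h e.lhs := ordLe_eval_update hI hv h1.1
  have hr : eval (starInterp I) h e.rhs ≤ eval (starInterp I) (Function.update h (.prop p) v) e.rhs :=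
    ordLe_eval_update hI hv h1.2
  exact hl.trans (hs.trans hr)

theorem ordLe_bigJoin {h : Var → A} {σ : Pol} {l : List (STm S)} {b : STm S} :
    OrdLe σ (eval (starInterp I) h (bigJoin σ l)) (eval (starInterp I) h b) ↔
      ∀ a ∈ l, (sle σ a b).Sat I h := by
  induction l with
  | nil =>
    simp only [List.not_mem_nil, false_imp_iff, implies_true, iff_true]
    cases σ
    · exact bot_le
    · exact le_top
  | cons a l ih =>
    rw [List.forall_mem_cons, ← ih]
    cases σ
    · exact sup_le_iff
    · exact le_inf_iff

/-- The join or meet of the bounds is the extreme value of `p` that satisfies them. Taking it as the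
value of `p` proves one direction; for the other, moving `p` to this value preserves the premises in
`Γ` by monotonicity and leaves the conclusion unchanged. -/
theorem ackermann_sound (hI : IsPerfectDLE I) (σ : Pol) (p i m : ℕ) (α : List (STm S))
    (Γ : Multiset (Ineq S)) (hα : ∀ a ∈ α, ¬ a.Occ (.prop p))
    (hΓ : ∀ e ∈ Γ, Substitutable σ p e) :
    Quasi.Valid I ⟨(α.map fun a => sle σ a (.var (.prop p)) : Multiset (Ineq S)) + Γ,
        ⟨.var (.nom i), .var (.conom m)⟩⟩ ↔
      Quasi.Valid I ⟨Γ.map (Ineq.subst (.prop p) (bigJoin σ α)),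
        ⟨.var (.nom i), .var (.conom m)⟩⟩ := by
  have hr : ¬ (bigJoin σ α).Occ (.prop p) := fun h => by
    obtain ⟨a, ha, h⟩ := occ_bigJoin h; exact hα a ha h
  have hc : ¬ (⟨.var (.nom i), .var (.conom m)⟩ : Ineq S).Occ (.prop p) :=
    fun h => h.elim (fun h => by cases h) (fun h => by cases h)
  constructor
  · intro hv h hh hp
    refine (Ineq.sat_update hc _).1
      (hv _ (hh.update_prop p (eval (starInterp I) h (bigJoin σ α))) fun e he => ?_)
    rcases Multiset.mem_add.1 he with he | he
    · obtain ⟨a, ha, rfl⟩ := List.mem_map.1 (Multiset.mem_coe.1 he)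
      refine ordLe_bigJoin.1 ?_ a ha
      rw [eval_update_of_not_occ hr]
      simp only [eval, Function.update_self]
      exact OrdLe.refl _ _
    · exact sat_subst.1 (hp _ (Multiset.mem_map_of_mem _ he))
  · intro hv h hh hp
    refine hv h hh fun e he => ?_
    obtain ⟨e, heΓ, rfl⟩ := Multiset.mem_map.1 he
    refine sat_subst.2 ((hΓ e heΓ).sat_update hI ?_ (hp e (Multiset.mem_add.2 (.inr heΓ))))
    exact ordLe_bigJoin (b := .var (.prop p)).2 fun a ha => hp _
      (Multiset.mem_add.2 (.inl (Multiset.mem_coe.2 (List.mem_map.2 ⟨a, ha, rfl⟩))))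

theorem EliminationRule.sound (hI : IsPerfectDLE I) {P Q : Multiset (Quasi S)}
    (hr : EliminationRule P Q) : (∀ q ∈ P, q.Valid I) ↔ ∀ q ∈ Q, q.Valid I := by
  have hvar : ∀ (σ : Pol) (a b r : STm S) (p : ℕ),
      (∀ (h : Var → A) (c : A), OrdLe σ (eval (starInterp I) h r) c) →
      Substitutable σ.op p ⟨a, b⟩ →
      (Quasi.Valid I ⟨0, ⟨a, b⟩⟩ ↔ Quasi.Valid I ⟨0, Ineq.subst (.prop p) r ⟨a, b⟩⟩) := by
    intro σ a b r p hr hs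
    constructor
    · exact fun hv h hh _ => sat_subst.2 (hv _ (hh.update_prop p _) (by simp))
    · intro hv h hh _
      -- The inequality holds with the letter at the extreme value `r`; by its polarity it persists
      -- when the letter moves back to its original value.
      have h1 := sat_subst.1 (hv h hh (by simp))
      have h2 := hs.sat_update hI (v := h (.prop p))
        (by rw [Function.update_self, ordLe_op]; exact hr h _) h1
      rwa [Function.update_idem, Function.update_eq_self] at h2
  cases hr with
  | varBot a b p ha hb =>
    simp only [Multiset.mem_singleton, forall_eq]
    exact hvar .pos a b .bot p (fun _ _ => bot_le) ⟨ha, hb⟩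
  | varTop a b p ha hb =>
    simp only [Multiset.mem_singleton, forall_eq]
    exact hvar .neg a b .top p (fun _ _ => le_top) ⟨ha, hb⟩
  | rightAckermann p i m α Γ hα hΓ =>
    simp only [Multiset.mem_singleton, forall_eq]
    exact ackermann_sound hI .pos p i m α Γ hα hΓ
  | leftAckermann p i m α Γ hα hΓ =>
    simp only [Multiset.mem_singleton, forall_eq]
    exact ackermann_sound hI .neg p i m α Γ hα hΓ

theorem AlbaStep.sound (hI : IsPerfectDLE I) {X Y : Multiset (Quasi S)} (hs : AlbaStep X Y) :
    (∀ q ∈ X, q.Valid I) ↔ ∀ q ∈ Y, q.Valid I := by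
  obtain ⟨P, Q, R, h, rfl, rfl⟩ := hs
  have hPQ : (∀ q ∈ P, q.Valid I) ↔ ∀ q ∈ Q, q.Valid I := by
    rcases h with h | h | h
    exacts [h.sound hI, (h.sound hI).symm, h.sound hI]
  simp only [Multiset.mem_add, or_imp, forall_and, hPQ]

theorem steps_sound (hI : IsPerfectDLE I) {X Y : Multiset (Quasi S)}
    (hs : Relation.ReflTransGen AlbaStep X Y) :
    (∀ q ∈ X, q.Valid I) ↔ ∀ q ∈ Y, q.Valid I := by
  induction hs with
  | refl => rfl
  | tail _ h ih => exact ih.trans (h.sound hI)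

theorem toQuasi_valid {e : Ineq S} : e.toQuasi.Valid I ↔ e.Valid I := by
  simp [Quasi.Valid, Ineq.toQuasi, Ineq.Valid, Ineq.Sat]

theorem eval_emb (h : Var → A) (t : Tm S ℕ) :
    eval (starInterp I) h (emb t) = eval I (fun n => h (.prop n)) t := by
  induction t with
  | var p => rfl
  | bot => rfl
  | top => rfl
  | and a b iha ihb => simp only [emb, eval, iha, ihb]
  | or a b iha ihb => simp only [emb, eval, iha, ihb]
  | fapp f a ih => simp only [emb, eval, ih]; rfl
  | gapp g a ih => simp only [emb, eval, ih]; rfl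

/-- An assignment of the letters has to be extended to nominals and conominals, which needs
irreducible elements. They exist in a nontrivial perfect algebra, since otherwise ⊤ would be an
empty join or ⊥ an empty meet; the one-element algebra validates everything. -/
theorem valid_emb_iff (hI : IsPerfectDLE I) {s t : Tm S ℕ} :
    Ineq.Valid I ⟨emb s, emb t⟩ ↔ ValidBase I s t := by
  simp only [Ineq.Valid, ValidBase, eval_emb]
  constructor
  · intro hv h
    rcases subsingleton_or_nontrivial A with hA | hA
    · exact (Subsingleton.elim _ _).le
    · have hj : ∃ j : A, ComplJoinIrred j := by
        by_contra! hn
        have := hI.eq_sSup (⊤ : A)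
        simp [hn] at this
      have hm : ∃ m : A, ComplMeetIrred m := by
        by_contra! hn
        have := hI.eq_sInf (⊥ : A)
        simp [hn] at this
      obtain ⟨j, hj⟩ := hj
      obtain ⟨m, hm⟩ := hm
      exact hv (fun x => match x with
        | .prop n => h n
        | .nom _ => j
        | .conom _ => m) ⟨fun _ => hj, fun _ => hm⟩
  · exact fun hv h _ => hv _

theorem equivalentOnPerfect_of_steps {s t : Tm S ℕ} {Λ : Multiset (Ineq S)}
    (hs : AlbaReduces s t Λ) : EquivalentOnPerfect.{u, v, w} s t Λ := by
  intro A _ I hI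
  have := steps_sound hI hs
  simp only [Multiset.mem_singleton, forall_eq, Multiset.mem_map, forall_exists_index, and_imp,
    forall_apply_eq_imp_iff₂, toQuasi_valid, valid_emb_iff hI] at this
  exact this

end Soundness

theorem AlbaReduces.interderivable {S : DLESig.{u, v}} {s t : Tm S ℕ} {Λ : Multiset (Ineq S)}
    (h : AlbaReduces s t Λ) : AlbaInterderivable s t Λ := by
  unfold AlbaReduces at h
  unfold AlbaInterderivable
  generalize Λ.map Ineq.toQuasi = Y at h ⊢
  induction h with
  | refl => exact .refl _
  | tail _ h ih => exact .trans _ _ _ ih (.rel _ _ h)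

end DLE

theorem mainTheorem8 (S : DLE.DLESig.{u, v}) (Ω : ℕ → ℕ → Prop)
    (hirr : ∀ p, ¬ Ω p p) (htrans : ∀ p q r, Ω p q → Ω q r → Ω p r)
    (ε : ℕ → DLE.Pol) (π : DLE.Pol) (s t : DLE.Tm S ℕ) :
    (DLE.RestrictedLeftAnalytic Ω ε π s t ∨ DLE.RestrictedRightAnalytic Ω ε π s t →
      ∃ Λ : Multiset (DLE.Ineq S),
        (∀ e ∈ Λ, e.Pure) ∧
        (π = DLE.Pol.neg → ∀ e ∈ Λ, e.LeftPrimitive) ∧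
        (π = DLE.Pol.pos → ∀ e ∈ Λ, e.RightPrimitive) ∧
        DLE.AlbaReduces s t Λ ∧ DLE.EquivalentOnPerfect.{u, v, w} s t Λ) ∧
    (DLE.RestrictedLeftAnalytic Ω ε π s t →
      ∃ Λ : Multiset (DLE.Ineq S),
        (∀ e ∈ Λ, e.Pure ∧ e.LeftPrimitive) ∧
        DLE.AlbaInterderivable s t Λ ∧ DLE.EquivalentOnPerfect.{u, v, w} s t Λ) ∧
    (DLE.RestrictedRightAnalytic Ω ε π s t →
      ∃ Λ : Multiset (DLE.Ineq S),
        (∀ e ∈ Λ, e.Pure ∧ e.RightPrimitive) ∧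
        DLE.AlbaInterderivable s t Λ ∧ DLE.EquivalentOnPerfect.{u, v, w} s t Λ) := by
  refine ⟨fun h => ?_, fun h => ?_, fun h => ?_⟩
  · obtain ⟨Λ, hΛ, hs⟩ := (DLE.red_sPrimitive hirr htrans h).exists_family
    refine ⟨Λ, fun e he => (hΛ e he).1, ?_, ?_, hs, DLE.equivalentOnPerfect_of_steps hs⟩
    · rintro rfl e he; exact (hΛ e he).2
    · rintro rfl e he; exact (hΛ e he).2
  -- The exchange uses reduction rules only, so the elimination rules are never reversed: the
  -- derivation obtained is an ALBA-reduction, which is more than interderivability.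
  · obtain ⟨Λ, hΛ, hs⟩ :=
      (DLE.red_sPrimitive_of_sign hirr htrans (.inl h) .neg).exists_family
    exact ⟨Λ, hΛ, DLE.AlbaReduces.interderivable hs, DLE.equivalentOnPerfect_of_steps hs⟩
  · obtain ⟨Λ, hΛ, hs⟩ :=
      (DLE.red_sPrimitive_of_sign hirr htrans (.inr h) .pos).exists_family
    exact ⟨Λ, hΛ, DLE.AlbaReduces.interderivable hs, DLE.equivalentOnPerfect_of_steps hs⟩
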